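/- **Conventions.** $\kappa$ is the security parameter, $f=\tilde O(g)$ means $f=O(g\cdot\log^{d} g)$ for some constant $d$, and all asymptotics are for $\kappa\to\infty$. Algorithms are uniform; randomized algorithms use fair coins. Adversaries (distinguishers and pirates) are either all uniform probabilistic algorithms, or all non-uniform ones (with an advice string of length $\mathrm{poly}(\kappa)$); the theorem holds for each of the two choices, made once for hypothesis and conclusion. **Local PRG.** A polynomial-time computable $G=\{G_\kappa\colon\{0,1\}^\kappa\to\{0,1\}^{\ell(\kappa)}\}$ is an $(\varepsilon,\ell,L)$-local pseudorandom generator if every output bit depends on at most $L$ bits of the input and for every $\mathrm{poly}(\ell(\kappa))$-time adversary $A$, for all sufficiently large $\kappa$, $|\Pr[A(G(U_\kappa))=1]-\Pr[A(U_{\ell(\kappa)})=1]|\le\varepsilon(\kappa)$. **Traitor tracing.** An $(n,k)$-traitor-tracing scheme consists of algorithms $\mathsf{Gen},\mathsf{Enc},\mathsf{Dec},\mathsf{Trace}$ that run in time $\mathrm{poly}(\kappa,n(\kappa))$ ($\mathrm{poly}(\kappa,n(\kappa),k(\kappa))$ for $\mathsf{Trace}$), all randomized except $\mathsf{Dec}$: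 $\mathsf{Gen}(1^\kappa)$ returns $n=n(\kappa)$ user keys $\vec{sk}=(sk_1,\dots,sk_n)$, $sk_i\in\{0,1\}^\kappa$; $\mathsf{Enc}(\vec{sk},b)$ returns a ciphertext $c\in\mathcal C^{(\kappa)}=\{0,1\}^{m(\kappa)}$ of the bit $b$; $\mathsf{Dec}(sk,c)$ returns a bit; and $\mathsf{Dec}(sk_i,\mathsf{Enc}(\vec{sk},b))=b$ always, for keys from $\mathsf{Gen}$. $\mathsf{Trace}^{\mathcal P}(\vec{sk})$ asks its oracle $\mathcal P$ one tuple of $k=k(\kappa)$ ciphertexts, gets $k$ bits, and returns a user $i\in[n]$. A pirate is a randomized algorithm $\mathcal P$ running in time $\mathrm{poly}(\kappa,n(\kappa),k(\kappa))$ that takes the keys $\vec{sk}_S=(sk_i)_{i\in S}$ of a set $S$ of users and $k$ ciphertexts and returns $k$ bits. It is *available* if there is $\delta(\kappa)=o(1/n(\kappa)^2)$ such that for all $\kappa$, all $\vec{sk}\in(\{0,1\}^\kappa)^n$, all $S\subseteq[n]$ with $|S|\ge n-1$ and all $c_1,\dots,c_k\in\mathcal C^{(\kappa)}$, the probability that for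 some $j\in[k]$ and some bit $b$ every $i\in S$ has $\mathsf{Dec}(sk_i,c_j)=b$ but the $j$-th bit of $\mathcal P(\vec{sk}_S,c_1,\dots,c_k)$ is not $b$, is at most $\delta(\kappa)$. The scheme is *secure* if for every available pirate $\mathcal P$ and all sets $S=S(\kappa)\subseteq[n(\kappa)]$ with $|S|\ge n(\kappa)-1$, $$\Pr_{\vec{sk}\leftarrow\mathsf{Gen}(1^\kappa)}\big[\mathsf{Trace}^{\mathcal P(\vec{sk}_S,\cdot)}(\vec{sk})\notin S\big]=o(1/n(\kappa)).$$ Its decryption function family is $\mathcal Q^{(\kappa)}=\{q_c\}_{c\in\mathcal C^{(\kappa)}}$, where $q_c\colon\{0,1\}^\kappa\to\{0,1\}$, $q_c(sk)=\mathsf{Dec}(sk,c)$. **Corollary 5.9.** Let $n=n(\kappa)$ be any nonconstant polynomial in $\kappa$ (with rational coefficients and values in $\mathbb N$). If for some constant $L\in\mathbb N$ and some $\varepsilon(\kappa)=o(1/n(\kappa)^2)$ there is an $(\varepsilon,n^7,L)$-local pseudorandom generator, then for some $k=\tilde O(n^2)$ there is a secure $(n,k)$-traitor-tracing scheme for which every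 function in the decryption function family $\mathcal Q^{(\kappa)}$ is computed by a Boolean circuit over $\{\wedge,\vee,\neg\}$ with unbounded fan-in, of size $\tilde O(n)\cdot\mathrm{poly}(\kappa)$ and depth at most $6$. -/

import Mathlib

open Filter Asymptotics Polynomial

/-! ## Bit strings and probabilities over fair coins -/

/-- Bit strings of length `m`. -/
abbrev Bits (m : ℕ) : Type := Fin m → Bool

open Classical in
/-- Probability of the event `E` when `ω` is uniform on the finite type `Ω`. -/
noncomputable def prob {Ω : Type} [Fintype Ω] (E : Ω → Prop) : ℝ :=
  ((Finset.univ.filter E).card : ℝ) / (Fintype.card Ω : ℝ)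

/-! ## A step-counting model of computation

The programs are the WHILE programs over binary trees (all data is built from `nil` and `cons`).
Every elementary operation costs one step (trees are handled by pointers, as in LISP), and
polynomial time in this model is polynomial time on Turing machines. -/

/-- Binary trees. -/
inductive Data : Type
  | nil : Data
  | cons : Data → Data → Data

namespace Data

/-- Left subtree (`nil` for `nil`). -/
def fst : Data → Data
  | nil => nil
  | cons a _ => a

/-- Right subtree (`nil` for `nil`). -/
def snd : Data → Data
  | nil => nil
  | cons _ b => b

/-- Lists of trees as trees. -/
def ofList : List Data → Data
  | [] => nil
  | a :: l => cons a (ofList l)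

/-- Bits as trees. -/
def ofBool : Bool → Data
  | false => nil
  | true => cons nil nil

/-- The number `m` in unary. -/
def unary (m : ℕ) : Data := ofList (List.replicate m (ofBool true))

/-- Finite sequences of bits as trees. -/
def ofBoolList (l : List Bool) : Data := ofList (l.map ofBool)

/-- Bit strings as trees. -/
def ofBits {m : ℕ} (x : Bits m) : Data := ofBoolList (List.ofFn x)

/-- Sequences of bit strings as trees. -/
def ofBitsSeq {a m : ℕ} (x : Fin a → Bits m) : Data :=
  ofList (List.ofFn fun i => ofBits (x i))

/-- A bit string that may be missing. -/
def ofOptionBits {m : ℕ} : Option (Bits m) → Data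
  | none => nil
  | some x => cons nil (ofBits x)

/-- Sequences of bit strings some of which may be missing. -/
def ofPartialSeq {a m : ℕ} (x : Fin a → Option (Bits m)) : Data :=
  ofList (List.ofFn fun i => ofOptionBits (x i))

end Data

/-- WHILE programs. Each program transforms one tree into another; `nil` counts as false and every
other tree as true. -/
inductive Prog : Type
  | id : Prog
  | nil : Prog
  | fst : Prog
  | snd : Prog
  /-- run both programs on the input and join the results by `cons` -/
  | pair : Prog → Prog → Prog
  /-- run the first program, then run the second one on its result -/
  | seq : Prog → Prog → Prog
  /-- `cond b f g`: if `b` then `f` else `g` -/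
  | cond : Prog → Prog → Prog → Prog
  /-- `loop b f`: while `b` do `f` -/
  | loop : Prog → Prog → Prog

/-- `Runs p x y t`: on input `x` the program `p` halts after exactly `t` steps with output `y`. -/
inductive Prog.Runs : Prog → Data → Data → ℕ → Prop
  | id (x : Data) : Runs .id x x 1
  | nil (x : Data) : Runs .nil x .nil 1
  | fst (x : Data) : Runs .fst x x.fst 1
  | snd (x : Data) : Runs .snd x x.snd 1
  | pair {f g : Prog} {x y z : Data} {s t : ℕ} :
      Runs f x y s → Runs g x z t → Runs (.pair f g) x (.cons y z) (s + t + 1)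
  | seq {f g : Prog} {x y z : Data} {s t : ℕ} :
      Runs f x y s → Runs g y z t → Runs (.seq f g) x z (s + t + 1)
  | cond_true {b f g : Prog} {x u v y : Data} {r s : ℕ} :
      Runs b x (.cons u v) r → Runs f x y s → Runs (.cond b f g) x y (r + s + 1)
  | cond_false {b f g : Prog} {x y : Data} {r s : ℕ} :
      Runs b x .nil r → Runs g x y s → Runs (.cond b f g) x y (r + s + 1)
  | loop_stop {b f : Prog} {x : Data} {r : ℕ} :
      Runs b x .nil r → Runs (.loop b f) x x (r + 1)
  | loop_step {b f : Prog} {x u v y z : Data} {r s t : ℕ} :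
      Runs b x (.cons u v) r → Runs f x y s → Runs (.loop b f) y z t →
      Runs (.loop b f) x z (r + s + t + 1)

/-- On input `x` the program `p` outputs `y` within `T` steps. -/
def Prog.ComputesIn (p : Prog) (x y : Data) (T : ℕ) : Prop :=
  ∃ t ≤ T, p.Runs x y t

/-- Uniform adversaries, or non-uniform ones (which get an advice string of polynomial length
for every value of the security parameter). -/
inductive AdversaryModel : Type
  | uniform : AdversaryModel
  | nonuniform : AdversaryModel

/-- The advice sequences that a model allows. -/
def AdversaryModel.Allows : AdversaryModel → (ℕ → List Bool) → Prop
  | .uniform, a => ∀ κ, a κ = []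
  | .nonuniform, a => ∃ d : ℕ, ∀ κ, (a κ).length ≤ (κ + 2) ^ d

/-! ## Local pseudorandom generators -/

/-- A probabilistic polynomial-time distinguisher for strings of length `ℓ κ`: it runs in time
`poly(ℓ κ)`, and may use one coin for every step. -/
structure Distinguisher (M : AdversaryModel) (ℓ : ℕ → ℕ) where
  e : ℕ
  prog : Prog
  advice : ℕ → List Bool
  advice_ok : M.Allows advice
  run : (κ : ℕ) → Bits ((ℓ κ + 2) ^ e) → Bits (ℓ κ) → Bool
  computes : ∀ (κ : ℕ) (ω : Bits ((ℓ κ + 2) ^ e)) (y : Bits (ℓ κ)),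
    prog.ComputesIn
      (Data.ofList [Data.unary κ, Data.ofBoolList (advice κ), Data.ofBits ω, Data.ofBits y])
      (Data.ofBool (run κ ω y)) ((ℓ κ + 2) ^ e)

/-- The advantage of a distinguisher in telling `G(U_κ)` from `U_{ℓ κ}`. -/
noncomputable def Distinguisher.advantage {M : AdversaryModel} {ℓ : ℕ → ℕ}
    (A : Distinguisher M ℓ) (G : (κ : ℕ) → Bits κ → Bits (ℓ κ)) (κ : ℕ) : ℝ :=
  |prob (fun q : Bits ((ℓ κ + 2) ^ A.e) × Bits κ => A.run κ q.1 (G κ q.2) = true)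
    - prob (fun q : Bits ((ℓ κ + 2) ^ A.e) × Bits (ℓ κ) => A.run κ q.1 q.2 = true)|

/-- `G` is an `(ε, ℓ, L)`-local pseudorandom generator: it is computable in polynomial time, every
polynomial-time distinguisher has advantage at most `ε κ` (for all sufficiently large `κ`), and each
output bit depends on at most `L` bits of the seed. -/
structure IsLocalPRG (M : AdversaryModel) (ε : ℕ → ℝ) (ℓ : ℕ → ℕ) (L : ℕ)
    (G : (κ : ℕ) → Bits κ → Bits (ℓ κ)) : Prop where
  efficient : ∃ (p : Prog) (d : ℕ), ∀ (κ : ℕ) (s : Bits κ),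
    p.ComputesIn (Data.ofBits s) (Data.ofBits (G κ s)) ((κ + 2) ^ d)
  pseudorandom : ∀ A : Distinguisher M ℓ, ∀ᶠ κ in atTop, A.advantage G κ ≤ ε κ
  isLocal : ∀ (κ : ℕ) (j : Fin (ℓ κ)), ∃ I : Finset (Fin κ), I.card ≤ L ∧
    ∀ s s' : Bits κ, (∀ i ∈ I, s i = s' i) → G κ s j = G κ s' j

/-! ## Traitor-tracing schemes -/

/-- An `(n, k)`-traitor-tracing scheme (the syntax, with perfectly correct decryption). Keys are in
`{0,1}^κ` and ciphertexts in `{0,1}^(clen κ)`. Randomized algorithms get a string of fair coins as an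
additional input. The tracing algorithm asks its oracle one `k`-tuple of ciphertexts, so it consists
of two stages, `query` and `trace`, that share their coins; its output is the name of a user.
All algorithms are uniform and run in time polynomial in `κ`, `n κ` (and `k κ`, for tracing). -/
structure TTScheme (n k : ℕ → ℕ) where
  clen : ℕ → ℕ
  e : ℕ
  gen : (κ : ℕ) → Bits ((κ + n κ + 2) ^ e) → Fin (n κ) → Bits κ
  enc : (κ : ℕ) → Bits ((κ + n κ + 2) ^ e) → (Fin (n κ) → Bits κ) → Bool → Bits (clen κ)
  dec : (κ : ℕ) → Bits κ → Bits (clen κ) → Bool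
  query : (κ : ℕ) → Bits ((κ + n κ + k κ + 2) ^ e) → (Fin (n κ) → Bits κ) →
    Fin (k κ) → Bits (clen κ)
  trace : (κ : ℕ) → Bits ((κ + n κ + k κ + 2) ^ e) → (Fin (n κ) → Bits κ) → Bits (k κ) → ℕ
  /-- the output is one of the users `0, …, n κ - 1` (if there are users at all) -/
  trace_lt : ∀ κ ω sk a, 0 < n κ → trace κ ω sk a < n κ
  correct : ∀ κ ω ω' b i, dec κ (gen κ ω i) (enc κ ω' (gen κ ω) b) = b
  genProg : Prog
  gen_computes : ∀ κ ω, genProg.ComputesIn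
    (Data.ofList [Data.unary κ, Data.ofBits ω])
    (Data.ofBitsSeq (gen κ ω)) ((κ + n κ + 2) ^ e)
  encProg : Prog
  enc_computes : ∀ κ ω sk b, encProg.ComputesIn
    (Data.ofList [Data.unary κ, Data.ofBits ω, Data.ofBitsSeq sk, Data.ofBool b])
    (Data.ofBits (enc κ ω sk b)) ((κ + n κ + 2) ^ e)
  decProg : Prog
  dec_computes : ∀ κ sk c, decProg.ComputesIn
    (Data.ofList [Data.unary κ, Data.ofBits sk, Data.ofBits c])
    (Data.ofBool (dec κ sk c)) ((κ + n κ + 2) ^ e)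
  queryProg : Prog
  query_computes : ∀ κ ω sk, queryProg.ComputesIn
    (Data.ofList [Data.unary κ, Data.ofBits ω, Data.ofBitsSeq sk])
    (Data.ofBitsSeq (query κ ω sk)) ((κ + n κ + k κ + 2) ^ e)
  traceProg : Prog
  trace_computes : ∀ κ ω sk a, traceProg.ComputesIn
    (Data.ofList [Data.unary κ, Data.ofBits ω, Data.ofBitsSeq sk, Data.ofBits a])
    (Data.unary (trace κ ω sk a)) ((κ + n κ + k κ + 2) ^ e)

/-- The keys `sk_S = (sk_i)_{i ∈ S}` of a coalition `S`. -/
def keysOf {a m : ℕ} (S : Finset (Fin a)) (sk : Fin a → Bits m) : Fin a → Option (Bits m) :=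
  fun i => if i ∈ S then some (sk i) else none

/-- A (possibly randomized) algorithm that takes the keys of a coalition and `k κ` ciphertexts, runs
in time polynomial in `κ`, `n κ`, `k κ`, and returns `k κ` bits. -/
structure Pirate (M : AdversaryModel) {n k : ℕ → ℕ} (T : TTScheme n k) where
  e : ℕ
  prog : Prog
  advice : ℕ → List Bool
  advice_ok : M.Allows advice
  run : (κ : ℕ) → Bits ((κ + n κ + k κ + 2) ^ e) → (Fin (n κ) → Option (Bits κ)) →
    (Fin (k κ) → Bits (T.clen κ)) → Bits (k κ)
  computes : ∀ κ ω skS c, prog.ComputesIn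
    (Data.ofList [Data.unary κ, Data.ofBoolList (advice κ), Data.ofBits ω,
      Data.ofPartialSeq skS, Data.ofBitsSeq c])
    (Data.ofBits (run κ ω skS c)) ((κ + n κ + k κ + 2) ^ e)

/-- Availability: for all keys, all coalitions of at least `n κ - 1` users and all ciphertexts, with
probability `1 - o(1/n^2)` the pirate returns the bit `b` on each ciphertext that every user of
the coalition decrypts to `b`. -/
def Pirate.Available {M : AdversaryModel} {n k : ℕ → ℕ} {T : TTScheme n k}
    (P : Pirate M T) : Prop :=
  ∃ δ : ℕ → ℝ, δ =o[atTop] (fun κ => 1 / (n κ : ℝ) ^ 2) ∧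
    ∀ (κ : ℕ) (sk : Fin (n κ) → Bits κ) (S : Finset (Fin (n κ))), n κ ≤ S.card + 1 →
      ∀ c : Fin (k κ) → Bits (T.clen κ),
        prob (fun ω => ∃ (j : Fin (k κ)) (b : Bool),
          (∀ i ∈ S, T.dec κ (sk i) (c j) = b) ∧ P.run κ ω (keysOf S sk) c j ≠ b) ≤ δ κ

/-- The probability that tracing the pirate with the keys of `S` does not return a user in `S`. -/
noncomputable def TTScheme.failure {M : AdversaryModel} {n k : ℕ → ℕ} (T : TTScheme n k)
    (P : Pirate M T) (κ : ℕ) (S : Finset (Fin (n κ))) : ℝ :=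
  prob (fun q : Bits ((κ + n κ + 2) ^ T.e) × Bits ((κ + n κ + k κ + 2) ^ T.e) ×
      Bits ((κ + n κ + k κ + 2) ^ P.e) =>
    ¬ ∃ i ∈ S, (i : ℕ) = T.trace κ q.2.1 (T.gen κ q.1)
      (P.run κ q.2.2 (keysOf S (T.gen κ q.1)) (T.query κ q.2.1 (T.gen κ q.1))))

/-- Security of a traitor-tracing scheme. -/
def TTScheme.Secure (M : AdversaryModel) {n k : ℕ → ℕ} (T : TTScheme n k) : Prop :=
  ∀ P : Pirate M T, P.Available →
    ∀ S : (κ : ℕ) → Finset (Fin (n κ)), (∀ κ, n κ ≤ (S κ).card + 1) →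
      (fun κ => T.failure P κ (S κ)) =o[atTop] (fun κ => 1 / (n κ : ℝ))

/-! ## Boolean circuits with unbounded fan-in -/

/-- A gate whose arguments are taken from `α`. -/
inductive Gate (α : Type) : Type
  | not : α → Gate α
  | and : List α → Gate α
  | or : List α → Gate α

namespace Gate

def args {α : Type} : Gate α → List α
  | not a => [a]
  | and l => l
  | or l => l

def eval {α : Type} (v : α → Bool) : Gate α → Bool
  | not a => !(v a)
  | and l => l.all v
  | or l => l.any v

end Gate

/-- A circuit with one output and inputs indexed by `α`: the arguments of a gate are inputs or
earlier gates. -/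
structure Circuit (α : Type) where
  numGates : ℕ
  gate : (j : Fin numGates) → Gate (α ⊕ Fin j.val)
  output : α ⊕ Fin numGates

namespace Circuit

/-- The value of gate `j` on input `x`. -/
def value {α : Type} (C : Circuit α) (x : α → Bool) (j : Fin C.numGates) : Bool :=
  (C.gate j).eval (Sum.elim x fun i => C.value x ⟨i.val, i.isLt.trans j.isLt⟩)
termination_by j.val
decreasing_by exact i.isLt

/-- The function that the circuit computes. -/
def eval {α : Type} (C : Circuit α) (x : α → Bool) : Bool :=
  Sum.elim x (C.value x) C.output

/-- The number of gates (negations included) on a longest path that ends in gate `j`. -/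
def gateDepth {α : Type} (C : Circuit α) (j : Fin C.numGates) : ℕ :=
  1 + ((C.gate j).args.map
    (Sum.elim (fun _ => 0) fun i => C.gateDepth ⟨i.val, i.isLt.trans j.isLt⟩)).foldr max 0
termination_by j.val
decreasing_by exact i.isLt

def depth {α : Type} (C : Circuit α) : ℕ :=
  Sum.elim (fun _ => 0) C.gateDepth C.output

/-- The number of gates and wires. -/
def size {α : Type} (C : Circuit α) : ℕ :=
  ∑ j, (1 + (C.gate j).args.length)

end Circuit

/-- Every function `q_c = dec(·, c)` of the decryption function family is computed by a circuit of
size at most `s κ` and depth at most `h`. -/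
def TTScheme.DecCircuits {n k : ℕ → ℕ} (T : TTScheme n k) (s : ℕ → ℕ) (h : ℕ) : Prop :=
  ∀ (κ : ℕ) (c : Bits (T.clen κ)), ∃ C : Circuit (Fin κ),
    C.size ≤ s κ ∧ C.depth ≤ h ∧ ∀ sk : Bits κ, C.eval sk = T.dec κ sk c

/-- `f = Õ(g)`. -/
def IsSoftO (f g : ℕ → ℝ) : Prop :=
  ∃ d : ℕ, f =O[atTop] (fun κ => g κ * Real.log (g κ) ^ d)

/-! Every key is split into a seed and a label, and the generator expands the seed to a string of
pads. A ciphertext names a position `p` and carries, for every user, the label of that user and a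
bit masked with bit `p` of that user's pads; decryption looks up its own label and removes the mask.
For a fixed ciphertext this is a disjunction over `n` slots of a label test and a condition on a
single output bit of the generator. Locality turns the condition into a DNF with at most `2 ^ L`
terms, so decryption is one DNF with about `n * 2 ^ L` terms and has depth `3`
(`exists_circuit_decBit`). Colliding labels could spoil decryption; `encode` checks for this and
then publishes the bit, which makes correctness perfect.

For tracing, query `j` encrypts column `j` of a fingerprinting code at position `j`, with different
bits for different users. Availability is a worst-case condition on ciphertexts, so these queries
need not resemble honest encryptions. The code is of Tardos type with uniform bias: in every column
each user compares a random string with a common random threshold. Ideally a column with `w` ones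
has probability `w! (n - w)! / (n + 1)!`. Where the pirate answers one, users with a one gain `1 /
w` and the others lose `1 / (n - w)`. The changes cancel except in constant columns, where the
pirate's answer is forced; hence the scores of all users add up to the number of all-ones columns,
about `k / (n + 1)`, and the largest score is about `k / n ^ 2` or more. If the answers do not
depend on the row of user `i`, the score of `i` has mean zero in every column, by Laplace's rule of
succession, and variance of order `log n / n ^ 2`. A Chernoff bound makes it unlikely that `i` has
the largest score: the error is `exp (-c k / (n ^ 2 log n))`, which is below every power of `1 / n`
for `k = n ^ 2 (log n) ^ 3` (`le_totalScore_of_accuse`, `sum_high_score_le`, `prob_accuse_le`).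

A coalition misses at most one user `i`. If the pads of `i` are replaced by a uniform string, the
masked bits of `i` form a one-time pad and the answers are independent of row `i`
(`prob_framed_le`). The real pads are only pseudorandom, so a distinguisher simulates the whole
experiment with its challenge as the pads of one user. It cannot know which user is missing and
guesses; this costs a factor of at most `2 n`, which is why errors `o(1 / n ^ 2)` lead to a failure
probability `o(1 / n)` (`prob_accuses_le_advantage`, `SchemePrograms.secure`).

Explicit programs are avoided: polynomial-time computability is derived from closure rules (`PComp`,
`NComp`, `BComp`) for families of trees, unary numbers and truth values. -/

/-! ## Polynomially bounded functions -/

/-- `f` is bounded by a polynomial in the size parameter `N`. -/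
def PBdd {α : Type} (N f : α → ℕ) : Prop := ∃ d : ℕ, ∀ a, f a ≤ (N a + 2) ^ d

namespace PBdd

variable {α β : Type} {N f g : α → ℕ}

theorem mono (h : PBdd N g) (hfg : ∀ a, f a ≤ g a) : PBdd N f :=
  let ⟨d, hd⟩ := h
  ⟨d, fun a => (hfg a).trans (hd a)⟩

/-- The base `N a + 2` is at least `2`, so `c < 2 ^ c` suffices. -/
theorem const (N : α → ℕ) (c : ℕ) : PBdd N fun _ => c :=
  ⟨c, fun a => (Nat.lt_two_pow_self).le.trans (Nat.pow_le_pow_left (by omega) c)⟩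

theorem self (N : α → ℕ) : PBdd N N := ⟨1, fun a => by simp⟩

theorem mul (hf : PBdd N f) (hg : PBdd N g) : PBdd N fun a => f a * g a := by
  obtain ⟨d, hd⟩ := hf
  obtain ⟨e, he⟩ := hg
  exact ⟨d + e, fun a => by rw [pow_add]; exact Nat.mul_le_mul (hd a) (he a)⟩

theorem add (hf : PBdd N f) (hg : PBdd N g) : PBdd N fun a => f a + g a := by
  obtain ⟨d, hd⟩ := hf
  obtain ⟨e, he⟩ := hg
  refine ⟨max d e + 1, fun a => ?_⟩
  have h1 : (N a + 2) ^ d ≤ (N a + 2) ^ max d e := Nat.pow_le_pow_right (by omega) (le_max_left _ _)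
  have h2 : (N a + 2) ^ e ≤ (N a + 2) ^ max d e := Nat.pow_le_pow_right (by omega) (le_max_right _ _)
  have h3 := hd a
  have h4 := he a
  calc f a + g a ≤ (N a + 2) ^ max d e * 2 := by omega
    _ ≤ (N a + 2) ^ max d e * (N a + 2) := Nat.mul_le_mul_left _ (by omega)
    _ = _ := (pow_succ _ _).symm

theorem pow (hf : PBdd N f) (e : ℕ) : PBdd N fun a => f a ^ e := by
  induction e with
  | zero => simpa using const N 1
  | succ e ih => simpa only [pow_succ] using ih.mul hf

theorem comp (h : PBdd N f) (φ : β → α) : PBdd (fun b => N (φ b)) (fun b => f (φ b)) :=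
  let ⟨d, hd⟩ := h
  ⟨d, fun b => hd (φ b)⟩

/-- Change of the size parameter. -/
theorem trans {N' : α → ℕ} (h : PBdd N' f) (hN : PBdd N N') : PBdd N f := by
  obtain ⟨d, hd⟩ := h
  have := (hN.add (const N 2)).pow d
  exact this.mono hd

/-- A bound for all members of a polynomially bounded family. -/
theorem exists_uniform {m : α → ℕ} {F : (q : Σ a, Fin (m a)) → ℕ} (h : PBdd (fun q : Σ a, Fin (m a) => N q.1) F) :
    ∃ T : α → ℕ, PBdd N T ∧ ∀ a i, F ⟨a, i⟩ ≤ T a :=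
  let ⟨d, hd⟩ := h
  ⟨fun a => (N a + 2) ^ d, ⟨d, fun _ => le_rfl⟩, fun a i => hd ⟨a, i⟩⟩

end PBdd

/-! ## Running times of composed programs -/

namespace Prog.ComputesIn

variable {p q b f g : Prog} {x y z u v : Data} {S T R : ℕ}

theorem mono (h : p.ComputesIn x y S) (hST : S ≤ T) : p.ComputesIn x y T :=
  let ⟨t, ht, hr⟩ := h
  ⟨t, ht.trans hST, hr⟩

theorem pair (h : p.ComputesIn x y S) (h' : q.ComputesIn x z T) :
    (Prog.pair p q).ComputesIn x (.cons y z) (S + T + 1) :=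
  let ⟨_, hs, hr⟩ := h
  let ⟨_, hs', hr'⟩ := h'
  ⟨_, by omega, hr.pair hr'⟩

theorem seq (h : p.ComputesIn x y S) (h' : q.ComputesIn y z T) :
    (Prog.seq p q).ComputesIn x z (S + T + 1) :=
  let ⟨_, hs, hr⟩ := h
  let ⟨_, hs', hr'⟩ := h'
  ⟨_, by omega, hr.seq hr'⟩

theorem cond_true (h : b.ComputesIn x (.cons u v) S) (h' : f.ComputesIn x y T) :
    (Prog.cond b f g).ComputesIn x y (S + T + 1) :=
  let ⟨_, hs, hr⟩ := h
  let ⟨_, hs', hr'⟩ := h'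
  ⟨_, by omega, hr.cond_true hr'⟩

theorem cond_false (h : b.ComputesIn x .nil S) (h' : g.ComputesIn x y T) :
    (Prog.cond b f g).ComputesIn x y (S + T + 1) :=
  let ⟨_, hs, hr⟩ := h
  let ⟨_, hs', hr'⟩ := h'
  ⟨_, by omega, hr.cond_false hr'⟩

theorem loop (m : ℕ) : ∀ (s : ℕ → Data),
    (∀ j < m, ∃ u v, b.ComputesIn (s j) (.cons u v) R) → b.ComputesIn (s m) .nil R →
    (∀ j < m, f.ComputesIn (s j) (s (j + 1)) T) →
    (Prog.loop b f).ComputesIn (s 0) (s m) (m * (R + T + 1) + R + 1) := by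
  induction m with
  | zero =>
    intro s _ h _
    obtain ⟨t, ht, hr⟩ := h
    exact ⟨_, by omega, Prog.Runs.loop_stop hr⟩
  | succ m ih =>
    intro s hb h hf
    obtain ⟨t, ht, hr⟩ := ih (fun j => s (j + 1)) (fun j hj => hb (j + 1) (by omega)) h
      (fun j hj => hf (j + 1) (by omega))
    obtain ⟨u, v, t1, ht1, hr1⟩ := hb 0 (by omega)
    obtain ⟨t2, ht2, hr2⟩ := hf 0 (by omega)
    refine ⟨_, ?_, Prog.Runs.loop_step hr1 hr2 hr⟩
    rw [Nat.succ_mul]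
    omega

end Prog.ComputesIn

/-! ## Polynomial-time computability relative to a size parameter -/

/-- The tree `y a` can be computed from `x a` in time polynomial in `N a`. -/
def PComp {α : Type} (N : α → ℕ) (x y : α → Data) : Prop :=
  ∃ (p : Prog) (t : α → ℕ), PBdd N t ∧ ∀ a, p.ComputesIn (x a) (y a) (t a)

namespace PComp

variable {α β : Type} {N : α → ℕ} {x y z w : α → Data}

theorem self : PComp N x x :=
  ⟨.id, fun _ => 1, .const N 1, fun _ => ⟨1, le_rfl, .id _⟩⟩

theorem nil : PComp N x fun _ => .nil :=
  ⟨.nil, fun _ => 1, .const N 1, fun _ => ⟨1, le_rfl, .nil _⟩⟩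

theorem trans (h : PComp N x y) (h' : PComp N y z) : PComp N x z :=
  let ⟨_, _, ht, hp⟩ := h
  let ⟨_, _, ht', hp'⟩ := h'
  ⟨_, _, (ht.add ht').add (.const N 1), fun a => (hp a).seq (hp' a)⟩

theorem cons (h : PComp N x y) (h' : PComp N x z) : PComp N x fun a => .cons (y a) (z a) :=
  let ⟨_, _, ht, hp⟩ := h
  let ⟨_, _, ht', hp'⟩ := h'
  ⟨_, _, (ht.add ht').add (.const N 1), fun a => (hp a).pair (hp' a)⟩

theorem fst (h : PComp N x y) : PComp N x fun a => (y a).fst :=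
  h.trans ⟨.fst, fun _ => 1, .const N 1, fun _ => ⟨1, le_rfl, .fst _⟩⟩

theorem snd (h : PComp N x y) : PComp N x fun a => (y a).snd :=
  h.trans ⟨.snd, fun _ => 1, .const N 1, fun _ => ⟨1, le_rfl, .snd _⟩⟩

theorem congr (h : PComp N x y) (e : ∀ a, y a = z a) : PComp N x z := by
  obtain rfl : y = z := funext e
  exact h

theorem comp (h : PComp N x y) (φ : β → α) :
    PComp (fun b => N (φ b)) (fun b => x (φ b)) (fun b => y (φ b)) :=
  let ⟨p, t, ht, hp⟩ := h
  ⟨p, fun b => t (φ b), ht.comp φ, fun b => hp (φ b)⟩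

theorem of_prog {p : Prog} {t : α → ℕ} (ht : PBdd N t) (hp : ∀ a, p.ComputesIn (x a) (y a) (t a)) :
    PComp N x y := ⟨p, t, ht, hp⟩

theorem exists_prog (h : PComp N x y) :
    ∃ (p : Prog) (d : ℕ), ∀ a, p.ComputesIn (x a) (y a) ((N a + 2) ^ d) :=
  let ⟨p, _, ⟨d, hd⟩, hp⟩ := h
  ⟨p, d, fun a => (hp a).mono (hd a)⟩

/-- The decidability instance of the result is arbitrary, so that the rule fits classical and
computable conditions alike. -/
theorem ite {P : α → Prop} {inst : ∀ a, Decidable (P a)}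
    (hb : PComp N x fun a => Data.ofBool (@decide (P a) (Classical.propDecidable _)))
    (hy : PComp N x y) (hz : PComp N x z) : PComp N x fun a => if P a then y a else z a := by
  obtain ⟨b, r, hr, hb⟩ := hb
  obtain ⟨p, t, ht, hp⟩ := hy
  obtain ⟨q, s, hs, hq⟩ := hz
  refine ⟨.cond b p q, _, (hr.add (ht.add hs)).add (.const N 1), fun a => ?_⟩
  have := hb a
  by_cases h : P a
  · simp only [h, decide_true, if_true, Data.ofBool] at this ⊢
    exact (this.cond_true (hp a)).mono (by omega)
  · simp only [h, decide_false, if_false, Data.ofBool] at this ⊢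
    exact (this.cond_false (hq a)).mono (by omega)

/-- Iteration along a list that serves as a counter. -/
theorem loop {L : α → List Data} {s : α → ℕ → Data}
    (hL : PComp N x fun a => Data.ofList (L a)) (hlen : PBdd N fun a => (L a).length)
    (h0 : PComp N x fun a => s a 0)
    (hs : PComp (fun q : Σ a, Fin (L a).length => N q.1)
      (fun q => .cons (x q.1) (.cons (Data.unary q.2) (s q.1 q.2))) (fun q => s q.1 (q.2 + 1))) :
    PComp N x fun a => s a (L a).length := by
  obtain ⟨p, t, ht, hp⟩ := hs
  obtain ⟨T, hT, htT⟩ := ht.exists_uniform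
  -- The loop state holds the input, the rest of the list, the index in unary and the current value.
  -- The loop runs while the rest of the list is not `nil`.
  let st : α → ℕ → Data := fun a j =>
    .cons (x a) (.cons (Data.ofList ((L a).drop j)) (.cons (Data.unary j) (s a j)))
  have hinit : PComp N x fun a => st a 0 := by
    refine cons self (cons (hL.congr fun a => by simp) (cons nil h0))
  have hb : PComp (fun q : Σ a, Fin ((L a).length + 1) => N q.1) (fun q => st q.1 q.2)
      (fun q => (st q.1 q.2).snd.fst) := self.snd.fst
  have hf : PComp (fun q : Σ a, Fin (L a).length => N q.1) (fun q => st q.1 q.2)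
      (fun q => st q.1 (q.2 + 1)) := by
    have h1 : PComp (fun q : Σ a, Fin (L a).length => N q.1) (fun q => st q.1 q.2)
        (fun q => s q.1 (q.2 + 1)) := by
      refine trans ?_ ⟨p, t, ht, hp⟩
      exact cons (y := fun q : Σ a, Fin (L a).length => (st q.1 q.2).fst) self.fst
        (z := fun q : Σ a, Fin (L a).length => (st q.1 q.2).snd.snd) self.snd.snd
    refine cons (y := fun q : Σ a, Fin (L a).length => (st q.1 q.2).fst) self.fst
      (cons ?_ (cons ?_ h1))
    · refine (self.snd.fst.snd).congr fun q => ?_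
      obtain ⟨a, i⟩ := q
      simp only [st, Data.snd, Data.fst]
      rw [List.drop_eq_getElem_cons i.2]
      rfl
    · refine (cons (cons nil nil) (self.snd.snd.fst)).congr fun q => ?_
      rfl
  obtain ⟨p1, t1, ht1, hp1⟩ := hb
  obtain ⟨p2, t2, ht2, hp2⟩ := hf
  -- The time of one round is bounded independently of the index, so that the total is a product of
  -- polynomial bounds.
  obtain ⟨T1, hT1, htT1⟩ := ht1.exists_uniform
  obtain ⟨T2, hT2, htT2⟩ := ht2.exists_uniform
  have hloop : PComp N (fun a => st a 0) (fun a => st a (L a).length) := by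
    refine ⟨.loop p1 p2, _, ((hlen.mul ((hT1.add hT2).add (.const N 1))).add hT1).add (.const N 1),
      fun a => ?_⟩
    refine Prog.ComputesIn.loop _ (st a) (fun j hj => ?_) ?_ (fun j hj => ?_)
    · have := (hp1 ⟨a, ⟨j, by omega⟩⟩).mono (htT1 a _)
      simp only [st, Data.snd, Data.fst] at this
      simp only [st]
      rw [List.drop_eq_getElem_cons hj] at this ⊢
      exact ⟨_, _, this⟩
    · have := (hp1 ⟨a, ⟨(L a).length, by omega⟩⟩).mono (htT1 a _)
      simp only [st, Data.snd, Data.fst, List.drop_length] at this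
      simp only [st, List.drop_length]
      exact this
    · exact (hp2 ⟨a, ⟨j, hj⟩⟩).mono (htT2 a _)
  exact (hinit.trans hloop).snd.snd.snd

/-- Environments follow de Bruijn: a bound variable is appended in unary to the old environment,
from which older data are read by a projection. -/
theorem weaken (h : PComp N x y) {m : α → ℕ} :
    PComp (fun q : Σ a, Fin (m a) => N q.1) (fun q => .cons (x q.1) (Data.unary q.2))
      (fun q => y q.1) :=
  trans (self (x := fun q : Σ a, Fin (m a) => Data.cons (x q.1) (Data.unary q.2))).fst
    (h.comp fun q : Σ a, Fin (m a) => q.1)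

end PComp

/-- The number `f a` is polynomially bounded, and its unary representation can be computed from `x a`
in time polynomial in `N a`. -/
def NComp {α : Type} (N : α → ℕ) (x : α → Data) (f : α → ℕ) : Prop :=
  (PComp N x fun a => Data.unary (f a)) ∧ PBdd N f

open Classical in
/-- The truth value of `P a` can be computed from `x a` in time polynomial in `N a`. -/
def BComp {α : Type} (N : α → ℕ) (x : α → Data) (P : α → Prop) : Prop :=
  PComp N x fun a => Data.ofBool (decide (P a))

/-- Entry `i` of a list (`nil` if there is none). -/
def Data.nth (d : Data) (i : ℕ) : Data := (Data.snd^[i] d).fst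

section

variable {α β : Type} {N : α → ℕ} {x y z : α → Data} {f g m : α → ℕ} {P Q : α → Prop}

/-- A unary number is a list of its own length, so it can serve as the counter of a `for` loop. -/
theorem PComp.iter {s : α → ℕ → Data} (hm : NComp N x m) (h0 : PComp N x fun a => s a 0)
    (hs : PComp (fun q : Σ a, Fin (m a) => N q.1)
      (fun q => .cons (x q.1) (.cons (Data.unary q.2) (s q.1 q.2))) (fun q => s q.1 (q.2 + 1))) :
    PComp N x fun a => s a (m a) := by
  have e : ∀ a, (List.replicate (m a) (Data.ofBool true)).length = m a := fun a => by simp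
  have := PComp.loop (L := fun a => List.replicate (m a) (Data.ofBool true)) (s := s) hm.1
    (hm.2.mono fun a => by simp) h0
    (hs.comp fun q : Σ a, Fin (List.replicate (m a) (Data.ofBool true)).length =>
      (⟨q.1, q.2.cast (e q.1)⟩ : Σ a, Fin (m a)))
  exact this.congr fun a => by simp

theorem PComp.drop (hy : PComp N x y) (hm : NComp N x m) :
    PComp N x fun a => Data.snd^[m a] (y a) := by
  refine PComp.iter (s := fun a i => Data.snd^[i] (y a)) hm hy ?_
  refine PComp.congr (PComp.self.snd.snd.snd) fun q => ?_
  rw [Function.iterate_succ_apply']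
  rfl

theorem PComp.nth (hy : PComp N x y) (hm : NComp N x m) : PComp N x fun a => (y a).nth (m a) :=
  (hy.drop hm).fst

/-- The length of a list. -/
theorem NComp.length {L : α → List Data} (hL : PComp N x fun a => Data.ofList (L a))
    (hlen : PBdd N fun a => (L a).length) : NComp N x fun a => (L a).length := by
  refine ⟨PComp.loop (s := fun _ i => Data.unary i) hL hlen PComp.nil ?_, hlen⟩
  exact PComp.cons (PComp.cons .nil .nil) PComp.self.snd.fst

/-! ### Arithmetic in unary -/

namespace NComp

theorem congr (h : NComp N x f) (e : ∀ a, f a = g a) : NComp N x g := by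
  obtain rfl : f = g := funext e
  exact h

theorem comp (h : NComp N x f) (φ : β → α) :
    NComp (fun b => N (φ b)) (fun b => x (φ b)) (fun b => f (φ b)) :=
  ⟨h.1.comp φ, h.2.comp φ⟩

theorem of_env (h : PComp N x y) (hf : NComp N y f) : NComp N x f := ⟨h.trans hf.1, hf.2⟩

theorem weaken (h : NComp N x f) {m : α → ℕ} :
    NComp (fun q : Σ a, Fin (m a) => N q.1) (fun q => .cons (x q.1) (Data.unary q.2))
      (fun q => f q.1) :=
  ⟨h.1.weaken, h.2.comp _⟩

/-- The innermost bound variable. -/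
theorem var (hm : NComp N x m) :
    NComp (fun q : Σ a, Fin (m a) => N q.1) (fun q => .cons (x q.1) (Data.unary q.2))
      (fun q => (q.2 : ℕ)) :=
  ⟨PComp.self.snd, (hm.2.comp fun q : Σ a, Fin (m a) => q.1).mono fun q => q.2.2.le⟩

theorem const (c : ℕ) : NComp N x fun _ => c := by
  refine ⟨?_, .const N c⟩
  induction c with
  | zero => exact PComp.nil
  | succ c ih => exact PComp.cons (PComp.cons .nil .nil) ih

theorem add (hf : NComp N x f) (hg : NComp N x g) : NComp N x fun a => f a + g a := by
  refine ⟨PComp.congr (y := fun a => Data.unary (g a + f a)) ?_ fun a => by rw [add_comm],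
    hf.2.add hg.2⟩
  refine PComp.iter (s := fun a i => Data.unary (g a + i)) hf hg.1 ?_
  exact PComp.cons (PComp.cons .nil .nil) PComp.self.snd.snd

theorem sub (hf : NComp N x f) (hg : NComp N x g) : NComp N x fun a => f a - g a := by
  refine ⟨?_, hf.2.mono fun a => Nat.sub_le _ _⟩
  -- The tail of a unary number is its predecessor, and the tail of `nil` is `nil`, in accordance
  -- with truncated subtraction.
  refine PComp.iter (s := fun a i => Data.unary (f a - i)) hg hf.1 ?_
  refine PComp.congr PComp.self.snd.snd.snd fun q => ?_
  simp only [Data.snd]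
  rw [← Nat.sub_sub]
  cases f q.1 - q.2 <;> rfl

/-- Sums with a computable range. -/
theorem sum {f : α → ℕ → ℕ} (hm : NComp N x m)
    (hf : NComp (fun q : Σ a, Fin (m a) => N q.1)
      (fun q => .cons (x q.1) (Data.unary q.2)) (fun q => f q.1 q.2)) :
    NComp N x fun a => ∑ i ∈ Finset.range (m a), f a i := by
  constructor
  · refine PComp.iter (s := fun a i => Data.unary (∑ j ∈ Finset.range i, f a j)) hm PComp.nil ?_
    have h : NComp (fun q : Σ a, Fin (m a) => N q.1)
        (fun q => .cons (x q.1) (.cons (Data.unary q.2)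
          (Data.unary (∑ j ∈ Finset.range q.2, f q.1 j)))) (fun q => f q.1 q.2) :=
      NComp.of_env (PComp.cons PComp.self.fst PComp.self.snd.fst) hf
    refine PComp.congr (y := fun q => Data.unary (∑ j ∈ Finset.range q.2, f q.1 j + f q.1 q.2)) ?_
      fun q => by rw [Finset.sum_range_succ]
    have h' : PComp (fun q : Σ a, Fin (m a) => N q.1)
        (fun q => .cons (x q.1) (.cons (Data.unary q.2)
          (Data.unary (∑ j ∈ Finset.range q.2, f q.1 j)))) (fun q => Data.unary (f q.1 q.2 +
            ∑ j ∈ Finset.range q.2, f q.1 j)) := by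
      refine PComp.congr (y := fun q => Data.unary (∑ j ∈ Finset.range q.2, f q.1 j + f q.1 q.2)) ?_
        fun q => by rw [add_comm]
      refine PComp.iter (s := fun q i => Data.unary (∑ j ∈ Finset.range q.2, f q.1 j + i)) h
        PComp.self.snd.snd ?_
      exact PComp.cons (PComp.cons .nil .nil) PComp.self.snd.snd
    exact h'.congr fun q => by rw [add_comm]
  · obtain ⟨T, hT, hfT⟩ := hf.2.exists_uniform
    refine (hm.2.mul hT).mono fun a => ?_
    refine (Finset.sum_le_card_nsmul _ _ (T a) fun i hi => ?_).trans (by simp)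
    exact hfT a ⟨i, Finset.mem_range.1 hi⟩

theorem mul (hf : NComp N x f) (hg : NComp N x g) : NComp N x fun a => f a * g a :=
  (sum (f := fun a _ => g a) hf hg.weaken).congr fun a => by simp

theorem pow (hf : NComp N x f) (e : ℕ) : NComp N x fun a => f a ^ e := by
  induction e with
  | zero => simpa using const 1
  | succ e ih => simpa only [pow_succ] using ih.mul hf

end NComp

/-- Lists given by a computable entry function. -/
theorem PComp.tab {g : α → ℕ → Data} (hm : NComp N x m)
    (hg : PComp (fun q : Σ a, Fin (m a) => N q.1)
      (fun q => .cons (x q.1) (Data.unary q.2)) (fun q => g q.1 q.2)) :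
    PComp N x fun a => Data.ofList ((List.range (m a)).map (g a)) := by
  -- Lists grow at the front, so the entries are computed in the order of decreasing indices.
  let s : α → ℕ → Data := fun a i =>
    Data.ofList ((List.range' (m a - i) i).map (g a))
  have : PComp N x fun a => s a (m a) := by
    refine PComp.iter hm (PComp.nil) ?_
    have hidx : NComp (fun q : Σ a, Fin (m a) => N q.1)
        (fun q => .cons (x q.1) (.cons (Data.unary q.2) (s q.1 q.2)))
        (fun q => m q.1 - (q.2 + 1)) := by
      refine NComp.sub ?_ (NComp.add ⟨PComp.self.snd.fst, (NComp.var hm).2⟩ (.const 1))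
      refine NComp.of_env PComp.self.fst (hm.comp fun q : Σ a, Fin (m a) => q.1)
    have hg' : PComp (fun q : Σ a, Fin (m a) => N q.1)
        (fun q => .cons (x q.1) (.cons (Data.unary q.2) (s q.1 q.2)))
        (fun q => g q.1 (m q.1 - (q.2 + 1))) := by
      refine PComp.trans (PComp.cons PComp.self.fst hidx.1) (hg.comp fun q : Σ a, Fin (m a) =>
        (⟨q.1, ⟨m q.1 - (q.2 + 1), by have := q.2.2; omega⟩⟩ : Σ a, Fin (m a)))
    refine (PComp.cons hg' PComp.self.snd.snd).congr fun q => ?_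
    simp only [Data.snd, s]
    rw [List.range'_succ, List.map_cons]
    have : m q.1 - (q.2 + 1) + 1 = m q.1 - q.2 := by have := q.2.2; omega
    rw [this]
    rfl
  exact this.congr fun a => by simp [s, List.range_eq_range']

/-! ### Decidable conditions -/

namespace BComp

theorem congr (h : BComp N x P) (e : ∀ a, P a ↔ Q a) : BComp N x Q := by
  obtain rfl : P = Q := funext fun a => propext (e a)
  exact h

theorem of_bool {b : α → Bool} (h : PComp N x fun a => Data.ofBool (b a)) :
    BComp N x fun a => b a = true :=
  PComp.congr h fun a => by simp

theorem to_bool {b : α → Bool} (h : BComp N x fun a => b a = true) :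
    PComp N x fun a => Data.ofBool (b a) :=
  PComp.congr h fun a => by simp

theorem of_env (h : PComp N x y) (hf : BComp N y P) : BComp N x P := PComp.trans h hf

theorem comp (h : BComp N x P) (φ : β → α) :
    BComp (fun b => N (φ b)) (fun b => x (φ b)) (fun b => P (φ b)) := PComp.comp h φ

theorem weaken (h : BComp N x P) {m : α → ℕ} :
    BComp (fun q : Σ a, Fin (m a) => N q.1) (fun q => .cons (x q.1) (Data.unary q.2))
      (fun q => P q.1) :=
  PComp.weaken h

theorem const_true : BComp N x fun _ => True :=
  PComp.congr (PComp.cons .nil .nil) fun a => by simp [Data.ofBool]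

theorem const_false : BComp N x fun _ => False :=
  PComp.congr .nil fun a => by simp [Data.ofBool]

open Classical in
theorem not (h : BComp N x P) : BComp N x fun a => ¬ P a :=
  (PComp.ite (inst := fun _ => Classical.propDecidable _) h const_false const_true).congr fun a => by by_cases h : P a <;> simp [h]

open Classical in
theorem and (h : BComp N x P) (h' : BComp N x Q) : BComp N x fun a => P a ∧ Q a :=
  (PComp.ite (inst := fun _ => Classical.propDecidable _) h h' const_false).congr fun a => by by_cases h : P a <;> simp [h]

open Classical in
theorem or (h : BComp N x P) (h' : BComp N x Q) : BComp N x fun a => P a ∨ Q a :=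
  (PComp.ite (inst := fun _ => Classical.propDecidable _) h const_true h').congr fun a => by by_cases h : P a <;> simp [h]

theorem imp (h : BComp N x P) (h' : BComp N x Q) : BComp N x fun a => P a → Q a :=
  (h.not.or h').congr fun a => by tauto

theorem iff (h : BComp N x P) (h' : BComp N x Q) : BComp N x fun a => P a ↔ Q a :=
  ((h.imp h').and (h'.imp h)).congr fun a => by tauto

theorem eq_zero (h : NComp N x f) : BComp N x fun a => f a = 0 := by
  obtain ⟨⟨p, t, ht, hp⟩, -⟩ := h
  refine ⟨.cond p .nil (.pair .nil .nil), _, ht.add (.const N 4), fun a => ?_⟩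
  have := hp a
  rcases h : f a with _ | k
  · simp only [h] at this ⊢
    simp only [decide_true, Data.ofBool]
    exact (this.cond_false (Prog.ComputesIn.pair ⟨1, le_rfl, .nil _⟩ ⟨1, le_rfl, .nil _⟩))
  · simp only [h] at this ⊢
    simp only [Nat.add_eq_zero_iff, one_ne_zero, and_false, decide_false, Data.ofBool]
    exact (this.cond_true ⟨1, le_rfl, .nil _⟩).mono (by omega)

theorem le (hf : NComp N x f) (hg : NComp N x g) : BComp N x fun a => f a ≤ g a :=
  (eq_zero (hf.sub hg)).congr fun a => by omega

theorem lt (hf : NComp N x f) (hg : NComp N x g) : BComp N x fun a => f a < g a :=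
  (le hg hf).not.congr fun a => by omega

theorem eq (hf : NComp N x f) (hg : NComp N x g) : BComp N x fun a => f a = g a :=
  ((le hf hg).and (le hg hf)).congr fun a => by omega

end BComp

theorem NComp.ite {inst : ∀ a, Decidable (P a)} (hb : BComp N x P) (hf : NComp N x f) (hg : NComp N x g) :
    NComp N x fun a => if P a then f a else g a :=
  ⟨(PComp.ite (inst := inst) hb hf.1 hg.1).congr fun a => by by_cases h : P a <;> simp [h],
    (hf.2.add hg.2).mono fun a => by split_ifs <;> omega⟩

theorem BComp.ite {R : α → Prop} {_ : ∀ a, Decidable (P a)} (hb : BComp N x P) (hf : BComp N x Q) (hg : BComp N x R) :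
    BComp N x fun a => if P a then Q a else R a :=
  ((hb.and hf).or (hb.not.and hg)).congr fun a => by split_ifs with h <;> simp [h]

-- Bounded search by counting the solutions and comparing the count with zero.
open Classical in
theorem BComp.exists_lt {P : α → ℕ → Prop} (hm : NComp N x m)
    (h : BComp (fun q : Σ a, Fin (m a) => N q.1)
      (fun q => .cons (x q.1) (Data.unary q.2)) (fun q => P q.1 q.2)) :
    BComp N x fun a => ∃ i < m a, P a i :=
  (BComp.eq_zero (NComp.sum (f := fun a i => if P a i then 1 else 0) hm
    (NComp.ite h (.const 1) (.const 0)))).not.congr fun a => by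
    simp

/-- The quotient counts the positive multiples of `g a` up to `f a`. For `g a = 0` every index would
be counted, hence the case distinction. -/
theorem NComp.div (hf : NComp N x f) (hg : NComp N x g) : NComp N x fun a => f a / g a := by
  have h : NComp N x fun a => ∑ i ∈ Finset.range (f a), if (i + 1) * g a ≤ f a then 1 else 0 :=
    NComp.sum (f := fun a i => if (i + 1) * g a ≤ f a then 1 else 0) hf
      (NComp.ite (.le (((NComp.var hf).add (.const 1)).mul hg.weaken) hf.weaken)
        (.const 1) (.const 0))
  refine (NComp.ite (inst := fun a => inferInstance) (.eq_zero hg) (.const 0) h).congr fun a => ?_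
  split_ifs with h0
  · simp [h0]
  · have hpos : 0 < g a := Nat.pos_of_ne_zero h0
    rw [Finset.sum_boole, Nat.cast_id]
    have : (Finset.range (f a)).filter (fun i => (i + 1) * g a ≤ f a) = Finset.range (f a / g a) := by
      ext i
      rw [Finset.mem_filter, Finset.mem_range, Finset.mem_range, ← Nat.le_div_iff_mul_le hpos,
        Nat.succ_le_iff]
      exact ⟨fun h => h.2, fun h => ⟨h.trans_le (Nat.div_le_self _ _), h⟩⟩
    rw [this, Finset.card_range]

theorem NComp.mod (hf : NComp N x f) (hg : NComp N x g) : NComp N x fun a => f a % g a :=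
  (hf.sub (hg.mul (hf.div hg))).congr fun _ => (Nat.mod_def _ _).symm

end

/-! ## Computing with bit strings -/

/-- Bit `t` of a bit string (`false` if there is none). -/
def bitAt {m : ℕ} (x : Bits m) (t : ℕ) : Bool := if h : t < m then x ⟨t, h⟩ else false

theorem bitAt_of_lt {m : ℕ} (x : Bits m) {t : ℕ} (h : t < m) : bitAt x t = x ⟨t, h⟩ := dif_pos h

@[simp] theorem bitAt_val {m : ℕ} (x : Bits m) (t : Fin m) : bitAt x t = x t := dif_pos t.2

theorem Data.nth_ofList (l : List Data) (i : ℕ) : (Data.ofList l).nth i = l.getD i .nil := by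
  induction i generalizing l with
  | zero => cases l <;> rfl
  | succ i ih =>
    cases l with
    | nil => exact ih []
    | cons a l => exact ih l

theorem Data.nth_ofBits {m : ℕ} (x : Bits m) (t : ℕ) :
    (Data.ofBits x).nth t = Data.ofBool (bitAt x t) := by
  unfold Data.ofBits Data.ofBoolList
  rw [Data.nth_ofList, bitAt]
  split_ifs with h
  · simp [List.getD, h]
  · simp [List.getD, h, Data.ofBool]

theorem Data.nth_ofBitsSeq {A m : ℕ} (c : Fin A → Bits m) (i : Fin A) :
    (Data.ofBitsSeq c).nth i = Data.ofBits (c i) := by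
  unfold Data.ofBitsSeq
  rw [Data.nth_ofList]
  simp [List.getD]

theorem List.ofFn_eq_map_range {τ : Type} {m : ℕ} (g : ℕ → τ) :
    List.ofFn (fun i : Fin m => g i) = (List.range m).map g := by
  apply List.ext_getElem <;> simp

section

variable {α : Type} {N : α → ℕ} {x : α → Data} {m k n : α → ℕ}

theorem PComp.ofList_ofFn {g : (a : α) → Fin (m a) → Data} (hm : NComp N x m)
    (hg : PComp (fun q : Σ a, Fin (m a) => N q.1)
      (fun q => .cons (x q.1) (Data.unary q.2)) (fun q => g q.1 q.2)) :
    PComp N x fun a => Data.ofList (List.ofFn (g a)) := by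
  have := PComp.tab (g := fun a i => if h : i < m a then g a ⟨i, h⟩ else .nil) hm
    (hg.congr fun q => by simp)
  refine this.congr fun a => ?_
  rw [← List.ofFn_eq_map_range]
  simp

theorem PComp.ofBits {w : (a : α) → Bits (m a)} (hm : NComp N x m)
    (hw : BComp (fun q : Σ a, Fin (m a) => N q.1)
      (fun q => .cons (x q.1) (Data.unary q.2)) (fun q => w q.1 q.2 = true)) :
    PComp N x fun a => Data.ofBits (w a) :=
  (PComp.ofList_ofFn (g := fun a i => Data.ofBool (w a i)) hm hw.to_bool).congr fun a => by
    simp [Data.ofBits, Data.ofBoolList, List.map_ofFn, Function.comp_def]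

theorem PComp.ofBitsSeq {c : (a : α) → Fin (k a) → Bits (m a)} (hk : NComp N x k)
    (hc : PComp (fun q : Σ a, Fin (k a) => N q.1)
      (fun q => .cons (x q.1) (Data.unary q.2)) (fun q => Data.ofBits (c q.1 q.2))) :
    PComp N x fun a => Data.ofBitsSeq (c a) :=
  PComp.ofList_ofFn hk hc

theorem BComp.bitAt {w : (a : α) → Bits (m a)} {t : α → ℕ}
    (hw : PComp N x fun a => Data.ofBits (w a)) (ht : NComp N x t) :
    BComp N x fun a => bitAt (w a) (t a) = true :=
  BComp.of_bool ((hw.nth ht).congr fun _ => Data.nth_ofBits _ _)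

theorem BComp.bit {w : (a : α) → Bits (m a)} {t : (a : α) → Fin (m a)}
    (hw : PComp N x fun a => Data.ofBits (w a)) (ht : NComp N x fun a => (t a : ℕ)) :
    BComp N x fun a => w a (t a) = true :=
  (BComp.bitAt hw ht).congr fun a => by simp

theorem PComp.row {c : (a : α) → Fin (k a) → Bits (m a)} {i : (a : α) → Fin (k a)}
    (hc : PComp N x fun a => Data.ofBitsSeq (c a)) (hi : NComp N x fun a => (i a : ℕ)) :
    PComp N x fun a => Data.ofBits (c a (i a)) :=
  (hc.nth hi).congr fun _ => Data.nth_ofBitsSeq _ _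

theorem NComp.sum_fin {f : (a : α) → Fin (m a) → ℕ} (hm : NComp N x m)
    (hf : NComp (fun q : Σ a, Fin (m a) => N q.1)
      (fun q => .cons (x q.1) (Data.unary q.2)) (fun q => f q.1 q.2)) :
    NComp N x fun a => ∑ i, f a i :=
  (NComp.sum (f := fun a i => if h : i < m a then f a ⟨i, h⟩ else 0) hm
    (hf.congr fun q => by simp)).congr fun a => by rw [Finset.sum_range]; simp

theorem BComp.exists_fin {P : (a : α) → Fin (m a) → Prop} (hm : NComp N x m)
    (h : BComp (fun q : Σ a, Fin (m a) => N q.1)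
      (fun q => .cons (x q.1) (Data.unary q.2)) (fun q => P q.1 q.2)) :
    BComp N x fun a => ∃ i, P a i :=
  (BComp.exists_lt (P := fun a i => ∃ h : i < m a, P a ⟨i, h⟩) hm (h.congr fun q => by simp)).congr
    fun a => ⟨fun ⟨_, _, h, hp⟩ => ⟨⟨_, h⟩, hp⟩, fun ⟨i, hp⟩ => ⟨i, i.2, i.2, hp⟩⟩

theorem BComp.forall_fin {P : (a : α) → Fin (m a) → Prop} (hm : NComp N x m)
    (h : BComp (fun q : Σ a, Fin (m a) => N q.1)
      (fun q => .cons (x q.1) (Data.unary q.2)) (fun q => P q.1 q.2)) :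
    BComp N x fun a => ∀ i, P a i :=
  (BComp.exists_fin (P := fun a i => ¬ P a i) hm h.not).not.congr fun a => by
    push Not
    rfl

theorem BComp.bool_eq {b c : α → Bool} (hb : BComp N x fun a => b a = true)
    (hc : BComp N x fun a => c a = true) : BComp N x fun a => b a = c a :=
  (hb.iff hc).congr fun a => by cases b a <;> cases c a <;> simp

theorem BComp.eq_false {b : α → Bool} (hb : BComp N x fun a => b a = true) :
    BComp N x fun a => b a = false :=
  hb.not.congr fun a => by simp

theorem BComp.xor {b c : α → Bool} (hb : BComp N x fun a => b a = true)
    (hc : BComp N x fun a => c a = true) : BComp N x fun a => Bool.xor (b a) (c a) = true :=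
  (hb.iff hc).not.congr fun a => by cases b a <;> cases c a <;> simp

theorem BComp.bits_eq {u v : (a : α) → Bits (m a)} (hm : NComp N x m)
    (hu : PComp N x fun a => Data.ofBits (u a)) (hv : PComp N x fun a => Data.ofBits (v a)) :
    BComp N x fun a => u a = v a := by
  refine (BComp.forall_fin (P := fun a i => u a i = v a i) hm ?_).congr fun a => funext_iff.symm
  have h : ∀ {w : (a : α) → Bits (m a)}, (PComp N x fun a => Data.ofBits (w a)) →
      BComp (fun q : Σ a, Fin (m a) => N q.1)
        (fun q => .cons (x q.1) (Data.unary q.2)) (fun q => w q.1 q.2 = true) := fun hw =>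
    BComp.bit (w := fun q : Σ a, Fin (m a) => _) (t := fun q => q.2) hw.weaken (.var hm)
  exact .bool_eq (h hu) (h hv)

/-! ### Powers of two -/

/-- Powers of two are too long in unary, so they are capped. Doubling and capping again keeps the
cap exact, so the capped powers can be computed by iteration. -/
theorem NComp.min_two_pow {q B : α → ℕ} (hq : NComp N x q) (hB : NComp N x B) :
    NComp N x fun a => min (2 ^ q a) (B a + 1) := by
  refine ⟨?_, (hB.add (.const 1)).2.mono fun a => min_le_right _ _⟩
  refine PComp.iter (s := fun a i => Data.unary (min (2 ^ i) (B a + 1))) hq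
    (PComp.congr (NComp.const (x := x) 1).1 fun a => by simp) ?_
  have h : NComp (fun r : Σ a, Fin (q a) => N r.1)
      (fun r => .cons (x r.1) (.cons (Data.unary r.2) (Data.unary (min (2 ^ (r.2 : ℕ)) (B r.1 + 1)))))
      (fun r => min (2 ^ (r.2 : ℕ)) (B r.1 + 1)) :=
    ⟨PComp.self.snd.snd, ((hB.add (.const 1)).2.comp _).mono fun r => min_le_right _ _⟩
  have hB' : NComp (fun r : Σ a, Fin (q a) => N r.1)
      (fun r => .cons (x r.1) (.cons (Data.unary r.2) (Data.unary (min (2 ^ (r.2 : ℕ)) (B r.1 + 1)))))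
      (fun r => B r.1) := .of_env PComp.self.fst (hB.comp _)
  have h2 := NComp.ite (inst := fun a => inferInstance) (.le (h.add h) hB') (h.add h)
    (hB'.add (.const 1))
  refine h2.1.congr fun r => congrArg _ ?_
  beta_reduce
  rw [pow_succ]
  generalize 2 ^ (r.2 : ℕ) = z
  split_ifs <;> omega

/-- The logarithm counts the `i` with `2 ^ (i + 1) ≤ f a`; a cap at `f a + 1` does not affect this
comparison. -/
theorem NComp.log {f : α → ℕ} (hf : NComp N x f) : NComp N x fun a => Nat.log 2 (f a) := by
  have h : NComp N x fun a => ∑ i ∈ Finset.range (f a),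
      if min (2 ^ (i + 1)) (f a + 1) ≤ f a then 1 else 0 :=
    NComp.sum (f := fun a i => if min (2 ^ (i + 1)) (f a + 1) ≤ f a then 1 else 0) hf
      (NComp.ite (.le (NComp.min_two_pow ((NComp.var hf).add (.const 1)) hf.weaken) hf.weaken)
        (.const 1) (.const 0))
  refine h.congr fun a => ?_
  rw [Finset.sum_boole, Nat.cast_id]
  have : (Finset.range (f a)).filter (fun i => min (2 ^ (i + 1)) (f a + 1) ≤ f a) =
      Finset.range (Nat.log 2 (f a)) := by
    ext i
    rw [Finset.mem_filter, Finset.mem_range, Finset.mem_range]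
    rcases Nat.eq_zero_or_pos (f a) with h0 | h0
    · simp [h0]
    · rw [show i < Nat.log 2 (f a) ↔ 2 ^ (i + 1) ≤ f a from
        Nat.le_log_iff_pow_le (by norm_num) (by omega)]
      constructor
      · rintro ⟨-, h⟩
        omega
      · intro h
        refine ⟨?_, by omega⟩
        have := (Nat.lt_two_pow_self (n := i + 1))
        omega
  rw [this, Finset.card_range]

end

/-- The number with binary digits `coin 0, …, coin (L - 1)` (the least significant digit first). -/
def binVal (L : ℕ) (coin : ℕ → Bool) : ℕ :=
  ∑ q ∈ Finset.range L, if coin q = true then 2 ^ q else 0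

/-- The subsequence `c, s + c, 2 s + c, …` of the coins `ω`. -/
def coins (s c : ℕ) {m : ℕ} (ω : Bits m) (t : ℕ) : Bool := bitAt ω (s * t + c)

section

variable {α : Type} {N : α → ℕ} {x : α → Data} {m k n : α → ℕ}

theorem BComp.coins (s c : ℕ) {w : (a : α) → Bits (m a)} {t : α → ℕ}
    (hw : PComp N x fun a => Data.ofBits (w a)) (ht : NComp N x t) :
    BComp N x fun a => coins s c (w a) (t a) = true :=
  .bitAt hw (((NComp.const s).mul ht).add (.const c))

/-- By `hLB` the cap `B a + 1` is never active, so capped powers of two give the exact value. -/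
theorem NComp.binVal {L B : α → ℕ} {coin : α → ℕ → Bool} (hL : NComp N x L) (hB : NComp N x B)
    (hLB : ∀ a, ∀ q < L a, 2 ^ q ≤ B a + 1)
    (hc : BComp (fun q : Σ a, Fin (L a) => N q.1)
      (fun q => .cons (x q.1) (Data.unary q.2)) (fun q => coin q.1 q.2 = true)) :
    NComp N x fun a => binVal (L a) (coin a) := by
  refine (NComp.sum (f := fun a q => if coin a q = true then min (2 ^ q) (B a + 1) else 0) hL
    (.ite hc (.min_two_pow (.var hL) hB.weaken) (.const 0))).congr fun a => ?_
  refine Finset.sum_congr rfl fun q hq => ?_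
  rw [min_eq_left (hLB a q (Finset.mem_range.1 hq))]

end

/-! ## The fingerprinting code -/

/-- `u` precedes `v` lexicographically. -/
def lexLT {B : ℕ} (u v : Bits B) : Prop :=
  ∃ t, u t = false ∧ v t = true ∧ ∀ s < t, u s = v s

open Classical in
/-- Row `i`, column `j` of the code tells whether the random string `u j (i + 1)` precedes `u j 0`. -/
noncomputable def code {k n B : ℕ} (u : Fin k → Fin (n + 1) → Bits B) : Fin k → Bits n :=
  fun j i => decide (lexLT (u j i.succ) (u j 0))

/-- The number of ones. -/
def weight {n : ℕ} (c : Bits n) : ℕ := ∑ i, if c i = true then 1 else 0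

/-- The score of user `i` if the pirate answers `a`, up to rounding and scaling. -/
def score {k n : ℕ} (F : Fin k → Bits n) (a : Bits k) (i : Fin n) : ℕ :=
  ∑ j, if a j = true ∧ F j i = true then
    16 * n * (n + 1) / weight (F j) + 16 * n * (n + 1) / (n - weight (F j)) else 0

open Classical in
/-- The first user of maximal score. -/
noncomputable def accuse {k n : ℕ} (F : Fin k → Bits n) (a : Bits k) : ℕ :=
  -- The index of the first maximiser is the number of users `i` such that nobody up to `i` is a
  -- maximiser.
  ∑ i : Fin n, if ∀ i' : Fin n, (i' : ℕ) ≤ i → ∃ i'' : Fin n, score F a i' < score F a i''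
    then 1 else 0

/-- Keys made of coins. -/
def coinKeys (n κ : ℕ) (coin : ℕ → Bool) : Fin n → Bits κ := fun i t => coin (t + κ * i)

/-- The random strings of the code made of coins. -/
def coinColumns (k n B : ℕ) (coin : ℕ → Bool) : Fin k → Fin (n + 1) → Bits B :=
  fun j i t => coin (t + B * (i + (n + 1) * j))

/-! ## Ciphertexts -/

/-- The concatenation of the rows of a matrix. -/
def flatRows {n l : ℕ} (M : Fin n → Bits l) : Bits (n * l) := fun r => M r.divNat r.modNat

/-- The string with a one at position `p` only. -/
def oneHot (Q p : ℕ) : Bits Q := fun t => decide ((t : ℕ) = p)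

/-- The position of the first one. -/
def firstOne {Q : ℕ} (f : Bits Q) : ℕ :=
  ∑ t : Fin Q, if ∀ s : Fin Q, (s : ℕ) ≤ t → f s = false then 1 else 0

/-- A ciphertext: a flag with a payload, a position of the pads, a masked bit for every user, and the
labels of the users. -/
def ctext {Q n l : ℕ} (flag payload : Bool) (p : ℕ) (z : Bits n) (lab : Fin n → Bits l) :
    Bits (2 + Q + n + n * l) :=
  Fin.append (Fin.append (Fin.append ![flag, payload] (oneHot Q p)) z) (flatRows lab)

namespace Ctext

variable {Q n l : ℕ} (c : Bits (2 + Q + n + n * l))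

def header : Bits 2 := fun t => c (.castAdd _ (.castAdd _ (.castAdd _ t)))
def position : Bits Q := fun t => c (.castAdd _ (.castAdd _ (.natAdd _ t)))
def mask : Bits n := fun t => c (.castAdd _ (.natAdd _ t))
def label (i : Fin n) : Bits l := fun t => c (.natAdd _ (finProdFinEquiv (i, t)))

end Ctext

open Classical in
/-- Decryption for the user with label `lab` and pads `y`. -/
noncomputable def decode {Q n l : ℕ} (y : Bits Q) (lab : Bits l) (c : Bits (2 + Q + n + n * l)) :
    Bool :=
  if Ctext.header c 0 = true then Ctext.header c 1
  else decide (∃ i, Ctext.label c i = lab ∧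
    Ctext.mask c i ≠ bitAt y (firstOne (Ctext.position c)))

/-- The encryption of the bits `f` (one for every user) at position `p`. -/
def maskAll {Q n l : ℕ} (pads : Fin n → Bits Q) (lab : Fin n → Bits l) (p : ℕ) (f : Bits n) :
    Bits (2 + Q + n + n * l) :=
  ctext false false p (fun i => Bool.xor (f i) (bitAt (pads i) p)) lab

/-- The encryption of a single bit; it falls back on a public message if some user cannot decrypt
because of a collision of labels. -/
noncomputable def encode {Q n l : ℕ} (pads : Fin n → Bits Q) (lab : Fin n → Bits l) (p : ℕ)
    (b : Bool) : Bits (2 + Q + n + n * l) :=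
  if ∀ i, decode (pads i) (lab i) (maskAll pads lab p fun _ => b) = b
    then maskAll pads lab p fun _ => b else ctext true b p (fun _ => false) lab

/-- The first half of a key. -/
def seedOf {κ : ℕ} (sk : Bits κ) : Bits (κ / 2) := fun t => sk ⟨t, by omega⟩

/-- The second half of a key. -/
def labelOf {κ : ℕ} (sk : Bits κ) : Bits (κ - κ / 2) := fun t => sk ⟨κ / 2 + t, by omega⟩

/-! ## Running times -/

section

variable {α : Type} {N : α → ℕ} {x : α → Data} {B k n Q l κ : α → ℕ}

theorem BComp.lexLT {u v : (a : α) → Bits (B a)} (hB : NComp N x B)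
    (hu : PComp N x fun a => Data.ofBits (u a)) (hv : PComp N x fun a => Data.ofBits (v a)) :
    BComp N x fun a => lexLT (u a) (v a) := by
  have h1 : ∀ {w : (a : α) → Bits (B a)}, (PComp N x fun a => Data.ofBits (w a)) →
      BComp (fun q : Σ a, Fin (B a) => N q.1)
        (fun q => .cons (x q.1) (Data.unary q.2)) (fun q => w q.1 q.2 = true) := fun hw =>
    BComp.bit (w := fun q : Σ a, Fin (B a) => _) (t := fun q => q.2) hw.weaken (.var hB)
  have h2 : ∀ {w : (a : α) → Bits (B a)}, (PComp N x fun a => Data.ofBits (w a)) →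
      BComp (fun q : Σ p : (Σ a, Fin (B a)), Fin (B p.1) => N q.1.1)
        (fun q => .cons (.cons (x q.1.1) (Data.unary q.1.2)) (Data.unary q.2))
        (fun q => w q.1.1 q.2 = true) := fun hw =>
    BComp.bit (w := fun q : Σ p : (Σ a, Fin (B a)), Fin (B p.1) => _) (t := fun q => q.2)
      hw.weaken.weaken (.var hB.weaken)
  refine BComp.exists_fin (P := fun a t => u a t = false ∧ v a t = true ∧ ∀ s < t, u a s = v a s) hB
    (.and (.eq_false (h1 hu)) (.and (h1 hv) ?_))
  exact BComp.forall_fin (P := fun q s => s < q.2 → u q.1 s = v q.1 s) hB.weaken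
    (.imp (.lt (.var hB.weaken) (NComp.var hB).weaken) (.bool_eq (h2 hu) (h2 hv)))

theorem PComp.code {u : (a : α) → Fin (k a) → Fin (n a + 1) → Bits (B a)}
    (hk : NComp N x k) (hn : NComp N x n) (hB : NComp N x B)
    (hu : BComp (fun q : Σ a, Fin (k a) × Fin (n a + 1) × Fin (B a) => N q.1)
      (fun q => .cons (.cons (.cons (x q.1) (Data.unary q.2.1)) (Data.unary q.2.2.1))
        (Data.unary q.2.2.2))
      (fun q => u q.1 q.2.1 q.2.2.1 q.2.2.2 = true)) :
    PComp N x fun a => Data.ofBitsSeq (code (u a)) := by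
  refine PComp.ofBitsSeq hk (PComp.ofBits hn.weaken ?_)
  have h : ∀ f : (q : Σ p : (Σ a, Fin (k a)), Fin (n p.1)) → Fin (n q.1.1 + 1),
      (NComp (fun q : Σ p : (Σ a, Fin (k a)), Fin (n p.1) => N q.1.1)
        (fun q => .cons (.cons (x q.1.1) (Data.unary q.1.2)) (Data.unary q.2)) fun q => f q) →
      PComp (fun q : Σ p : (Σ a, Fin (k a)), Fin (n p.1) => N q.1.1)
        (fun q => .cons (.cons (x q.1.1) (Data.unary q.1.2)) (Data.unary q.2))
        (fun q => Data.ofBits (u q.1.1 q.1.2 (f q))) := fun f hf => by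
    refine PComp.ofBits hB.weaken.weaken (BComp.of_env ?_ (hu.comp
      fun r : Σ q : (Σ p : (Σ a, Fin (k a)), Fin (n p.1)), Fin (B q.1.1) =>
        (⟨r.1.1.1, r.1.1.2, f r.1, r.2⟩ : Σ a, Fin (k a) × Fin (n a + 1) × Fin (B a))))
    exact PComp.cons (PComp.cons PComp.self.fst.fst (PComp.trans PComp.self.fst (hf.1.comp _)))
      PComp.self.snd
  refine BComp.congr (P := fun q : Σ p : (Σ a, Fin (k a)), Fin (n p.1) =>
    _root_.lexLT (u q.1.1 q.1.2 q.2.succ) (u q.1.1 q.1.2 0)) ?_ fun q => by simp [_root_.code]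
  refine BComp.lexLT hB.weaken.weaken (h (fun q => q.2.succ) ?_) (h (fun q => 0) ?_)
  · exact ((NComp.var hn.weaken).add (.const 1)).congr fun q => by simp
  · exact (NComp.const 0).congr fun q => by simp

/-- Reading an entry of a bit matrix. -/
theorem BComp.entry {c : (a : α) → Fin (k a) → Bits (n a)} {i : (a : α) → Fin (k a)}
    {t : (a : α) → Fin (n a)} (hc : PComp N x fun a => Data.ofBitsSeq (c a))
    (hi : NComp N x fun a => (i a : ℕ)) (ht : NComp N x fun a => (t a : ℕ)) :
    BComp N x fun a => c a (i a) (t a) = true :=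
  .bit (hc.row hi) ht

theorem NComp.weight {c : (a : α) → Bits (n a)} (hn : NComp N x n)
    (hc : PComp N x fun a => Data.ofBits (c a)) : NComp N x fun a => weight (c a) :=
  .sum_fin hn (.ite (BComp.bit (w := fun q : Σ a, Fin (n a) => c q.1) (t := fun q => q.2)
    hc.weaken (.var hn)) (.const 1) (.const 0))

theorem NComp.score {F : (a : α) → Fin (k a) → Bits (n a)} {w : (a : α) → Bits (k a)}
    {i : (a : α) → Fin (n a)} (hk : NComp N x k) (hn : NComp N x n)
    (hF : PComp N x fun a => Data.ofBitsSeq (F a)) (hw : PComp N x fun a => Data.ofBits (w a))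
    (hi : NComp N x fun a => (i a : ℕ)) : NComp N x fun a => score (F a) (w a) (i a) := by
  have hM : NComp N x fun a => 16 * n a * (n a + 1) := ((NComp.const 16).mul hn).mul (hn.add (.const 1))
  have hj := NComp.var hk
  have hwt := NComp.weight (c := fun q : Σ a, Fin (k a) => F q.1 q.2) hn.weaken
    (PComp.row (c := fun q : Σ a, Fin (k a) => F q.1) (i := fun q => q.2) hF.weaken hj)
  refine .sum_fin hk (.ite (.and ?_ ?_) (.add (.div hM.weaken hwt)
    (.div hM.weaken (.sub hn.weaken hwt))) (.const 0))
  · exact BComp.bit (w := fun q : Σ a, Fin (k a) => w q.1) (t := fun q => q.2) hw.weaken hj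
  · exact BComp.entry (c := fun q : Σ a, Fin (k a) => F q.1) (i := fun q => q.2)
      (t := fun q => i q.1) hF.weaken hj hi.weaken

theorem NComp.accuse {F : (a : α) → Fin (k a) → Bits (n a)} {w : (a : α) → Bits (k a)}
    (hk : NComp N x k) (hn : NComp N x n)
    (hF : PComp N x fun a => Data.ofBitsSeq (F a)) (hw : PComp N x fun a => Data.ofBits (w a)) :
    NComp N x fun a => accuse (F a) (w a) := by
  refine .sum_fin hn (.ite ?_ (.const 1) (.const 0))
  refine BComp.forall_fin (P := fun q i' => (i' : ℕ) ≤ q.2 → ∃ i'' : Fin (n q.1),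
    _root_.score (F q.1) (w q.1) i' < _root_.score (F q.1) (w q.1) i'') hn.weaken
    (.imp (.le (.var hn.weaken) (NComp.var hn).weaken) ?_)
  refine BComp.exists_fin hn.weaken.weaken (.lt ?_ ?_)
  · exact NComp.score (i := fun q : Σ p : (Σ p : (Σ a, Fin (n a)), Fin (n p.1)), Fin (n p.1.1) => q.1.2)
      hk.weaken.weaken.weaken hn.weaken.weaken.weaken
      hF.weaken.weaken.weaken hw.weaken.weaken.weaken (NComp.var hn.weaken).weaken
  · exact NComp.score (i := fun q : Σ p : (Σ p : (Σ a, Fin (n a)), Fin (n p.1)), Fin (n p.1.1) => q.2)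
      hk.weaken.weaken.weaken hn.weaken.weaken.weaken
      hF.weaken.weaken.weaken hw.weaken.weaken.weaken (NComp.var hn.weaken.weaken)

theorem PComp.append {u : (a : α) → Bits (k a)} {v : (a : α) → Bits (n a)}
    (hk : NComp N x k) (hn : NComp N x n)
    (hu : PComp N x fun a => Data.ofBits (u a)) (hv : PComp N x fun a => Data.ofBits (v a)) :
    PComp N x fun a => Data.ofBits (Fin.append (u a) (v a)) := by
  refine PComp.ofBits (hk.add hn) (BComp.congr (P := fun q : Σ a, Fin (k a + n a) =>
    if (q.2 : ℕ) < k q.1 then _root_.bitAt (u q.1) q.2 = true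
      else _root_.bitAt (v q.1) (q.2 - k q.1) = true) ?_ ?_)
  · have hvar := NComp.var (hk.add hn)
    exact .ite (.lt hvar hk.weaken)
      (BComp.bitAt (w := fun q : Σ a, Fin (k a + n a) => u q.1) hu.weaken hvar)
      (BComp.bitAt (w := fun q : Σ a, Fin (k a + n a) => v q.1) hv.weaken (hvar.sub hk.weaken))
  · rintro ⟨a, t⟩
    induction t using Fin.addCases with
    | left t => simp
    | right t => simp

theorem PComp.flatRows {M : (a : α) → Fin (n a) → Bits (l a)} (hn : NComp N x n) (hl : NComp N x l)
    (hM : PComp N x fun a => Data.ofBitsSeq (M a)) :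
    PComp N x fun a => Data.ofBits (flatRows (M a)) := by
  have hvar := NComp.var (hn.mul hl)
  exact PComp.ofBits (hn.mul hl) (BComp.entry (c := fun q : Σ a, Fin (n a * l a) => M q.1)
    (i := fun q => q.2.divNat) (t := fun q => q.2.modNat) hM.weaken
    (hvar.div hl.weaken) (hvar.mod hl.weaken))

theorem PComp.ctext {b c : α → Bool} {p : α → ℕ} {z : (a : α) → Bits (n a)}
    {lab : (a : α) → Fin (n a) → Bits (l a)}
    (hQ : NComp N x Q) (hn : NComp N x n) (hl : NComp N x l)
    (hb : BComp N x fun a => b a = true) (hc : BComp N x fun a => c a = true) (hp : NComp N x p)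
    (hz : PComp N x fun a => Data.ofBits (z a)) (hlab : PComp N x fun a => Data.ofBitsSeq (lab a)) :
    PComp N x fun a => Data.ofBits (ctext (Q := Q a) (b a) (c a) (p a) (z a) (lab a)) := by
  refine .append (((NComp.const 2).add hQ).add hn) (hn.mul hl)
    (.append ((NComp.const 2).add hQ) hn (.append (.const 2) hQ ?_ ?_) hz) (.flatRows hn hl hlab)
  · exact (PComp.cons hb.to_bool (PComp.cons hc.to_bool .nil)).congr fun a => rfl
  · exact PComp.ofBits hQ ((BComp.eq (.var hQ) hp.weaken).congr fun q => by simp [oneHot])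

theorem NComp.firstOne {f : (a : α) → Bits (Q a)} (hQ : NComp N x Q)
    (hf : PComp N x fun a => Data.ofBits (f a)) : NComp N x fun a => firstOne (f a) :=
  .sum_fin hQ (.ite (BComp.forall_fin (P := fun q s => (s : ℕ) ≤ q.2 → f q.1 s = false) hQ.weaken
    (.imp (.le (.var hQ.weaken) (NComp.var hQ).weaken) (.eq_false (BComp.bit
      (w := fun q : Σ p : (Σ a, Fin (Q a)), Fin (Q p.1) => f q.1.1) (t := fun q => q.2)
      hf.weaken.weaken (.var hQ.weaken))))) (.const 1) (.const 0))

/-- Extraction of a part of a bit string. -/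
theorem PComp.part {c : (a : α) → Bits (k a)} {f : (a : α) → Fin (n a) → Fin (k a)}
    (hc : PComp N x fun a => Data.ofBits (c a)) (hn : NComp N x n)
    (hf : NComp (fun q : Σ a, Fin (n a) => N q.1)
      (fun q => .cons (x q.1) (Data.unary q.2)) (fun q => (f q.1 q.2 : ℕ))) :
    PComp N x fun a => Data.ofBits fun t => c a (f a t) :=
  PComp.ofBits hn (BComp.bit (w := fun q : Σ a, Fin (n a) => c q.1) (t := fun q => f q.1 q.2)
    hc.weaken hf)

theorem BComp.decode {y : (a : α) → Bits (Q a)} {lab : (a : α) → Bits (l a)}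
    {c : (a : α) → Bits (2 + Q a + n a + n a * l a)}
    (hQ : NComp N x Q) (hn : NComp N x n) (hl : NComp N x l)
    (hy : PComp N x fun a => Data.ofBits (y a)) (hlab : PComp N x fun a => Data.ofBits (lab a))
    (hc : PComp N x fun a => Data.ofBits (c a)) :
    BComp N x fun a => decode (y a) (lab a) (c a) = true := by
  have hpos : PComp N x fun a => Data.ofBits (Ctext.position (c a)) :=
    PComp.part (c := c) (f := fun _ t => .castAdd _ (.castAdd _ (.natAdd _ t))) hc hQ
      (((NComp.const 2).add (.var hQ)).congr fun q => by simp)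
  have hmask : PComp N x fun a => Data.ofBits (Ctext.mask (c a)) :=
    PComp.part (c := c) (f := fun _ t => .castAdd _ (.natAdd _ t)) hc hn
      ((((NComp.const 2).add hQ).weaken.add (.var hn)).congr fun q => by simp)
  have hlabel : PComp (fun q : Σ a, Fin (n a) => N q.1) (fun q => .cons (x q.1) (Data.unary q.2))
      fun q => Data.ofBits (Ctext.label (c q.1) q.2) := by
    refine PComp.part (f := fun _ t => .natAdd _ (finProdFinEquiv (_, t))) (k := fun q : Σ a, Fin (n a) => 2 + Q q.1 + n q.1 + n q.1 * l q.1)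
      (n := fun q : Σ a, Fin (n a) => l q.1) (c := fun q : Σ a, Fin (n a) => c q.1)
      hc.weaken hl.weaken ?_
    refine NComp.congr (f := fun r : Σ q : (Σ a, Fin (n a)), Fin (l q.1) => 2 + Q r.1.1 + n r.1.1 + ((r.2 : ℕ) + l r.1.1 * (r.1.2 : ℕ)))
      (.add (((NComp.const 2).add hQ).add hn).weaken.weaken
        (.add (.var hl.weaken) (.mul hl.weaken.weaken (NComp.var hn).weaken))) ?_
    intro r
    simp
  have hhdr : ∀ t : Fin 2, BComp N x fun a => Ctext.header (c a) t = true := fun t =>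
    BComp.bit (t := fun a => .castAdd _ (.castAdd _ (.castAdd _ t))) hc (NComp.const t)
  refine BComp.congr (P := fun a => if Ctext.header (c a) 0 = true then Ctext.header (c a) 1 = true
    else ∃ i, Ctext.label (c a) i = lab a ∧
      ¬ (Ctext.mask (c a) i = _root_.bitAt (y a) (firstOne (Ctext.position (c a))))) ?_ fun a => by
        unfold _root_.decode; split_ifs <;> simp
  refine .ite (hhdr 0) (hhdr 1) (.exists_fin hn (.and ?_ (.not (.bool_eq ?_ ?_))))
  · exact BComp.bits_eq (m := fun q : Σ a, Fin (n a) => l q.1) hl.weaken hlabel hlab.weaken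
  · exact BComp.bit (w := fun q : Σ a, Fin (n a) => Ctext.mask (c q.1)) (t := fun q => q.2)
      hmask.weaken (.var hn)
  · exact BComp.bitAt (w := fun q : Σ a, Fin (n a) => y q.1) hy.weaken (NComp.firstOne hQ hpos).weaken

theorem PComp.maskAll {pads : (a : α) → Fin (n a) → Bits (Q a)}
    {lab : (a : α) → Fin (n a) → Bits (l a)} {p : α → ℕ} {f : (a : α) → Bits (n a)}
    (hQ : NComp N x Q) (hn : NComp N x n) (hl : NComp N x l)
    (hpads : PComp N x fun a => Data.ofBitsSeq (pads a))
    (hlab : PComp N x fun a => Data.ofBitsSeq (lab a)) (hp : NComp N x p)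
    (hf : PComp N x fun a => Data.ofBits (f a)) :
    PComp N x fun a => Data.ofBits (maskAll (pads a) (lab a) (p a) (f a)) := by
  refine .ctext hQ hn hl (BComp.const_false.congr fun a => by simp)
    (BComp.const_false.congr fun a => by simp) hp (.ofBits hn (.xor ?_ ?_)) hlab
  · exact BComp.bit (w := fun q : Σ a, Fin (n a) => f q.1) (t := fun q => q.2) hf.weaken (.var hn)
  · exact BComp.bitAt (w := fun q : Σ a, Fin (n a) => pads q.1 q.2)
      (PComp.row (c := fun q : Σ a, Fin (n a) => pads q.1) (i := fun q => q.2) hpads.weaken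
        (.var hn)) hp.weaken

theorem PComp.encode {pads : (a : α) → Fin (n a) → Bits (Q a)}
    {lab : (a : α) → Fin (n a) → Bits (l a)} {p : α → ℕ} {b : α → Bool}
    (hQ : NComp N x Q) (hn : NComp N x n) (hl : NComp N x l)
    (hpads : PComp N x fun a => Data.ofBitsSeq (pads a))
    (hlab : PComp N x fun a => Data.ofBitsSeq (lab a)) (hp : NComp N x p)
    (hb : BComp N x fun a => b a = true) :
    PComp N x fun a => Data.ofBits (encode (pads a) (lab a) (p a) (b a)) := by
  have hm := PComp.maskAll hQ hn hl hpads hlab hp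
    (PComp.ofBits (w := fun a _ => b a) hn (BComp.weaken hb))
  refine PComp.congr (PComp.ite (inst := fun a => inferInstance) (BComp.forall_fin (P := fun a i => _root_.decode (pads a i) (lab a i)
      (_root_.maskAll (pads a) (lab a) (p a) fun _ => b a) = b a) hn (.bool_eq ?_ hb.weaken)) hm
    (PComp.ctext hQ hn hl (BComp.const_true.congr (Q := fun _ => true = true) fun a => by simp) hb hp
      (PComp.ofBits (w := fun a _ => false) hn (BComp.const_false.congr fun a => by simp)) hlab)) fun a => ?_
  · exact BComp.decode (y := fun q : Σ a, Fin (n a) => pads q.1 q.2)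
      (lab := fun q : Σ a, Fin (n a) => lab q.1 q.2) hQ.weaken hn.weaken hl.weaken
      (PComp.row (c := fun q : Σ a, Fin (n a) => pads q.1) (i := fun q => q.2) hpads.weaken
        (.var hn))
      (PComp.row (c := fun q : Σ a, Fin (n a) => lab q.1) (i := fun q => q.2) hlab.weaken
        (.var hn)) hm.weaken
  · unfold _root_.encode
    split_ifs <;> rfl

theorem PComp.seedOf {sk : (a : α) → Bits (κ a)} (hκ : NComp N x κ)
    (h : PComp N x fun a => Data.ofBits (sk a)) : PComp N x fun a => Data.ofBits (seedOf (sk a)) :=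
  PComp.part (c := sk) (f := fun a (t : Fin (κ a / 2)) => ⟨t, by omega⟩) h (hκ.div (.const 2))
    (.var (hκ.div (.const 2)))

theorem PComp.labelOf {sk : (a : α) → Bits (κ a)} (hκ : NComp N x κ)
    (h : PComp N x fun a => Data.ofBits (sk a)) : PComp N x fun a => Data.ofBits (labelOf (sk a)) :=
  PComp.part (c := sk) (f := fun a (t : Fin (κ a - κ a / 2)) => ⟨κ a / 2 + t, by omega⟩) h
    (hκ.sub (hκ.div (.const 2)))
    (.add (hκ.div (.const 2)).weaken (.var (hκ.sub (hκ.div (.const 2)))))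

end

section

variable {α : Type} {N : α → ℕ} {x : α → Data} {m B k n Q l κ : α → ℕ}

theorem PComp.coinKeys (s c : ℕ) {w : (a : α) → Bits (m a)}
    (hw : PComp N x fun a => Data.ofBits (w a)) (hn : NComp N x n) (hκ : NComp N x κ) :
    PComp N x fun a => Data.ofBitsSeq (coinKeys (n a) (κ a) (coins s c (w a))) :=
  .ofBitsSeq hn (.ofBits hκ.weaken (BComp.coins s c
    (w := fun q : Σ p : (Σ a, Fin (n a)), Fin (κ p.1) => w q.1.1) hw.weaken.weaken
    (.add (.var hκ.weaken) (.mul hκ.weaken.weaken (NComp.var hn).weaken))))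

theorem PComp.codeOfCoins (s c : ℕ) {w : (a : α) → Bits (m a)}
    (hw : PComp N x fun a => Data.ofBits (w a)) (hk : NComp N x k) (hn : NComp N x n)
    (hB : NComp N x B) :
    PComp N x fun a => Data.ofBitsSeq (_root_.code (coinColumns (k a) (n a) (B a) (coins s c (w a)))) := by
  refine PComp.code hk hn hB ?_
  have h : ∀ {f : α → ℕ}, NComp N x f → NComp
      (fun q : Σ a, Fin (k a) × Fin (n a + 1) × Fin (B a) => N q.1)
      (fun q => .cons (.cons (.cons (x q.1) (Data.unary q.2.1)) (Data.unary q.2.2.1))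
        (Data.unary q.2.2.2)) (fun q => f q.1) := fun hf =>
    .of_env PComp.self.fst.fst.fst (hf.comp _)
  have hw' : PComp (fun q : Σ a, Fin (k a) × Fin (n a + 1) × Fin (B a) => N q.1)
      (fun q => .cons (.cons (.cons (x q.1) (Data.unary q.2.1)) (Data.unary q.2.2.1))
        (Data.unary q.2.2.2)) (fun q => Data.ofBits (w q.1)) :=
    .trans PComp.self.fst.fst.fst (hw.comp _)
  refine BComp.coins s c (w := fun q : Σ a, Fin (k a) × Fin (n a + 1) × Fin (B a) => w q.1) hw'
    (.add ⟨PComp.self.snd, (h hB).2.mono fun q => q.2.2.2.2.le⟩ (.mul (h hB) (.add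
      ⟨PComp.self.fst.snd, ((h hn).add (.const 1)).2.mono fun q => q.2.2.1.2.le⟩
      (.mul ((h hn).add (.const 1)) ⟨PComp.self.fst.fst.snd, (h hk).2.mono fun q => q.2.1.2.le⟩))))

theorem PComp.maskCode {pads : (a : α) → Fin (n a) → Bits (Q a)}
    {lab : (a : α) → Fin (n a) → Bits (l a)} {F : (a : α) → Fin (k a) → Bits (n a)}
    (hk : NComp N x k) (hQ : NComp N x Q) (hn : NComp N x n) (hl : NComp N x l)
    (hpads : PComp N x fun a => Data.ofBitsSeq (pads a))
    (hlab : PComp N x fun a => Data.ofBitsSeq (lab a))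
    (hF : PComp N x fun a => Data.ofBitsSeq (F a)) :
    PComp N x fun a => Data.ofBitsSeq fun j : Fin (k a) => _root_.maskAll (pads a) (lab a) j (F a j) :=
  .ofBitsSeq hk (PComp.maskAll (pads := fun q : Σ a, Fin (k a) => pads q.1)
    (lab := fun q : Σ a, Fin (k a) => lab q.1) (f := fun q : Σ a, Fin (k a) => F q.1 q.2)
    hQ.weaken hn.weaken hl.weaken hpads.weaken hlab.weaken (.var hk)
    (PComp.row (c := fun q : Σ a, Fin (k a) => F q.1) (i := fun q => q.2) hF.weaken (.var hk)))

end

/-- The number of ciphertexts that are used to trace `n` users. -/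
def numQueries (n : ℕ) : ℕ := n ^ 2 * (Nat.log 2 n + 1) ^ 3

theorem NComp.numQueries {α : Type} {N : α → ℕ} {x : α → Data} {n : α → ℕ} (hn : NComp N x n) :
    NComp N x fun a => numQueries (n a) :=
  (hn.pow 2).mul ((hn.log.add (.const 1)).pow 3)

/-- `G` is computable in polynomial time. -/
def EfficientGenerator {ℓ : ℕ → ℕ} (G : (κ : ℕ) → Bits κ → Bits (ℓ κ)) : Prop :=
  ∃ (p : Prog) (d : ℕ), ∀ (κ : ℕ) (s : Bits κ),
    p.ComputesIn (Data.ofBits s) (Data.ofBits (G κ s)) ((κ + 2) ^ d)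

/-! ### Computability of pads, labels and the number of users -/

section

variable {n : ℕ → ℕ} {G : (κ : ℕ) → Bits κ → Bits (n κ ^ 7)}

/-- The pads that the keys expand to. -/
def padsOf (G : (κ : ℕ) → Bits κ → Bits (n κ ^ 7)) {A κ : ℕ} (sk : Fin A → Bits κ) :
    Fin A → Bits (n (κ / 2) ^ 7) := fun i => G (κ / 2) (seedOf (sk i))

/-- The labels of the keys. -/
def labelsOf {A κ : ℕ} (sk : Fin A → Bits κ) : Fin A → Bits (κ - κ / 2) := fun i => labelOf (sk i)

section

variable {α : Type} {N : α → ℕ} {x : α → Data} {κ A : α → ℕ}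

theorem PComp.generator (hG : EfficientGenerator G) {s : (a : α) → Bits (κ a)}
    (hκ : PBdd N κ) (hs : PComp N x fun a => Data.ofBits (s a)) :
    PComp N x fun a => Data.ofBits (G (κ a) (s a)) := by
  obtain ⟨p, d, hp⟩ := hG
  exact hs.trans (.of_prog ((hκ.add (.const N 2)).pow d) fun a => hp (κ a) (s a))

/-- The number of users is the seventh root of the output length of the generator. -/
theorem NComp.users (hG : EfficientGenerator G) (hn : PBdd id n) (hκ : NComp N x κ) :
    NComp N x fun a => n (κ a) := by
  have hb : PBdd N fun a => n (κ a) := by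
    obtain ⟨d, hd⟩ := hn
    exact ((hκ.2.add (.const N 2)).pow d).mono fun a => hd _
  -- No program for `n` is at hand; its seventh power is measured as the length of the generator's
  -- output on the zero seed.
  have hlen : NComp N x fun a => n (κ a) ^ 7 := by
    have h := PComp.generator hG hκ.2 (PComp.ofBits (w := fun a _ => false) hκ
      (BComp.const_false.congr fun a => by simp))
    refine (NComp.length h ((hb.pow 7).mono fun a => by simp)).congr fun a => by simp
  refine (NComp.sum (f := fun a i => if (i + 1) ^ 7 ≤ n (κ a) ^ 7 then 1 else 0) hlen
    (.ite (.le (((NComp.var hlen).add (.const 1)).pow 7) hlen.weaken) (.const 1)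
      (.const 0))).congr fun a => ?_
  rw [Finset.sum_boole, Nat.cast_id]
  have : (Finset.range (n (κ a) ^ 7)).filter (fun i => (i + 1) ^ 7 ≤ n (κ a) ^ 7) =
      Finset.range (n (κ a)) := by
    ext i
    rw [Finset.mem_filter, Finset.mem_range, Finset.mem_range,
      Nat.pow_le_pow_iff_left (by norm_num), Nat.succ_le_iff]
    exact ⟨fun h => h.2, fun h => ⟨h.trans_le (Nat.le_self_pow (by norm_num) _), h⟩⟩
  rw [this, Finset.card_range]

theorem PComp.padsOf (hG : EfficientGenerator G) {sk : (a : α) → Fin (A a) → Bits (κ a)}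
    (hκ : NComp N x κ) (hA : NComp N x A) (hsk : PComp N x fun a => Data.ofBitsSeq (sk a)) :
    PComp N x fun a => Data.ofBitsSeq (padsOf G (sk a)) :=
  .ofBitsSeq hA (PComp.generator (κ := fun q : Σ a, Fin (A a) => κ q.1 / 2) hG
    (hκ.div (.const 2)).weaken.2
    (.seedOf hκ.weaken (.row (c := fun q : Σ a, Fin (A a) => sk q.1) (i := fun q => q.2)
      hsk.weaken (.var hA))))

theorem PComp.labelsOf {sk : (a : α) → Fin (A a) → Bits (κ a)}
    (hκ : NComp N x κ) (hA : NComp N x A) (hsk : PComp N x fun a => Data.ofBitsSeq (sk a)) :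
    PComp N x fun a => Data.ofBitsSeq (labelsOf (sk a)) :=
  .ofBitsSeq hA (.labelOf hκ.weaken (.row (c := fun q : Σ a, Fin (A a) => sk q.1)
    (i := fun q => q.2) hsk.weaken (.var hA)))

end

/-! ## The scheme -/

/-- The length of ciphertexts. -/
def ctextLength (n : ℕ → ℕ) (κ : ℕ) : ℕ := 2 + n (κ / 2) ^ 7 + n κ + n κ * (κ - κ / 2)

def genKeys (n : ℕ → ℕ) (κ : ℕ) {m : ℕ} (ω : Bits m) : Fin (n κ) → Bits κ :=
  coinKeys (n κ) κ (coins 1 0 ω)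

/-- The position has `Nat.log 2 Q` random binary digits for `Q` pads, so it is below `Q` whenever
there are pads at all. -/
noncomputable def encBit (G : (κ : ℕ) → Bits κ → Bits (n κ ^ 7)) (κ : ℕ) {m : ℕ} (ω : Bits m)
    (sk : Fin (n κ) → Bits κ) (b : Bool) : Bits (ctextLength n κ) :=
  encode (padsOf G sk) (labelsOf sk) (binVal (Nat.log 2 (n (κ / 2) ^ 7)) (coins 1 0 ω)) b

noncomputable def decBit (G : (κ : ℕ) → Bits κ → Bits (n κ ^ 7)) (κ : ℕ) (sk : Bits κ)
    (c : Bits (ctextLength n κ)) : Bool :=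
  decode (n := n κ) (G (κ / 2) (seedOf sk)) (labelOf sk) c

/-- The code that is used for tracing. -/
noncomputable def traceCode (n : ℕ → ℕ) (κ : ℕ) {m : ℕ} (ω : Bits m) :
    Fin (numQueries (n κ)) → Bits (n κ) :=
  code (coinColumns (numQueries (n κ)) (n κ) κ (coins 1 0 ω))

/-- Every query has its own position, so no pad bit masks two bits of the code as long as there are
enough pads. -/
noncomputable def traceQuery (G : (κ : ℕ) → Bits κ → Bits (n κ ^ 7)) (κ : ℕ) {m : ℕ} (ω : Bits m)
    (sk : Fin (n κ) → Bits κ) : Fin (numQueries (n κ)) → Bits (ctextLength n κ) :=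
  fun j => maskAll (padsOf G sk) (labelsOf sk) j (traceCode n κ ω j)

/-- A user of maximal score is not counted by `accuse`, so the count stays below `n`. -/
theorem accuse_lt {k n : ℕ} (hn : 0 < n) (F : Fin k → Bits n) (a : Bits k) : accuse F a < n := by
  classical
  obtain ⟨i, -, hi⟩ := Finset.exists_max_image Finset.univ (score F a) ⟨⟨0, hn⟩, Finset.mem_univ _⟩
  unfold accuse
  refine (Finset.sum_lt_sum (g := fun _ => 1) (fun j _ => by split_ifs <;> simp)
    ⟨i, Finset.mem_univ _, ?_⟩).trans_le (by simp)
  rw [if_neg]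
  · exact Nat.zero_lt_one
  · intro h
    obtain ⟨j, hj⟩ := h i le_rfl
    exact absurd (hi j (Finset.mem_univ _)) (by omega)

theorem Ctext.header_ctext {Q n l : ℕ} (b c : Bool) (p : ℕ) (z : Bits n) (lab : Fin n → Bits l)
    (t : Fin 2) : Ctext.header (ctext (Q := Q) b c p z lab) t = ![b, c] t := by
  simp [Ctext.header, ctext]

theorem decode_encode {Q n l : ℕ} (pads : Fin n → Bits Q) (lab : Fin n → Bits l) (p : ℕ) (b : Bool)
    (i : Fin n) : decode (pads i) (lab i) (encode pads lab p b) = b := by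
  unfold encode
  split_ifs with h
  · exact h i
  · simp [decode, Ctext.header_ctext]

/-- Programs for the algorithms of the scheme, with a common bound for their running times. -/
structure SchemePrograms (G : (κ : ℕ) → Bits κ → Bits (n κ ^ 7)) where
  e : ℕ
  -- The next two fields say that there are enough coins for independent keys and for independent
  -- columns of the code.
  gen_coins : ∀ κ, n κ * κ ≤ (κ + n κ + 2) ^ e
  trace_coins : ∀ κ, numQueries (n κ) * ((n κ + 1) * κ) ≤ (κ + n κ + numQueries (n κ) + 2) ^ e
  -- The programs below accept coin strings of any length `m`: the actual length depends on `e`,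
  -- which is chosen after the programs, and the running times do not depend on it.
  genProg : Prog
  gen_computes : ∀ (κ m : ℕ) (ω : Bits m), genProg.ComputesIn
    (Data.ofList [Data.unary κ, Data.ofBits ω])
    (Data.ofBitsSeq (genKeys n κ ω)) ((κ + n κ + 2) ^ e)
  encProg : Prog
  enc_computes : ∀ (κ m : ℕ) (ω : Bits m) sk b, encProg.ComputesIn
    (Data.ofList [Data.unary κ, Data.ofBits ω, Data.ofBitsSeq sk, Data.ofBool b])
    (Data.ofBits (encBit G κ ω sk b)) ((κ + n κ + 2) ^ e)
  decProg : Prog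
  dec_computes : ∀ κ sk c, decProg.ComputesIn
    (Data.ofList [Data.unary κ, Data.ofBits sk, Data.ofBits c])
    (Data.ofBool (decBit G κ sk c)) ((κ + n κ + 2) ^ e)
  queryProg : Prog
  query_computes : ∀ (κ m : ℕ) (ω : Bits m) sk, queryProg.ComputesIn
    (Data.ofList [Data.unary κ, Data.ofBits ω, Data.ofBitsSeq sk])
    (Data.ofBitsSeq (traceQuery G κ ω sk)) ((κ + n κ + numQueries (n κ) + 2) ^ e)
  traceProg : Prog
  trace_computes : ∀ (κ m : ℕ) (ω : Bits m) (sk : Fin (n κ) → Bits κ) a, traceProg.ComputesIn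
    (Data.ofList [Data.unary κ, Data.ofBits ω, Data.ofBitsSeq sk, Data.ofBits a])
    (Data.unary (accuse (traceCode n κ ω) a)) ((κ + n κ + numQueries (n κ) + 2) ^ e)

/-- The traitor-tracing scheme. -/
noncomputable def SchemePrograms.scheme (P : SchemePrograms G) :
    TTScheme n fun κ => numQueries (n κ) where
  clen := ctextLength n
  e := P.e
  gen κ ω := genKeys n κ ω
  enc κ ω sk b := encBit G κ ω sk b
  dec κ sk c := decBit G κ sk c
  query κ ω sk := traceQuery G κ ω sk
  trace κ ω _ a := accuse (traceCode n κ ω) a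
  trace_lt _ _ _ _ h := accuse_lt h _ _
  correct _ _ _ _ i := decode_encode _ _ _ _ i
  genProg := P.genProg
  gen_computes κ ω := P.gen_computes κ _ ω
  encProg := P.encProg
  enc_computes κ ω sk b := P.enc_computes κ _ ω sk b
  decProg := P.decProg
  dec_computes κ sk c := P.dec_computes κ sk c
  queryProg := P.queryProg
  query_computes κ ω sk := P.query_computes κ _ ω sk
  traceProg := P.traceProg
  trace_computes κ ω sk a := P.trace_computes κ _ ω sk a

/-! ### Running times of the algorithms of the scheme -/

theorem NComp.parameters {α : Type} {N : α → ℕ} {x : α → Data} {κ : α → ℕ}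
    (hG : EfficientGenerator G) (hn : PBdd id n) (h : NComp N x κ) :
    NComp N x (fun a => n (κ a)) ∧ NComp N x (fun a => n (κ a / 2) ^ 7) ∧
      NComp N x (fun a => κ a - κ a / 2) ∧ NComp N x (fun a => _root_.numQueries (n (κ a))) :=
  ⟨.users hG hn h, (NComp.users hG hn (h.div (.const 2))).pow 7, h.sub (h.div (.const 2)),
    .numQueries (.users hG hn h)⟩

theorem exists_genProg (hG : EfficientGenerator G) (hn : PBdd id n) :
    ∃ (p : Prog) (d : ℕ), ∀ a : (Σ _ : ℕ, Σ m, Bits m), p.ComputesIn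
    (Data.ofList [Data.unary a.1, Data.ofBits a.2.2]) (Data.ofBitsSeq (genKeys n a.1 a.2.2))
    ((a.1 + 2) ^ d) := by
  have hκ : NComp (fun a : (Σ _ : ℕ, Σ m, Bits m) => a.1)
    (fun a => Data.ofList [Data.unary a.1, Data.ofBits a.2.2]) (fun a => a.1) :=
    ⟨PComp.self.fst, .self _⟩
  exact (PComp.coinKeys 1 0 (w := fun a => a.2.2) PComp.self.snd.fst (NComp.parameters hG hn hκ).1 hκ).exists_prog

theorem exists_encProg (hG : EfficientGenerator G) (hn : PBdd id n) :
    ∃ (p : Prog) (d : ℕ),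
    ∀ a : (Σ κ : ℕ, Σ m, Bits m × (Fin (n κ) → Bits κ) × Bool), p.ComputesIn
    (Data.ofList [Data.unary a.1, Data.ofBits a.2.2.1, Data.ofBitsSeq a.2.2.2.1,
      Data.ofBool a.2.2.2.2]) (Data.ofBits (encBit G a.1 a.2.2.1 a.2.2.2.1 a.2.2.2.2))
    ((a.1 + 2) ^ d) := by
  let x : (Σ κ : ℕ, Σ m, Bits m × (Fin (n κ) → Bits κ) × Bool) → Data := fun a =>
    Data.ofList [Data.unary a.1, Data.ofBits a.2.2.1, Data.ofBitsSeq a.2.2.2.1,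
      Data.ofBool a.2.2.2.2]
  have hκ : NComp (fun a => a.1) x (fun a => a.1) := ⟨PComp.self.fst, .self _⟩
  obtain ⟨hn', hQ, hl, -⟩ := NComp.parameters hG hn hκ
  have hω : PComp (fun a => a.1) x (fun a => Data.ofBits a.2.2.1) := PComp.self.snd.fst
  have hsk : PComp (fun a => a.1) x (fun a => Data.ofBitsSeq a.2.2.2.1) := PComp.self.snd.snd.fst
  have hb : BComp (fun a => a.1) x (fun a => a.2.2.2.2 = true) :=
    .of_bool PComp.self.snd.snd.snd.fst
  have hpos : NComp (fun a => a.1) x (fun a =>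
      binVal (Nat.log 2 (n (a.1 / 2) ^ 7)) (coins 1 0 a.2.2.1)) := by
    refine .binVal hQ.log hQ (fun a q hq => ?_) ?_
    · rcases Nat.eq_zero_or_pos (n (a.1 / 2) ^ 7) with h | h
      · simp [h] at hq
      · have := Nat.pow_le_of_le_log (by omega) hq.le
        omega
    · exact BComp.coins 1 0 (w := fun q : (Σ a : (Σ κ : ℕ, Σ m, Bits m × (Fin (n κ) → Bits κ) × Bool),
        Fin (Nat.log 2 (n (a.1 / 2) ^ 7))) => q.1.2.2.1) hω.weaken (.var hQ.log)
  have h := PComp.encode hQ hn' hl (PComp.padsOf hG hκ hn' hsk) (PComp.labelsOf hκ hn' hsk) hpos hb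
  exact h.exists_prog

theorem exists_decProg (hG : EfficientGenerator G) (hn : PBdd id n) :
    ∃ (p : Prog) (d : ℕ),
    ∀ a : (Σ κ : ℕ, Bits κ × Bits (ctextLength n κ)), p.ComputesIn
    (Data.ofList [Data.unary a.1, Data.ofBits a.2.1, Data.ofBits a.2.2])
    (Data.ofBool (decBit G a.1 a.2.1 a.2.2)) ((a.1 + 2) ^ d) := by
  have hκ : NComp (fun a : (Σ κ : ℕ, Bits κ × Bits (ctextLength n κ)) => a.1)
    (fun a => Data.ofList [Data.unary a.1, Data.ofBits a.2.1, Data.ofBits a.2.2])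
    (fun a => a.1) := ⟨PComp.self.fst, .self _⟩
  obtain ⟨hn', hQ, hl, -⟩ := NComp.parameters hG hn hκ
  exact (BComp.decode hQ hn' hl (PComp.generator hG (hκ.div (.const 2)).2
    (.seedOf hκ (sk := fun a => a.2.1) PComp.self.snd.fst))
    (.labelOf hκ (sk := fun a => a.2.1) PComp.self.snd.fst)
    (PComp.self.snd.snd.fst)).to_bool.exists_prog

theorem exists_queryProg (hG : EfficientGenerator G) (hn : PBdd id n) :
    ∃ (p : Prog) (d : ℕ),
    ∀ a : (Σ κ : ℕ, Σ m, Bits m × (Fin (n κ) → Bits κ)), p.ComputesIn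
    (Data.ofList [Data.unary a.1, Data.ofBits a.2.2.1, Data.ofBitsSeq a.2.2.2])
    (Data.ofBitsSeq (traceQuery G a.1 a.2.2.1 a.2.2.2)) ((a.1 + 2) ^ d) := by
  let x : (Σ κ : ℕ, Σ m, Bits m × (Fin (n κ) → Bits κ)) → Data := fun a =>
    Data.ofList [Data.unary a.1, Data.ofBits a.2.2.1, Data.ofBitsSeq a.2.2.2]
  have hκ : NComp (fun a => a.1) x (fun a => a.1) := ⟨PComp.self.fst, .self _⟩
  obtain ⟨hn', hQ, hl, hk⟩ := NComp.parameters hG hn hκ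
  have hω : PComp (fun a => a.1) x (fun a => Data.ofBits a.2.2.1) := PComp.self.snd.fst
  have hsk : PComp (fun a => a.1) x (fun a => Data.ofBitsSeq a.2.2.2) := PComp.self.snd.snd.fst
  have h := PComp.maskCode hk hQ hn' hl (PComp.padsOf hG hκ hn' hsk) (PComp.labelsOf hκ hn' hsk)
    (PComp.codeOfCoins 1 0 hω hk hn' hκ)
  exact h.exists_prog

theorem exists_traceProg (hG : EfficientGenerator G) (hn : PBdd id n) :
    ∃ (p : Prog) (d : ℕ),
    ∀ a : (Σ κ : ℕ, Σ m, Bits m × (Fin (n κ) → Bits κ) × Bits (numQueries (n κ))), p.ComputesIn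
    (Data.ofList [Data.unary a.1, Data.ofBits a.2.2.1, Data.ofBitsSeq a.2.2.2.1,
      Data.ofBits a.2.2.2.2])
    (Data.unary (accuse (traceCode n a.1 a.2.2.1) a.2.2.2.2)) ((a.1 + 2) ^ d) := by
  let x : (Σ κ : ℕ, Σ m, Bits m × (Fin (n κ) → Bits κ) × Bits (numQueries (n κ))) → Data := fun a =>
    Data.ofList [Data.unary a.1, Data.ofBits a.2.2.1, Data.ofBitsSeq a.2.2.2.1,
      Data.ofBits a.2.2.2.2]
  have hκ : NComp (fun a => a.1) x (fun a => a.1) := ⟨PComp.self.fst, .self _⟩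
  obtain ⟨hn', hQ, hl, hk⟩ := NComp.parameters hG hn hκ
  have hω : PComp (fun a => a.1) x (fun a => Data.ofBits a.2.2.1) := PComp.self.snd.fst
  have ha : PComp (fun a => a.1) x (fun a => Data.ofBits a.2.2.2.2) := PComp.self.snd.snd.snd.fst
  have h := NComp.accuse hk hn' (PComp.codeOfCoins 1 0 hω hk hn' hκ) ha
  exact h.1.exists_prog

theorem SchemePrograms.nonempty (hG : EfficientGenerator G) (hn : PBdd id n) :
    Nonempty (SchemePrograms G) := by
  obtain ⟨p1, d1, h1⟩ := exists_genProg hG hn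
  obtain ⟨p2, d2, h2⟩ := exists_encProg hG hn
  obtain ⟨p3, d3, h3⟩ := exists_decProg hG hn
  obtain ⟨p4, d4, h4⟩ := exists_queryProg hG hn
  obtain ⟨p5, d5, h5⟩ := exists_traceProg hG hn
  -- The summand `3` covers the coin counts, which are products of up to three factors once
  -- `numQueries` is taken as one of them.
  let e := d1 + d2 + d3 + d4 + d5 + 3
  have hle : ∀ {z d κ : ℕ}, κ ≤ z → d ≤ e → (κ + 2) ^ d ≤ (z + 2) ^ e := fun hz hd =>
    (Nat.pow_le_pow_left (by omega) _).trans (Nat.pow_le_pow_right (by omega) hd)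
  refine ⟨⟨e, fun κ => ?_, fun κ => ?_, p1, fun κ m ω => (h1 ⟨κ, m, ω⟩).mono (hle ?_ ?_),
    p2, fun κ m ω sk b => (h2 ⟨κ, m, ω, sk, b⟩).mono (hle ?_ ?_),
    p3, fun κ sk c => (h3 ⟨κ, sk, c⟩).mono (hle ?_ ?_),
    p4, fun κ m ω sk => (h4 ⟨κ, m, ω, sk⟩).mono (hle ?_ ?_),
    p5, fun κ m ω sk a => (h5 ⟨κ, m, ω, sk, a⟩).mono (hle ?_ ?_)⟩⟩
  case refine_1 =>
    refine le_trans ?_ (Nat.pow_le_pow_right (by omega) (show 2 ≤ e by omega))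
    rw [sq]
    exact Nat.mul_le_mul (by omega) (by omega)
  case refine_2 =>
    refine le_trans ?_ (Nat.pow_le_pow_right (by omega) (show 3 ≤ e by omega))
    rw [pow_succ', sq]
    exact Nat.mul_le_mul (by omega) (Nat.mul_le_mul (by omega) (by omega))
  all_goals first | omega | (dsimp only; omega)

end

/-! ## Finite probabilities -/

section

variable {Ω Ω' : Type} [Fintype Ω] [Fintype Ω'] {E E' : Ω → Prop}

open Classical in
theorem prob_eq_sum (E : Ω → Prop) :
    prob E = (∑ ω, if E ω then (1 : ℝ) else 0) / Fintype.card Ω := by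
  simp [prob]

theorem prob_nonneg : 0 ≤ prob E := by
  unfold prob
  positivity

theorem prob_mono (h : ∀ ω, E ω → E' ω) : prob E ≤ prob E' := by
  unfold prob
  refine div_le_div_of_nonneg_right (Nat.cast_le.2 (Finset.card_le_card fun ω => ?_)) (by positivity)
  simpa using h ω

theorem prob_or_le : prob (fun ω => E ω ∨ E' ω) ≤ prob E + prob E' := by
  classical
  unfold prob
  rw [← add_div]
  gcongr
  rw [← Nat.cast_add]
  refine Nat.cast_le.2 ((Finset.card_le_card fun ω => ?_).trans (Finset.card_union_le _ _))
  simp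

theorem prob_equiv (e : Ω ≃ Ω') (E : Ω' → Prop) : prob (fun ω => E (e ω)) = prob E := by
  classical
  rw [prob_eq_sum, prob_eq_sum, Fintype.card_congr e]
  congr 1
  exact Equiv.sum_comp e fun ω => if E ω then (1 : ℝ) else 0

theorem prob_prod (E : Ω × Ω' → Prop) :
    prob E = (∑ ω, prob fun ω' => E (ω, ω')) / Fintype.card Ω := by
  classical
  simp_rw [prob_eq_sum]
  rw [Fintype.sum_prod_type, Fintype.card_prod, ← Finset.sum_div, div_div, Nat.cast_mul, mul_comm]

theorem prob_prod_le {c : ℝ} (hc : 0 ≤ c) {E : Ω × Ω' → Prop}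
    (h : ∀ ω, prob (fun ω' => E (ω, ω')) ≤ c) : prob E ≤ c := by
  rw [prob_prod]
  rcases Nat.eq_zero_or_pos (Fintype.card Ω) with h0 | h0
  · simpa [h0] using hc
  · rw [div_le_iff₀ (by exact_mod_cast h0)]
    calc _ ≤ ∑ _ω : Ω, c := Finset.sum_le_sum fun ω _ => h ω
      _ = _ := by simp [mul_comm]

theorem prob_snd [Nonempty Ω] (E : Ω' → Prop) : prob (fun ω : Ω × Ω' => E ω.2) = prob E := by
  rw [prob_prod]
  have : (Fintype.card Ω : ℝ) ≠ 0 := by exact_mod_cast Fintype.card_ne_zero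
  simp [this]

theorem prob_fst [Nonempty Ω'] (E : Ω → Prop) : prob (fun ω : Ω × Ω' => E ω.1) = prob E :=
  (prob_equiv (Equiv.prodComm Ω Ω') fun ω => E ω.2).trans (prob_snd E)

/-- One value of the first component contributes its share. -/
theorem prob_ge_of_fst [Nonempty Ω] {E : Ω × Ω' → Prop} (ω : Ω) :
    (prob fun ω' => E (ω, ω')) / Fintype.card Ω ≤ prob E := by
  rw [prob_prod]
  gcongr
  exact Finset.single_le_sum (f := fun ω => prob fun ω' => E (ω, ω')) (fun _ _ => prob_nonneg)
    (Finset.mem_univ ω)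

/-- Coins that are not used do not matter. -/
theorem prob_comp_injective {ι : Type} [Fintype ι] [DecidableEq ι] {m : ℕ} {φ : ι → Fin m}
    (hφ : Function.Injective φ) (E : (ι → Bool) → Prop) :
    prob (fun ω : Bits m => E fun i => ω (φ i)) = prob E := by
  classical
  let e1 := Equiv.ofInjective φ hφ
  -- The coins in the range of `φ` are separated from the rest, which then drop out as an
  -- independent factor.
  have h := prob_equiv ((Equiv.piEquivPiSubtypeProd (· ∈ Set.range φ) fun _ : Fin m => Bool).trans
    (Equiv.prodCongrLeft fun _ => Equiv.arrowCongr e1.symm (Equiv.refl Bool)))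
    (fun q : (ι → Bool) × _ => E q.1)
  rw [prob_fst] at h
  rw [← h]
  rfl

end

/-! ## The distribution of the columns of the code -/

/-- Subsets with `w + v + 1` elements are counted by the place of their `(w + 1)`-st element, which
has `a + w` places before it and `N - a + v` after it. The proof is by Pascal's rule. -/
theorem Nat.sum_choose_mul_choose (w v N : ℕ) :
    ∑ a ∈ Finset.range (N + 1), (a + w).choose w * (N - a + v).choose v =
      (N + w + v + 1).choose (w + v + 1) := by
  induction v generalizing N with
  | zero => simpa using Nat.sum_range_add_choose N w
  | succ v ihv =>
    induction N with
    | zero => simp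
    | succ N ih =>
      have h : ∀ a ∈ Finset.range (N + 1), (a + w).choose w * (N + 1 - a + (v + 1)).choose (v + 1) =
          (a + w).choose w * (N + 1 - a + v).choose v +
            (a + w).choose w * (N - a + (v + 1)).choose (v + 1) := fun a ha => by
        have ha' := Finset.mem_range.1 ha
        rw [show N + 1 - a + (v + 1) = (N - a + (v + 1)) + 1 by omega, Nat.choose_succ_succ,
          show N + 1 - a + v = N - a + (v + 1) by omega, mul_add]
      have h1 := ihv (N + 1)
      rw [Finset.sum_range_succ] at h1 ⊢
      rw [Finset.sum_congr rfl h, Finset.sum_add_distrib, ih,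
        show N + 1 + w + (v + 1) + 1 = (N + 1 + w + v + 1) + 1 by omega,
        show w + (v + 1) + 1 = (w + v + 1) + 1 by omega,
        show N + w + (v + 1) + 1 = N + 1 + w + v + 1 by omega,
        Nat.choose_succ_succ (N + 1 + w + v + 1), ← h1]
      simp only [Nat.sub_self, Nat.zero_add, Nat.choose_self, Nat.succ_eq_add_one]
      omega

theorem Nat.pow_le_factorial_mul_choose (a w : ℕ) : a ^ w ≤ w.factorial * (a + w).choose w := by
  rw [← Nat.ascFactorial_eq_factorial_mul_choose]
  exact (Nat.pow_le_pow_left (Nat.le_succ a) w).trans (Nat.pow_succ_le_ascFactorial _ _)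

/-- A discrete beta integral. -/
theorem sum_pow_mul_pow_le (w v N : ℕ) :
    (∑ a ∈ Finset.range N, (a : ℝ) ^ w * ((N - a : ℕ) : ℝ) ^ v) ≤
      (w.factorial * v.factorial : ℝ) / (w + v + 1).factorial * (N + (w + v + 1) : ℕ) ^ (w + v + 1) := by
  -- Powers are replaced by the larger rising factorials, for which the sum is known exactly.
  have h1 : ∑ a ∈ Finset.range N, a ^ w * (N - a) ^ v ≤
      w.factorial * v.factorial * (N + (w + v + 1)).choose (w + v + 1) := by
    rw [show N + (w + v + 1) = N + w + v + 1 by omega, ← Nat.sum_choose_mul_choose,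
      Finset.sum_range_succ, mul_add, Finset.mul_sum]
    refine le_add_right (Finset.sum_le_sum fun a _ => ?_)
    calc a ^ w * (N - a) ^ v ≤ (w.factorial * (a + w).choose w) *
          (v.factorial * (N - a + v).choose v) :=
        Nat.mul_le_mul (Nat.pow_le_factorial_mul_choose _ _) (Nat.pow_le_factorial_mul_choose _ _)
      _ = _ := by ring
  have h2 : ((N + (w + v + 1)).choose (w + v + 1) : ℝ) ≤
      ((N + (w + v + 1) : ℕ) : ℝ) ^ (w + v + 1) / (w + v + 1).factorial :=
    Nat.choose_le_pow_div _ _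
  calc (∑ a ∈ Finset.range N, (a : ℝ) ^ w * ((N - a : ℕ) : ℝ) ^ v)
      = ((∑ a ∈ Finset.range N, a ^ w * (N - a) ^ v : ℕ) : ℝ) := by push_cast; rfl
    _ ≤ ((w.factorial * v.factorial * (N + (w + v + 1)).choose (w + v + 1) : ℕ) : ℝ) :=
        Nat.cast_le.2 h1
    _ ≤ (w.factorial * v.factorial : ℝ) *
        (((N + (w + v + 1) : ℕ) : ℝ) ^ (w + v + 1) / (w + v + 1).factorial) := by
        push_cast at h2 ⊢
        gcongr
    _ = _ := by ring

theorem weight_eq_card {n : ℕ} (c : Bits n) :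
    weight c = (Finset.univ.filter fun i => c i = true).card := by
  simp [weight]

theorem weight_le {n : ℕ} (c : Bits n) : weight c ≤ n := by
  rw [weight_eq_card]
  exact (Finset.card_le_univ _).trans (by simp)

/-- The probability of a column in the idealized code. -/
noncomputable def colProb {n : ℕ} (c : Bits n) : ℝ :=
  ((weight c).factorial * (n - weight c).factorial : ℝ) / (n + 1).factorial

/-- The lexicographic order makes the bit strings of length `B` a chain with `2 ^ B` elements. -/
theorem exists_equiv_lexLT (B : ℕ) :
    ∃ e : Fin (2 ^ B) ≃ Bits B, ∀ a b, lexLT (e a) (e b) ↔ a < b := by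
  let e := Fintype.orderIsoFinOfCardEq (Lex (Fin B → Bool)) (k := 2 ^ B) (by
    rw [show Fintype.card (Lex (Fin B → Bool)) = Fintype.card (Fin B → Bool) from
      Fintype.card_congr ofLex]
    simp)
  refine ⟨e.toEquiv.trans ofLex, fun a b => ?_⟩
  rw [← e.lt_iff_lt]
  refine exists_congr fun t => ?_
  rw [← and_assoc, and_comm]
  exact and_congr Iff.rfl Bool.lt_iff.symm

-- Only ranks in the lexicographic chain matter. If the threshold `v 0` has rank `a`, each one of
-- the column leaves `a` choices and each zero `2 ^ B - a`, ties counting as zeros. The sum over `a`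
-- is the discrete beta integral; the factor `(1 + (n + 1) / 2 ^ B) ^ (n + 1)` is the price of
-- discreteness.
open Classical in
theorem card_code_column_le {n B : ℕ} (c : Bits n) :
    (Fintype.card {v : Fin (n + 1) → Bits B // ∀ i : Fin n, lexLT (v i.succ) (v 0) ↔ c i = true} : ℝ) ≤
      colProb c * (1 + (n + 1) / 2 ^ B) ^ (n + 1) * (2 ^ B) ^ (n + 1) := by
  obtain ⟨e, he⟩ := exists_equiv_lexLT B
  have h1 : Fintype.card {v : Fin (n + 1) → Bits B //
      ∀ i : Fin n, lexLT (v i.succ) (v 0) ↔ c i = true} =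
      ∑ a : Fin (2 ^ B), (a : ℕ) ^ weight c * (2 ^ B - a) ^ (n - weight c) := by
    have e0 : {v : Fin (n + 1) → Fin (2 ^ B) // ∀ i : Fin n, v i.succ < v 0 ↔ c i = true} ≃
        {v : Fin (n + 1) → Bits B // ∀ i : Fin n, lexLT (v i.succ) (v 0) ↔ c i = true} :=
      (Equiv.piCongrRight fun _ => e).subtypeEquiv fun v => by simp [he]
    -- Once the threshold is fixed, the strings of the users can be chosen independently.
    have e1 : {v : Fin (n + 1) → Fin (2 ^ B) // ∀ i : Fin n, v i.succ < v 0 ↔ c i = true} ≃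
        Σ a : Fin (2 ^ B), (i : Fin n) → {b : Fin (2 ^ B) // b < a ↔ c i = true} :=
      { toFun := fun v => ⟨v.1 0, fun i => ⟨v.1 i.succ, v.2 i⟩⟩
        invFun := fun v => ⟨Fin.cons v.1 fun i => (v.2 i).1, fun i => (v.2 i).2⟩
        left_inv := fun v => Subtype.ext (Fin.cons_self_tail v.1)
        right_inv := fun _ => rfl }
    rw [← Fintype.card_congr e0, Fintype.card_congr e1, Fintype.card_sigma]
    refine Finset.sum_congr rfl fun a _ => ?_
    rw [Fintype.card_pi]
    have h2 : ∀ i, Fintype.card {b : Fin (2 ^ B) // b < a ↔ c i = true} =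
        if c i = true then (a : ℕ) else 2 ^ B - a := fun i => by
      by_cases h : c i = true
      · simp only [h, iff_true, if_true]
        rw [Fintype.card_subtype]
        convert Fin.card_Iio a using 2
        ext
        simp
      · simp only [h, Bool.false_eq_true, iff_false, if_false, not_lt]
        rw [Fintype.card_subtype]
        convert Fin.card_Ici a using 2
        ext
        simp
    simp_rw [h2]
    rw [Finset.prod_ite, Finset.prod_const, Finset.prod_const, ← weight_eq_card]
    congr 2
    have := Finset.card_filter_add_card_filter_not (s := Finset.univ) (fun i : Fin n => c i = true)
    rw [← weight_eq_card, Finset.card_univ, Fintype.card_fin] at this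
    omega
  rw [h1, Fin.sum_univ_eq_sum_range (fun a => a ^ weight c * (2 ^ B - a) ^ (n - weight c))]
  have h3 := sum_pow_mul_pow_le (weight c) (n - weight c) (2 ^ B)
  have hw := weight_le c
  rw [show weight c + (n - weight c) + 1 = n + 1 by omega] at h3
  push_cast at h3 ⊢
  refine h3.trans (le_of_eq ?_)
  rw [colProb, mul_assoc, ← mul_pow]
  congr 2
  have : (2 : ℝ) ^ B ≠ 0 := by positivity
  field_simp


theorem colProb_nonneg {n : ℕ} (c : Bits n) : 0 ≤ colProb c := by
  unfold colProb
  positivity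

open Classical in
/-- The code is as likely to be bad as the idealized code, up to a factor of three. -/
theorem prob_code_le {k n B : ℕ} (hB : (n + 1) ^ 2 * k ≤ 2 ^ B) (E : (Fin k → Bits n) → Prop) :
    prob (fun u : Fin k → Fin (n + 1) → Bits B => E (code u)) ≤
      3 * ∑ F : Fin k → Bits n, (∏ j, colProb (F j)) * if E F then 1 else 0 := by
  have hpos : (0 : ℝ) < 2 ^ B := by positivity
  have hfib : ∀ F : Fin k → Bits n,
      ((Finset.univ.filter fun u : Fin k → Fin (n + 1) → Bits B => code u = F).card : ℝ) ≤
        3 * (∏ j, colProb (F j)) * ((2 ^ B) ^ (n + 1)) ^ k := fun F => by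
    have e : {u : Fin k → Fin (n + 1) → Bits B // code u = F} ≃
        ((j : Fin k) → {v : Fin (n + 1) → Bits B // ∀ i : Fin n, lexLT (v i.succ) (v 0) ↔ F j i = true}) :=
      (Equiv.subtypeEquivRight fun u => by
        simp only [funext_iff, code]
        exact forall_congr' fun j => forall_congr' fun i => by
          rw [← Bool.coe_iff_coe, decide_eq_true_eq]).trans Equiv.subtypePiEquivPi
    rw [← Fintype.card_subtype, Fintype.card_congr e, Fintype.card_pi, Nat.cast_prod]
    calc _ ≤ ∏ j, colProb (F j) * (1 + (n + 1) / 2 ^ B : ℝ) ^ (n + 1) * (2 ^ B) ^ (n + 1) :=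
          Finset.prod_le_prod (fun _ _ => by positivity) fun j _ => card_code_column_le (F j)
      _ = ((1 + (n + 1) / 2 ^ B : ℝ) ^ (n + 1)) ^ k * (∏ j, colProb (F j)) * ((2 ^ B) ^ (n + 1)) ^ k := by
          rw [Finset.prod_mul_distrib, Finset.prod_mul_distrib]
          simp only [Finset.prod_const, Finset.card_univ, Fintype.card_fin]
          ring
      _ ≤ _ := by
          -- The errors of all `k` columns together stay below `exp ((n + 1) ^ 2 * k / 2 ^ B) ≤ e <
          -- 3`, by the assumption on `B`.
          have h1 : ((1 + (n + 1) / 2 ^ B : ℝ) ^ (n + 1)) ^ k ≤ 3 := by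
            calc ((1 + (n + 1) / 2 ^ B : ℝ) ^ (n + 1)) ^ k
                ≤ ((Real.exp ((n + 1) / 2 ^ B)) ^ (n + 1)) ^ k := by
                  gcongr
                  rw [add_comm]
                  exact Real.add_one_le_exp _
              _ = Real.exp (((n + 1) ^ 2 * k : ℕ) / 2 ^ B) := by
                  rw [← Real.exp_nat_mul, ← Real.exp_nat_mul]
                  congr 1
                  push_cast
                  ring
              _ ≤ Real.exp 1 := by
                  refine Real.exp_le_exp.2 ((div_le_one hpos).2 ?_)
                  exact_mod_cast hB
              _ ≤ 3 := by
                  have := Real.exp_one_lt_d9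
                  linarith
          have h2 : (0 : ℝ) ≤ ∏ j, colProb (F j) := Finset.prod_nonneg fun j _ => colProb_nonneg _
          gcongr
  have hcard : (Fintype.card (Fin k → Fin (n + 1) → Bits B) : ℝ) = ((2 ^ B) ^ (n + 1)) ^ k := by
    simp [Fintype.card_pi, Finset.prod_const]
  rw [prob, hcard, div_le_iff₀ (by positivity)]
  have hsum := Finset.card_eq_sum_card_fiberwise (f := fun u : Fin k → Fin (n + 1) → Bits B => code u)
    (s := Finset.univ.filter fun u => E (code u)) (t := Finset.univ) (fun _ _ => Finset.mem_univ _)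
  have hsum' : ((Finset.univ.filter fun u : Fin k → Fin (n + 1) → Bits B => E (code u)).card : ℝ) =
      ∑ F, (((Finset.univ.filter fun u => E (code u)).filter
        fun u : Fin k → Fin (n + 1) → Bits B => code u = F).card : ℝ) := by
    rw [hsum]
    push_cast
    rfl
  rw [hsum', mul_assoc, Finset.sum_mul, Finset.mul_sum]
  refine Finset.sum_le_sum fun F _ => ?_
  by_cases hF : E F
  · simp only [hF, if_true, mul_one]
    rw [← mul_assoc]
    refine le_trans ?_ (hfib F)
    refine Nat.cast_le.2 (Finset.card_le_card fun u hu => ?_)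
    simp only [Finset.mem_filter, Finset.mem_univ, true_and] at hu ⊢
    exact hu.2
  · simp only [hF, if_false, mul_zero, zero_mul]
    refine le_of_eq ?_
    rw [Nat.cast_eq_zero, Finset.card_eq_zero, Finset.filter_eq_empty_iff]
    intro u hu huF
    simp only [Finset.mem_filter, Finset.mem_univ, true_and] at hu
    exact hF (huF ▸ hu)

/-! ## Scores in the idealized code -/

theorem sum_apply_card_true {ι : Type} [Fintype ι] [DecidableEq ι] (f : ℕ → ℝ) :
    ∑ x : ι → Bool, f (Finset.univ.filter fun i => x i = true).card =
      ∑ w ∈ Finset.range (Fintype.card ι + 1), (Fintype.card ι).choose w * f w := by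
  have h := Finset.sum_powerset_apply_card f (x := (Finset.univ : Finset ι))
  rw [Finset.powerset_univ, Finset.card_univ] at h
  simp_rw [nsmul_eq_mul] at h
  rw [← h]
  refine Fintype.sum_equiv ⟨fun x => Finset.univ.filter fun i => x i = true,
    fun s i => decide (i ∈ s), fun x => ?_, fun s => ?_⟩ _ _ fun x => rfl
  · ext i
    simp
  · ext i
    simp

/-- The weight of an ideal column is uniform: each of the `n + 1` possible weights contributes `1 /
(n + 1)`. -/
theorem sum_colProb (n : ℕ) : ∑ c : Bits n, colProb c = 1 := by
  have h := sum_apply_card_true (ι := Fin n)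
    fun w => (w.factorial * (n - w).factorial : ℝ) / (n + 1).factorial
  simp_rw [← weight_eq_card] at h
  simp only [colProb]
  rw [h, Fintype.card_fin, Finset.sum_congr rfl (g := fun _ => 1 / ((n : ℝ) + 1))]
  · simp
    field_simp
  · intro w hw
    have hw' : w ≤ n := by
      have := Finset.mem_range.1 hw
      omega
    have h1 : (n.choose w * w.factorial * (n - w).factorial : ℝ) = n.factorial := by
      exact_mod_cast Nat.choose_mul_factorial_mul_factorial hw'
    have h2 : (0 : ℝ) < n.factorial := by exact_mod_cast Nat.factorial_pos n
    rw [Nat.factorial_succ]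
    push_cast
    rw [← mul_div_assoc, ← mul_assoc, h1]
    field_simp

/-- The score of user `i` in a column in which the pirate answers one. -/
noncomputable def colScore {n : ℕ} (c : Bits n) (i : Fin n) : ℝ :=
  if c i = true then 1 / (weight c : ℝ) else -(1 / ((n - weight c : ℕ) : ℝ))

-- The users with a one share a gain of `1` and those with a zero a loss of `1`. These cancel unless
-- one of the two groups is empty.
open Classical in
theorem sum_colScore {n : ℕ} (hn : 0 < n) (c : Bits n) :
    ∑ i, colScore c i =
      (if weight c = n then 1 else 0) - (if weight c = 0 then 1 else 0) := by
  have hw := weight_le c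
  have hcard := Finset.card_filter_add_card_filter_not (s := Finset.univ) (fun i : Fin n => c i = true)
  rw [← weight_eq_card, Finset.card_univ, Fintype.card_fin] at hcard
  simp only [colScore]
  rw [Finset.sum_ite, Finset.sum_const, Finset.sum_const, ← weight_eq_card,
    Nat.eq_sub_of_add_eq' hcard, nsmul_eq_mul, nsmul_eq_mul, mul_neg, ← sub_eq_add_neg]
  -- Division by zero gives zero, so an empty group contributes nothing.
  have h1 : ∀ m : ℕ, (m : ℝ) * (1 / m) = 1 - if m = 0 then 1 else 0 := fun m => by
    split_ifs with h
    · simp [h]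
    · have : (m : ℝ) ≠ 0 := by exact_mod_cast h
      field_simp
      simp
  rw [h1, h1]
  by_cases h2 : weight c = n
  · simp [h2, hn.ne']
  · by_cases h3 : weight c = 0
    · rw [if_neg (show n - weight c ≠ 0 by omega), if_neg h2]
      simp [h3]
    · rw [if_neg (show n - weight c ≠ 0 by omega), if_neg h2]
      simp [h3]

/-- The total score of user `i` if the pirate answers `a`. -/
noncomputable def totalScore {k n : ℕ} (F : Fin k → Bits n) (a : Bits k) (i : Fin n) : ℝ :=
  ∑ j, if a j = true then colScore (F j) i else 0

theorem Nat.div_sub_one_le (m w : ℕ) : (m : ℝ) / w - 1 ≤ (m / w : ℕ) := by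
  rcases Nat.eq_zero_or_pos w with h | h
  · simp [h]
  · have h1 : (m : ℝ) < w * ((m / w : ℕ) + 1) := by exact_mod_cast Nat.lt_mul_div_succ m h
    have h2 : (m : ℝ) / w < (m / w : ℕ) + 1 := by
      rw [div_lt_iff₀ (by exact_mod_cast h)]
      linarith
    linarith

/-- The integral score is an affine function of the total score, up to rounding. -/
theorem exists_score_approx {k n : ℕ} (F : Fin k → Bits n) (a : Bits k) :
    ∃ s : ℝ, ∀ i, (score F a i : ℝ) ≤ 16 * n * (n + 1) * totalScore F a i + s ∧
      16 * n * (n + 1) * totalScore F a i + s - 2 * k ≤ score F a i := by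
  set M : ℕ := 16 * n * (n + 1) with hM
  have hM' : (16 * n * (n + 1) : ℝ) = M := by
    rw [hM]
    push_cast
    ring
  -- In a column answered by one, all users receive the same extra `M / (n - w)`. This changes no
  -- comparison and brings users with a zero to score `0`, so natural numbers suffice.
  let t : Fin k → ℝ := fun j => if a j = true then (M : ℝ) / ((n - weight (F j) : ℕ) : ℝ) else 0
  -- A user with a one is credited with two rounded quotients, each losing at most `1`; hence the
  -- error `2` per column.
  have key : ∀ i j, ((if a j = true ∧ F j i = true then M / weight (F j) + M / (n - weight (F j))
      else 0 : ℕ) : ℝ) ≤ M * (if a j = true then colScore (F j) i else 0) + t j ∧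
      M * (if a j = true then colScore (F j) i else 0) + t j - 2 ≤
        ((if a j = true ∧ F j i = true then M / weight (F j) + M / (n - weight (F j)) else 0 : ℕ) : ℝ) := by
    intro i j
    by_cases h1 : a j = true
    · by_cases h2 : F j i = true
      · simp only [t, h1, h2, colScore, and_self, if_true, Nat.cast_add]
        have e1 := Nat.div_sub_one_le M (weight (F j))
        have e2 := Nat.div_sub_one_le M (n - weight (F j))
        have e3 : ((M / weight (F j) : ℕ) : ℝ) ≤ M / weight (F j) := Nat.cast_div_le
        have e4 : ((M / (n - weight (F j)) : ℕ) : ℝ) ≤ M / (n - weight (F j) : ℕ) := Nat.cast_div_le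
        rw [mul_one_div]
        constructor <;> linarith
      · simp only [t, h1, h2, colScore, if_true]
        constructor <;> simp [div_eq_mul_inv]
    · simp [t, h1]
  refine ⟨∑ j, t j, fun i => ?_⟩
  rw [hM', totalScore, Finset.mul_sum, ← Finset.sum_add_distrib, score, Nat.cast_sum]
  refine ⟨Finset.sum_le_sum fun j _ => (key i j).1, ?_⟩
  have := Finset.sum_le_sum fun j (_ : j ∈ Finset.univ) => (key i j).2
  rw [Finset.sum_sub_distrib, Finset.sum_const, Finset.card_univ, Fintype.card_fin, nsmul_eq_mul,
    mul_comm (k : ℝ)] at this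
  exact this

/-- The users counted by `accuse` are exactly those before the first maximiser `m`, so their number
is the index of `m`. -/
theorem score_le_of_accuse {k n : ℕ} {F : Fin k → Bits n} {a : Bits k} {i : Fin n}
    (h : accuse F a = i) (i' : Fin n) : score F a i' ≤ score F a i := by
  classical
  have hne : (Finset.univ.filter fun i : Fin n => ∀ i', score F a i' ≤ score F a i).Nonempty := by
    obtain ⟨m, -, hm⟩ := Finset.exists_max_image Finset.univ (score F a) ⟨i, Finset.mem_univ _⟩
    exact ⟨m, by simpa using hm⟩
  set m := Finset.min' _ hne with hm
  have h1 : ∀ i', score F a i' ≤ score F a m := by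
    have := Finset.min'_mem _ hne
    rw [← hm] at this
    simpa using this
  have h2 : ∀ i < m, ∃ i', score F a i < score F a i' := fun i hi => by
    by_contra! hc
    exact absurd (Finset.min'_le _ i (by simpa using hc)) (not_le.2 (hm ▸ hi))
  have h3 : accuse F a = m := by
    rw [accuse, Finset.sum_boole, Nat.cast_id]
    rw [show (Finset.univ.filter fun i : Fin n => ∀ i' : Fin n, (i' : ℕ) ≤ i →
      ∃ i'' : Fin n, score F a i' < score F a i'') = Finset.Iio m from ?_, Fin.card_Iio]
    ext i
    simp only [Finset.mem_filter, Finset.mem_univ, true_and, Finset.mem_Iio]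
    constructor
    · intro hi
      by_contra hc
      obtain ⟨i'', hi''⟩ := hi m (by simpa using hc)
      exact absurd (h1 i'') (by omega)
    · intro hi i' hi'
      exact h2 i' (lt_of_le_of_lt (by simpa using hi') hi)
  have h4 : i = m := Fin.ext (by rw [← h, h3])
  rw [h4]
  exact h1 i'

/-- The pirate's answers agree with all users other than `i` where these agree. -/
def Feasible {k n : ℕ} (i : Fin n) (F : Fin k → Bits n) (a : Bits k) : Prop :=
  ∀ j b, (∀ i', i' ≠ i → F j i' = b) → a j = b

/-- If an innocent user is accused, then his score is high or few columns are full of ones. -/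
theorem le_totalScore_of_accuse {k n : ℕ} {F : Fin k → Bits n} {a : Bits k} {i : Fin n}
    (hfeas : Feasible i F a) (h : accuse F a = i)
    (hcnt : (k : ℝ) / (4 * (n + 1)) ≤ ∑ j, if weight (F j) = n then 1 else 0) :
    (k : ℝ) / (8 * n * (n + 1)) ≤ totalScore F a i := by
  have hn : 0 < n := i.pos
  have hn' : (0 : ℝ) < n := by exact_mod_cast hn
  obtain ⟨s, hs⟩ := exists_score_approx F a
  -- The rounding error `2 k` divided by the scale `16 n (n + 1)` is `k / (8 n (n + 1))`.
  have hle : ∀ i', totalScore F a i' ≤ totalScore F a i + k / (8 * n * (n + 1)) := fun i' => by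
    have h1 := (hs i').2
    have h2 := (hs i).1
    have h3 : (score F a i' : ℝ) ≤ score F a i := by exact_mod_cast score_le_of_accuse h i'
    have h4 : 16 * n * (n + 1) * (totalScore F a i' - totalScore F a i) ≤ 2 * (k : ℝ) := by linarith
    have h5 : totalScore F a i' - totalScore F a i ≤ k / (8 * n * (n + 1)) := by
      rw [le_div_iff₀ (by positivity)]
      linarith
    linarith
  -- Column by column: all-ones columns must be answered by one and give `1` in total, all-zero
  -- columns must be answered by zero, and in all other columns gains and losses cancel.
  have hsum : (∑ j, if weight (F j) = n then (1 : ℝ) else 0) ≤ ∑ i', totalScore F a i' := by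
    simp only [totalScore]
    rw [Finset.sum_comm]
    refine Finset.sum_le_sum fun j _ => ?_
    have hcol := sum_colScore hn (F j)
    by_cases hw : weight (F j) = n
    · have : a j = true := hfeas j true fun i' _ => by
        by_contra hc
        have : weight (F j) < n := by
          rw [weight_eq_card]
          refine (Finset.card_lt_univ_of_notMem (x := i') (by simpa using hc)).trans_le (by simp)
        omega
      simp only [this, if_true, hcol, hw, hn.ne']
      simp
    · by_cases hw0 : weight (F j) = 0
      · have : a j = false := hfeas j false fun i' _ => by
          rw [weight_eq_card, Finset.card_eq_zero, Finset.filter_eq_empty_iff] at hw0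
          simpa using hw0 (Finset.mem_univ i')
        simp [this, hw]
      · simp only [hw, if_false, hw0, sub_zero] at hcol ⊢
        by_cases ha : a j = true
        · simp [ha, hcol]
        · simp [ha]
  have hsum2 : ∑ i', totalScore F a i' ≤ n * (totalScore F a i + k / (8 * n * (n + 1))) := by
    refine (Finset.sum_le_sum fun i' _ => hle i').trans (le_of_eq ?_)
    rw [Finset.sum_const, Finset.card_univ, Fintype.card_fin, nsmul_eq_mul]
  have h6 : (k : ℝ) / (4 * (n + 1)) ≤ n * (totalScore F a i + k / (8 * n * (n + 1))) :=
    hcnt.trans (hsum.trans hsum2)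
  -- The average score is at least twice the rounding error, so one half of it survives as a lower
  -- bound.
  have h7 : (k : ℝ) / (4 * (n + 1)) = n * (2 * (k / (8 * n * (n + 1)))) := by
    field_simp
    ring
  rw [h7] at h6
  have := le_of_mul_le_mul_left h6 hn'
  linarith

/-! ## Concentration in the idealized code -/

/-- The column with bit `b` for user `i` and bits `r` for the others. -/
def glue {n : ℕ} (i : Fin n) (b : Bool) (r : {i' // i' ≠ i} → Bool) : Bits n :=
  (Equiv.funSplitAt i Bool).symm (b, r)

def restWeight {n : ℕ} {i : Fin n} (r : {i' // i' ≠ i} → Bool) : ℕ :=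
  (Finset.univ.filter fun i' => r i' = true).card

theorem glue_self {n : ℕ} (i : Fin n) (b : Bool) (r : {i' // i' ≠ i} → Bool) :
    glue i b r i = b := by
  simp [glue]

theorem glue_of_ne {n : ℕ} {i : Fin n} (b : Bool) (r : {i' // i' ≠ i} → Bool) {i' : Fin n}
    (h : i' ≠ i) : glue i b r i' = r ⟨i', h⟩ := by
  simp [glue, h]

theorem weight_glue {n : ℕ} (i : Fin n) (b : Bool) (r : {i' // i' ≠ i} → Bool) :
    weight (glue i b r) = (if b = true then 1 else 0) + restWeight r := by
  rw [weight, Fintype.sum_eq_add_sum_subtype_ne _ i, glue_self]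
  congr 1
  rw [restWeight, Finset.card_filter]
  refine Finset.sum_congr rfl fun i' _ => ?_
  rw [glue_of_ne b r i'.2]

theorem restWeight_lt {n : ℕ} {i : Fin n} (r : {i' // i' ≠ i} → Bool) : restWeight r < n := by
  have := weight_le (glue i true r)
  rw [weight_glue] at this
  simp at this
  omega

/-- The probability of the bits of the others, up to normalization. -/
noncomputable def restProb {n : ℕ} {i : Fin n} (r : {i' // i' ≠ i} → Bool) : ℝ :=
  ((restWeight r).factorial * (n - 1 - restWeight r).factorial : ℝ) / (n + 1).factorial

/-- Together with `colProb_glue_false` this is Laplace's rule of succession: if the others have `w`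
ones, then a one and a zero of user `i` are in the ratio `w + 1 : n - w`. -/
theorem colProb_glue_true {n : ℕ} (i : Fin n) (r : {i' // i' ≠ i} → Bool) :
    colProb (glue i true r) = (restWeight r + 1) * restProb r := by
  rw [colProb, restProb, weight_glue, if_pos rfl, add_comm 1, Nat.factorial_succ,
    show n - (restWeight r + 1) = n - 1 - restWeight r by omega]
  push_cast
  ring

theorem colProb_glue_false {n : ℕ} (i : Fin n) (r : {i' // i' ≠ i} → Bool) :
    colProb (glue i false r) = (n - restWeight r : ℕ) * restProb r := by
  have := restWeight_lt r
  rw [colProb, restProb, weight_glue, if_neg (by simp), zero_add,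
    show n - restWeight r = n - 1 - restWeight r + 1 by omega, Nat.factorial_succ]
  push_cast
  ring

theorem restProb_nonneg {n : ℕ} {i : Fin n} (r : {i' // i' ≠ i} → Bool) : 0 ≤ restProb r := by
  unfold restProb
  positivity

theorem exp_le_of_abs_le_one {y : ℝ} (h : |y| ≤ 1) : Real.exp y ≤ 1 + y + y ^ 2 := by
  have := (abs_le.1 (Real.abs_exp_sub_one_sub_id_le h)).2
  linarith

/-- A bound for the moment generating function of the score of one column, given the bits of the
others. -/
theorem colProb_mul_exp_le {n : ℕ} (i : Fin n) (r : {i' // i' ≠ i} → Bool) (a : Bool) {t : ℝ}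
    (ht0 : 0 ≤ t) (ht1 : t ≤ 1) :
    ∑ b, colProb (glue i b r) * Real.exp (t * if a = true then colScore (glue i b r) i else 0) ≤
      restProb r * (n + 1) +
        t ^ 2 * (restProb r * (1 / (restWeight r + 1 : ℕ) + 1 / (n - restWeight r : ℕ))) := by
  have hlt := restWeight_lt r
  have hP := restProb_nonneg r
  set w := restWeight r with hw
  have hsub : ((n - w : ℕ) : ℝ) = n - w := by
    rw [Nat.cast_sub hlt.le]
  have h1 : (1 : ℝ) ≤ (w + 1 : ℕ) := by exact_mod_cast Nat.le_add_left 1 w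
  have h2 : (1 : ℝ) ≤ (n - w : ℕ) := by exact_mod_cast (show 1 ≤ n - w by omega)
  rw [Fintype.sum_bool, colProb_glue_true, colProb_glue_false, ← hw]
  cases a with
  | false =>
    simp only [Bool.false_eq_true, if_false, mul_zero, Real.exp_zero, mul_one, hsub]
    have : 0 ≤ t ^ 2 * (restProb r * (1 / (w + 1 : ℕ) + 1 / ((n : ℝ) - w))) := by
      rw [← hsub]
      positivity
    linarith
  | true =>
    have e1 : colScore (glue i true r) i = 1 / (w + 1 : ℕ) := by
      rw [colScore, glue_self, if_pos rfl, weight_glue, if_pos rfl, add_comm 1]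
    have e2 : colScore (glue i false r) i = -(1 / (n - w : ℕ)) := by
      rw [colScore, glue_self, if_neg (by simp), weight_glue, if_neg (by simp), zero_add]
    simp only [if_true, e1, e2]
    set p : ℝ := ((w + 1 : ℕ) : ℝ) with hp
    set q : ℝ := ((n - w : ℕ) : ℝ) with hq
    have hp' : (w : ℝ) + 1 = p := by
      rw [hp]
      push_cast
      rfl
    have hpos1 : 0 < p := by linarith
    have hpos2 : 0 < q := by linarith
    have b1 : |t * (1 / p)| ≤ 1 := by
      rw [abs_of_nonneg (by positivity), mul_one_div, div_le_one hpos1]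
      linarith
    have b2 : |t * -(1 / q)| ≤ 1 := by
      rw [mul_neg, abs_neg, abs_of_nonneg (by positivity), mul_one_div, div_le_one hpos2]
      linarith
    have c1 := exp_le_of_abs_le_one b1
    have c2 := exp_le_of_abs_le_one b2
    rw [hp']
    calc _ ≤ p * restProb r * (1 + t * (1 / p) + (t * (1 / p)) ^ 2) +
          q * restProb r * (1 + t * -(1 / q) + (t * -(1 / q)) ^ 2) := by gcongr
      -- The terms linear in `t` cancel because `p * (1 / p) = q * (1 / q)`: the score of a user
      -- unknown to the pirate has mean zero.
      _ = restProb r * (p + q) + t ^ 2 * (restProb r * (1 / p + 1 / q)) := by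
          field_simp
          ring
      _ = _ := by
          rw [show p + q = n + 1 by rw [hsub, ← hp']; ring]

/-- Harmonic numbers. -/
noncomputable def harm (n : ℕ) : ℝ := ∑ w ∈ Finset.range n, 1 / ((w + 1 : ℕ) : ℝ)

/-- The weight of the others is uniform too: the `(n - 1).choose w` vectors of weight `w` have total
mass `1 / (n (n + 1))`. -/
theorem sum_restProb_mul {n : ℕ} (i : Fin n) (f : ℕ → ℝ) :
    ∑ r : {i' // i' ≠ i} → Bool, restProb r * f (restWeight r) =
      (∑ w ∈ Finset.range n, f w) / (n * (n + 1)) := by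
  have hn : 0 < n := i.pos
  have hcard : Fintype.card {i' // i' ≠ i} = n - 1 := by simp
  have h := sum_apply_card_true (ι := {i' // i' ≠ i})
    fun w => ((w.factorial * (n - 1 - w).factorial : ℝ) / (n + 1).factorial) * f w
  simp only [restProb, restWeight]
  rw [h, hcard, show n - 1 + 1 = n by omega, Finset.sum_div]
  refine Finset.sum_congr rfl fun w hw => ?_
  have hw' : w ≤ n - 1 := by
    have := Finset.mem_range.1 hw
    omega
  have h1 : ((n - 1).choose w * w.factorial * (n - 1 - w).factorial : ℝ) = (n - 1).factorial := by
    exact_mod_cast Nat.choose_mul_factorial_mul_factorial hw'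
  have h2 : (0 : ℝ) < (n - 1).factorial := by exact_mod_cast Nat.factorial_pos _
  have h3 : ((n + 1).factorial : ℝ) = (n + 1) * n * (n - 1).factorial := by
    obtain ⟨m, rfl⟩ : ∃ m, n = m + 1 := ⟨n - 1, by omega⟩
    rw [Nat.factorial_succ, Nat.factorial_succ]
    push_cast
    ring
  have hn' : (0 : ℝ) < n := by exact_mod_cast hn
  rw [← mul_assoc, ← mul_div_assoc, ← mul_assoc, h1, h3]
  field_simp

/-- As `w` runs through its uniform distribution, `1 / (w + 1)` and `1 / (n - w)` each sum to a
harmonic number. This is the source of the factor `harm n` in the variance. -/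
theorem sum_mgf_bound {n : ℕ} (i : Fin n) (t : ℝ) :
    ∑ r : {i' // i' ≠ i} → Bool, (restProb r * (n + 1) +
        t ^ 2 * (restProb r * (1 / (restWeight r + 1 : ℕ) + 1 / (n - restWeight r : ℕ)))) =
      1 + 2 * t ^ 2 * harm n / (n * (n + 1)) := by
  have hn : (0 : ℝ) < n := by exact_mod_cast i.pos
  rw [Finset.sum_add_distrib, ← Finset.mul_sum, sum_restProb_mul i fun _ => (n : ℝ) + 1,
    sum_restProb_mul i fun w => 1 / (w + 1 : ℕ) + 1 / (n - w : ℕ),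
    Finset.sum_add_distrib (f := fun w => 1 / ((w + 1 : ℕ) : ℝ))]
  have h : ∑ w ∈ Finset.range n, 1 / ((n - w : ℕ) : ℝ) = harm n := by
    rw [harm, ← Finset.sum_range_reflect]
    refine Finset.sum_congr rfl fun w hw => ?_
    have := Finset.mem_range.1 hw
    rw [show n - (n - 1 - w) = w + 1 by omega]
  rw [h, ← harm]
  simp
  field_simp
  ring

/-- The moment generating function of the score of an innocent user. -/
theorem sum_colProb_mul_exp_le {k n : ℕ} (i : Fin n) (a : (Fin k → Bits n) → Bits k)
    (ha : ∀ F F', (∀ j i', i' ≠ i → F j i' = F' j i') → a F = a F') {t : ℝ}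
    (ht0 : 0 ≤ t) (ht1 : t ≤ 1) :
    ∑ F : Fin k → Bits n, (∏ j, colProb (F j)) * Real.exp (t * totalScore F (a F) i) ≤
      (1 + 2 * t ^ 2 * harm n / (n * (n + 1))) ^ k := by
  -- The row of user `i` is separated from the bits of all others.
  let e : (Fin k → {i' // i' ≠ i} → Bool) × (Fin k → Bool) ≃ (Fin k → Bits n) :=
    (Equiv.prodComm _ _).trans ((Equiv.arrowProdEquivProdArrow (Fin k) (fun _ => Bool)
      (fun _ => {i' // i' ≠ i} → Bool)).symm.trans
      (Equiv.piCongrRight fun _ => (Equiv.funSplitAt i Bool).symm))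
  have he : ∀ q j, e q j = glue i (q.2 j) (q.1 j) := fun q j => rfl
  rw [← Equiv.sum_comp e, Fintype.sum_prod_type, ← sum_mgf_bound i t]
  have hpow : (∑ r : {i' // i' ≠ i} → Bool, (restProb r * (n + 1) +
        t ^ 2 * (restProb r * (1 / (restWeight r + 1 : ℕ) + 1 / (n - restWeight r : ℕ))))) ^ k =
      ∑ r : Fin k → {i' // i' ≠ i} → Bool, ∏ j, (restProb (r j) * (n + 1) +
        t ^ 2 * (restProb (r j) * (1 / (restWeight (r j) + 1 : ℕ) +
          1 / (n - restWeight (r j) : ℕ)))) := by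
    rw [Finset.sum_pow']
    simp
  rw [hpow]
  refine Finset.sum_le_sum fun r _ => ?_
  -- For fixed bits of the others the answers are constant, so the sum over row `i` factors into
  -- columns.
  let α := a (e (r, fun _ => false))
  have hα : ∀ β, a (e (r, β)) = α := fun β => ha _ _ fun j i' hi' => by
    rw [he, he, glue_of_ne _ _ hi', glue_of_ne _ _ hi']
  calc ∑ β : Fin k → Bool, (∏ j, colProb (e (r, β) j)) *
        Real.exp (t * totalScore (e (r, β)) (a (e (r, β))) i)
      = ∑ β : Fin k → Bool, ∏ j, colProb (glue i (β j) (r j)) *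
          Real.exp (t * if α j = true then colScore (glue i (β j) (r j)) i else 0) := by
        refine Finset.sum_congr rfl fun β _ => ?_
        rw [hα, totalScore, Finset.mul_sum, Real.exp_sum, ← Finset.prod_mul_distrib]
        rfl
    _ = ∏ j, ∑ b, colProb (glue i b (r j)) *
          Real.exp (t * if α j = true then colScore (glue i b (r j)) i else 0) := by
        rw [Finset.prod_univ_sum, Fintype.piFinset_univ]
    _ ≤ _ := Finset.prod_le_prod (fun j _ => Finset.sum_nonneg fun b _ =>
        mul_nonneg (colProb_nonneg _) (Real.exp_nonneg _)) fun j _ =>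
        colProb_mul_exp_le i (r j) (α j) ht0 ht1

/-! ## Innocent users are rarely accused -/

-- Only the all-ones column, of probability `1 / (n + 1)`, is damped, and `1 - exp (-1) ≥ 1 / 2`.
open Classical in
theorem sum_colProb_mul_exp_weight (n : ℕ) :
    ∑ c : Bits n, colProb c * Real.exp (if weight c = n then -1 else 0) ≤
      1 - 1 / (2 * (n + 1)) := by
  have hfull : ∀ c : Bits n, weight c = n ↔ c = fun _ => true := fun c => by
    constructor
    · intro h
      funext i
      by_contra hc
      have : weight c < n := by
        rw [weight_eq_card]
        refine (Finset.card_lt_univ_of_notMem (x := i) (by simpa using hc)).trans_le (by simp)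
      omega
    · rintro rfl
      simp [weight_eq_card]
  have h1 : ∀ c : Bits n, colProb c * Real.exp (if weight c = n then -1 else 0) =
      colProb c - if c = (fun _ => true) then (1 - Real.exp (-1)) / (n + 1) else 0 := fun c => by
    by_cases h : c = fun _ => true
    · have hw := (hfull c).2 h
      have hp : colProb c = 1 / (n + 1) := by
        rw [colProb, hw, Nat.sub_self, Nat.factorial_succ]
        have : (n.factorial : ℝ) ≠ 0 := by exact_mod_cast n.factorial_ne_zero
        push_cast
        field_simp
        simp
      rw [if_pos hw, if_pos h, hp]
      ring
    · rw [if_neg (mt (hfull c).1 h), if_neg h]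
      simp
  have h2 : Real.exp (-1) ≤ 1 / 2 := by
    rw [Real.exp_neg, one_div]
    exact inv_anti₀ two_pos (by linarith [Real.add_one_le_exp (1 : ℝ)])
  rw [Finset.sum_congr rfl fun c _ => h1 c, Finset.sum_sub_distrib, sum_colProb]
  simp only [Finset.sum_ite_eq', Finset.mem_univ, if_true]
  have h3 : 1 / (2 * ((n : ℝ) + 1)) = (1 / 2) / (n + 1) := by field_simp
  rw [h3]
  gcongr
  linarith

theorem one_sub_pow_le_exp {y : ℝ} (h : 0 ≤ 1 + y) (k : ℕ) : (1 + y) ^ k ≤ Real.exp (k * y) := by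
  rw [Real.exp_nat_mul]
  gcongr
  linarith [Real.add_one_le_exp y]

theorem one_le_harm {n : ℕ} (hn : 0 < n) : 1 ≤ harm n := by
  have := Finset.single_le_sum (f := fun w : ℕ => 1 / ((w + 1 : ℕ) : ℝ)) (s := Finset.range n)
    (fun w _ => by positivity) (Finset.mem_range.2 hn)
  simpa [harm] using this

theorem prod_colProb_nonneg {k n : ℕ} (F : Fin k → Bits n) : 0 ≤ ∏ j, colProb (F j) :=
  Finset.prod_nonneg fun _ _ => colProb_nonneg _

open Classical in
/-- With overwhelming probability many columns are full of ones. -/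
theorem sum_few_full_le (k n : ℕ) :
    ∑ F : Fin k → Bits n, (∏ j, colProb (F j)) *
      (if (∑ j, if weight (F j) = n then (1 : ℝ) else 0) < k / (4 * (n + 1)) then 1 else 0) ≤
      Real.exp (-(k / (4 * (n + 1)))) := by
  -- A Chernoff bound for the lower tail with parameter `-1`. The final exponent is `k / (4 (n + 1))
  -- - k / (2 (n + 1))`.
  calc _ ≤ ∑ F : Fin k → Bits n, Real.exp (k / (4 * (n + 1))) * ∏ j, (colProb (F j) *
        Real.exp (if weight (F j) = n then -1 else 0)) := by
        refine Finset.sum_le_sum fun F _ => ?_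
        rw [Finset.prod_mul_distrib, ← Real.exp_sum, mul_left_comm, ← Real.exp_add]
        refine mul_le_mul_of_nonneg_left ?_ (prod_colProb_nonneg F)
        split_ifs with h
        · refine Real.one_le_exp ?_
          have : ∑ j, (if weight (F j) = n then (-1 : ℝ) else 0) =
              -∑ j, if weight (F j) = n then (1 : ℝ) else 0 := by
            rw [← Finset.sum_neg_distrib]
            refine Finset.sum_congr rfl fun j _ => ?_
            split_ifs <;> simp
          rw [this]
          linarith
        · exact Real.exp_nonneg _
    _ = Real.exp (k / (4 * (n + 1))) *
        (∑ c : Bits n, colProb c * Real.exp (if weight c = n then -1 else 0)) ^ k := by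
        rw [← Finset.mul_sum, Finset.sum_pow']
        simp
    _ ≤ Real.exp (k / (4 * (n + 1))) * (1 + -(1 / (2 * (n + 1)))) ^ k := by
        refine mul_le_mul_of_nonneg_left (pow_le_pow_left₀ (Finset.sum_nonneg fun c _ =>
          mul_nonneg (colProb_nonneg c) (Real.exp_nonneg _)) ?_ k) (Real.exp_nonneg _)
        rw [← sub_eq_add_neg]
        exact sum_colProb_mul_exp_weight n
    _ ≤ Real.exp (k / (4 * (n + 1))) * Real.exp (k * -(1 / (2 * (n + 1)))) := by
        refine mul_le_mul_of_nonneg_left (one_sub_pow_le_exp ?_ k) (Real.exp_nonneg _)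
        rw [← sub_eq_add_neg, sub_nonneg, div_le_one (by positivity)]
        have : (0 : ℝ) ≤ n := Nat.cast_nonneg n
        linarith
    _ = _ := by
        rw [← Real.exp_add]
        congr 1
        field_simp
        ring

open Classical in
/-- With overwhelming probability an innocent user has a low score. -/
theorem sum_high_score_le {k n : ℕ} (i : Fin n) (a : (Fin k → Bits n) → Bits k)
    (ha : ∀ F F', (∀ j i', i' ≠ i → F j i' = F' j i') → a F = a F') :
    ∑ F : Fin k → Bits n, (∏ j, colProb (F j)) *
      (if (k : ℝ) / (8 * n * (n + 1)) ≤ totalScore F (a F) i then 1 else 0) ≤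
      Real.exp (-(k / (512 * harm n * (n * (n + 1))))) := by
  have hn : (0 : ℝ) < n := by exact_mod_cast i.pos
  have hH := one_le_harm i.pos
  have hH0 : 0 < harm n := by linarith
  -- This `t` minimises `2 t ^ 2 * harm n - t / 8`, which is the exponent below up to the factor `k
  -- / (n (n + 1))`; the minimum is `-1 / (512 * harm n)`.
  set t : ℝ := 1 / (32 * harm n) with ht
  have ht0 : 0 ≤ t := by positivity
  have ht1 : t ≤ 1 := by
    rw [ht, div_le_one (by positivity)]
    linarith
  set y : ℝ := k / (8 * n * (n + 1))
  calc _ ≤ ∑ F : Fin k → Bits n, Real.exp (-(t * y)) * ((∏ j, colProb (F j)) *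
        Real.exp (t * totalScore F (a F) i)) := by
        refine Finset.sum_le_sum fun F _ => ?_
        rw [mul_left_comm, ← Real.exp_add]
        refine mul_le_mul_of_nonneg_left ?_ (prod_colProb_nonneg F)
        split_ifs with h
        · refine Real.one_le_exp ?_
          have := mul_le_mul_of_nonneg_left h ht0
          linarith
        · exact Real.exp_nonneg _
    _ ≤ Real.exp (-(t * y)) * Real.exp (k * (2 * t ^ 2 * harm n / (n * (n + 1)))) := by
        rw [← Finset.mul_sum]
        refine mul_le_mul_of_nonneg_left ((sum_colProb_mul_exp_le i a ha ht0 ht1).trans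
          (one_sub_pow_le_exp (by positivity) k)) (Real.exp_nonneg _)
    _ = _ := by
        rw [← Real.exp_add]
        congr 1
        simp only [y, t]
        field_simp
        ring

/-- The probability of accusing an innocent user. -/
noncomputable def codeError (k n : ℕ) : ℝ :=
  3 * (Real.exp (-(k / (4 * (n + 1)))) + Real.exp (-(k / (512 * harm n * (n * (n + 1))))))

/-- A false accusation needs few all-ones columns or a high score of `i`, by
`le_totalScore_of_accuse`. The two tail bounds add up, and the factor `3` is the passage from the
actual to the ideal code. -/
theorem prob_accuse_le {k n B : ℕ} (hB : (n + 1) ^ 2 * k ≤ 2 ^ B) (i : Fin n)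
    (a : (Fin k → Bits n) → Bits k)
    (ha : ∀ F F', (∀ j i', i' ≠ i → F j i' = F' j i') → a F = a F') :
    prob (fun u : Fin k → Fin (n + 1) → Bits B => Feasible i (code u) (a (code u)) ∧
      accuse (code u) (a (code u)) = i) ≤ codeError k n := by
  classical
  refine (prob_code_le hB fun F => Feasible i F (a F) ∧ accuse F (a F) = i).trans ?_
  refine mul_le_mul_of_nonneg_left ?_ (by norm_num)
  refine le_trans ?_ (add_le_add (sum_few_full_le k n) (sum_high_score_le i a ha))
  rw [← Finset.sum_add_distrib]
  refine Finset.sum_le_sum fun F _ => ?_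
  rw [← mul_add]
  refine mul_le_mul_of_nonneg_left ?_ (prod_colProb_nonneg F)
  by_cases h1 : Feasible i F (a F) ∧ accuse F (a F) = i
  · rw [if_pos h1]
    by_cases h2 : (∑ j, if weight (F j) = n then (1 : ℝ) else 0) < k / (4 * (n + 1))
    · rw [if_pos h2]
      have : (0 : ℝ) ≤ if (k : ℝ) / (8 * n * (n + 1)) ≤ totalScore F (a F) i then 1 else 0 := by
        split_ifs <;> norm_num
      linarith
    · rw [if_neg h2, if_pos (le_totalScore_of_accuse h1.1 h1.2 (not_lt.1 h2))]
      norm_num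
  · rw [if_neg h1]
    refine add_nonneg ?_ ?_ <;> split_ifs <;> norm_num

/-! ## Circuits from disjunctive normal forms -/

/-- The value of a disjunctive normal form; the literal `(i, b)` says that input `i` is `b`. -/
def dnfEval {m : ℕ} (D : List (List (Fin m × Bool))) (x : Bits m) : Bool :=
  D.any fun t => t.all fun q => x q.1 == q.2

/-- The circuit of a disjunctive normal form: negations, conjunctions, and one disjunction. -/
def dnfCircuit {m : ℕ} (D : List (List (Fin m × Bool))) : Circuit (Fin m) where
  numGates := m + D.length + 1
  gate j :=
    if h : (j : ℕ) < m then .not (.inl ⟨j, h⟩)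
    else if h' : (j : ℕ) - m < D.length then
      .and (D[(j : ℕ) - m].map fun q =>
        if q.2 then .inl q.1 else .inr ⟨q.1, q.1.2.trans_le (not_lt.1 h)⟩)
    else .or (List.ofFn fun t : Fin D.length => .inr ⟨m + t, by omega⟩)
  output := .inr ⟨m + D.length, by omega⟩

section

variable {m : ℕ} (D : List (List (Fin m × Bool))) (x : Bits m)

theorem dnfCircuit_gate_lt (i : Fin m) (h : (i : ℕ) < (dnfCircuit D).numGates) :
    (dnfCircuit D).gate ⟨i, h⟩ = .not (.inl i) := by
  simp [dnfCircuit]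

theorem dnfCircuit_gate_mid (t : Fin D.length) (h : m + (t : ℕ) < (dnfCircuit D).numGates) :
    (dnfCircuit D).gate ⟨m + t, h⟩ = .and (D[t].map fun q =>
        if q.2 then .inl q.1 else .inr ⟨q.1, q.1.2.trans_le (Nat.le_add_right _ _)⟩) := by
  simp [dnfCircuit]

theorem dnfCircuit_gate_last (h : m + D.length < (dnfCircuit D).numGates) :
    (dnfCircuit D).gate ⟨m + D.length, h⟩ =
      .or (List.ofFn fun t : Fin D.length => .inr ⟨m + t, by simp⟩) := by
  simp [dnfCircuit]

theorem dnfCircuit_value_lt (i : Fin m) (h : (i : ℕ) < (dnfCircuit D).numGates) :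
    (dnfCircuit D).value x ⟨i, h⟩ = !(x i) := by
  rw [Circuit.value, dnfCircuit_gate_lt]
  rfl

theorem dnfCircuit_value_mid (t : Fin D.length) (h : m + (t : ℕ) < (dnfCircuit D).numGates) :
    (dnfCircuit D).value x ⟨m + t, h⟩ = D[t].all fun q => x q.1 == q.2 := by
  rw [Circuit.value, dnfCircuit_gate_mid]
  simp only [Gate.eval, List.all_map]
  congr 1
  funext q
  rcases q with ⟨i, b⟩
  cases b
  · simp only [Function.comp, Bool.false_eq_true, if_false, Sum.elim_inr]
    rw [dnfCircuit_value_lt]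
    cases x i <;> rfl
  · simp

theorem dnfCircuit_eval : (dnfCircuit D).eval x = dnfEval D x := by
  have hlt : m + D.length < (dnfCircuit D).numGates := Nat.lt_succ_self _
  have h : (dnfCircuit D).output = .inr ⟨m + D.length, hlt⟩ := rfl
  rw [Circuit.eval, h, Sum.elim_inr, Circuit.value, dnfCircuit_gate_last]
  rw [Bool.eq_iff_iff]
  simp only [Gate.eval, dnfEval, List.any_eq_true, List.mem_ofFn]
  constructor
  · rintro ⟨_, ⟨t, rfl⟩, ht⟩
    rw [Sum.elim_inr, dnfCircuit_value_mid] at ht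
    exact ⟨_, D.getElem_mem t.2, ht⟩
  · rintro ⟨l, hl, ht⟩
    obtain ⟨t, ht', rfl⟩ := List.getElem_of_mem hl
    refine ⟨_, ⟨⟨t, ht'⟩, rfl⟩, ?_⟩
    rw [Sum.elim_inr]
    exact (dnfCircuit_value_mid D x ⟨t, ht'⟩ _).trans ht

theorem one_add_foldr_max_le {l : List ℕ} (d : ℕ) (h : ∀ a ∈ l, a ≤ d) :
    1 + l.foldr max 0 ≤ d + 1 := by
  rw [add_comm]
  refine Nat.add_le_add_right ?_ 1
  induction l with
  | nil => exact Nat.zero_le _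
  | cons a l ih =>
    exact max_le (h a (by simp)) (ih fun b hb => h b (by simp [hb]))

theorem dnfCircuit_depth : (dnfCircuit D).depth ≤ 3 := by
  have h1 : ∀ (i : Fin m) h, (dnfCircuit D).gateDepth ⟨i, h⟩ ≤ 1 := fun i h => by
    rw [Circuit.gateDepth, dnfCircuit_gate_lt]
    simp [Gate.args]
  have h2 : ∀ (t : Fin D.length) h, (dnfCircuit D).gateDepth ⟨m + t, h⟩ ≤ 2 := fun t h => by
    rw [Circuit.gateDepth, dnfCircuit_gate_mid]
    refine one_add_foldr_max_le 1 fun a ha => ?_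
    simp only [Gate.args, List.map_map, List.mem_map] at ha
    obtain ⟨⟨i, b⟩, -, rfl⟩ := ha
    cases b
    · exact h1 i _
    · simp
  have hlt : m + D.length < (dnfCircuit D).numGates := Nat.lt_succ_self _
  have h : (dnfCircuit D).output = .inr ⟨m + D.length, hlt⟩ := rfl
  rw [Circuit.depth, h, Sum.elim_inr, Circuit.gateDepth, dnfCircuit_gate_last]
  refine one_add_foldr_max_le 2 fun a ha => ?_
  simp only [Gate.args, List.mem_map, List.mem_ofFn] at ha
  obtain ⟨_, ⟨t, rfl⟩, rfl⟩ := ha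
  exact h2 t _

/-- A negation counts as one gate and one wire, a term as at most `w + 1`, and the disjunction as
one gate with a wire for every term. -/
theorem dnfCircuit_size {w : ℕ} (hw : ∀ t ∈ D, t.length ≤ w) :
    (dnfCircuit D).size ≤ 2 * m + D.length * (w + 2) + 1 := by
  have h : (dnfCircuit D).size = ∑ j : Fin (m + D.length + 1),
    (1 + ((dnfCircuit D).gate j).args.length) := rfl
  rw [h, Fin.sum_univ_castSucc, Fin.sum_univ_add]
  have e1 : ∀ i : Fin m, 1 + ((dnfCircuit D).gate
      (Fin.castSucc (Fin.castAdd D.length i))).args.length = 2 := fun i => by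
    have := dnfCircuit_gate_lt D i (by simp [dnfCircuit]; omega)
    exact (congrArg (fun g : Gate (Fin m ⊕ Fin i.val) => 1 + g.args.length) this).trans rfl
  have e2 : ∀ t : Fin D.length, 1 + ((dnfCircuit D).gate
      (Fin.castSucc (Fin.natAdd m t))).args.length ≤ w + 1 := fun t => by
    have := dnfCircuit_gate_mid D t (by simp [dnfCircuit])
    refine (congrArg (fun g : Gate (Fin m ⊕ Fin (m + t.val)) => 1 + g.args.length) this).le.trans ?_
    simp only [Gate.args, List.length_map]
    have := hw _ (D.getElem_mem t.2)
    simp only [Fin.getElem_fin]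
    omega
  have e3 : 1 + ((dnfCircuit D).gate (Fin.last (m + D.length))).args.length = D.length + 1 := by
    have := dnfCircuit_gate_last D (by simp [dnfCircuit])
    refine (congrArg (fun g : Gate (Fin m ⊕ Fin (m + D.length)) => 1 + g.args.length) this).trans ?_
    simp [Gate.args, add_comm]
  rw [e3, Finset.sum_congr rfl fun i _ => e1 i]
  have := Finset.sum_le_sum fun t (_ : t ∈ Finset.univ) => e2 t
  simp only [Finset.sum_const, Finset.card_univ, Fintype.card_fin, smul_eq_mul] at this ⊢
  nlinarith

end

/-! ### Functions with small disjunctive normal forms -/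

/-- `f` is a disjunction of at most `T` conjunctions of at most `w` literals. -/
def HasDNF {m : ℕ} (f : Bits m → Bool) (T w : ℕ) : Prop :=
  ∃ D : List (List (Fin m × Bool)), D.length ≤ T ∧ (∀ t ∈ D, t.length ≤ w) ∧ ∀ x, dnfEval D x = f x

namespace HasDNF

variable {m T w : ℕ} {f : Bits m → Bool}

theorem exists_circuit (h : HasDNF f T w) : ∃ C : Circuit (Fin m),
    C.size ≤ 2 * m + T * (w + 2) + 1 ∧ C.depth ≤ 3 ∧ ∀ x, C.eval x = f x := by
  obtain ⟨D, hT, hw, hD⟩ := h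
  refine ⟨dnfCircuit D, (dnfCircuit_size D hw).trans ?_, dnfCircuit_depth D,
    fun x => (dnfCircuit_eval D x).trans (hD x)⟩
  gcongr

theorem const (b : Bool) : HasDNF (fun _ : Bits m => b) 1 w := by
  cases b
  · exact ⟨[], by simp, by simp, fun x => rfl⟩
  · exact ⟨[[]], by simp, by simp, fun x => rfl⟩

theorem mono {T' w' : ℕ} (h : HasDNF f T w) (hT : T ≤ T') (hw : w ≤ w') : HasDNF f T' w' := by
  obtain ⟨D, h1, h2, h3⟩ := h
  exact ⟨D, h1.trans hT, fun t ht => (h2 t ht).trans hw, h3⟩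

theorem congr {g : Bits m → Bool} (h : HasDNF f T w) (hfg : ∀ x, f x = g x) : HasDNF g T w := by
  obtain ⟨D, h1, h2, h3⟩ := h
  exact ⟨D, h1, h2, fun x => (h3 x).trans (hfg x)⟩

/-- One term for each satisfying assignment of `I`; an assignment is represented by its set `S ⊆ I`
of ones and tested with `false` outside `S`. -/
theorem of_depends_on (I : Finset (Fin m)) (hI : ∀ x x' : Bits m, (∀ i ∈ I, x i = x' i) → f x = f x') :
    HasDNF f (2 ^ I.card) I.card := by
  classical
  refine ⟨((I.powerset.filter fun S => f (fun i => decide (i ∈ S)) = true).toList.map fun S =>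
    I.toList.map fun i => (i, decide (i ∈ S))), ?_, ?_, fun x => ?_⟩
  · rw [List.length_map, Finset.length_toList, ← Finset.card_powerset]
    exact Finset.card_filter_le _ _
  · simp only [List.mem_map]
    rintro _ ⟨S, -, rfl⟩
    simp
  · rw [Bool.eq_iff_iff]
    simp only [dnfEval, List.any_map, List.any_eq_true, Finset.mem_toList, Finset.mem_filter,
      Finset.mem_powerset, Function.comp, List.all_map, List.all_eq_true, beq_iff_eq]
    constructor
    · rintro ⟨S, ⟨-, hS⟩, h⟩
      rw [← hS]
      exact hI _ _ h
    · intro h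
      have hx : ∀ i ∈ I, x i = decide (i ∈ I.filter fun i => x i = true) := fun i hi => by
        simp [hi]
      exact ⟨I.filter fun i => x i = true, ⟨Finset.filter_subset _ _, (hI _ _ hx).symm.trans h⟩, hx⟩

theorem and_literals (h : HasDNF f T w) {l : ℕ} (φ : Fin l → Fin m) (y : Bits l) :
    HasDNF (fun x => decide ((fun i => x (φ i)) = y) && f x) T (l + w) := by
  obtain ⟨D, h1, h2, h3⟩ := h
  refine ⟨D.map fun t => (List.ofFn fun i => (φ i, y i)) ++ t, by simpa using h1, ?_, fun x => ?_⟩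
  · simp only [List.mem_map]
    rintro _ ⟨t, ht, rfl⟩
    simpa using h2 t ht
  · simp only [← h3]
    rw [Bool.eq_iff_iff]
    have h4 : ((fun i => x (φ i)) = y) ↔ ∀ i, x (φ i) = y i := funext_iff
    simp [dnfEval, h4]
    exact ⟨fun ⟨t, a, b, c⟩ => ⟨b, t, a, c⟩, fun ⟨b, t, a, c⟩ => ⟨t, a, b, c⟩⟩

theorem exists_fin {n : ℕ} {f : Fin n → Bits m → Bool} (h : ∀ i, HasDNF (f i) T w) :
    HasDNF (fun x => decide (∃ i, f i x = true)) (n * T) w := by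
  choose D h1 h2 h3 using h
  refine ⟨(List.finRange n).flatMap D, ?_, ?_, fun x => ?_⟩
  · rw [List.length_flatMap]
    refine (List.sum_le_card_nsmul _ T ?_).trans (by simp)
    simp only [List.mem_map]
    rintro _ ⟨i, -, rfl⟩
    exact h1 i
  · simp only [List.mem_flatMap]
    rintro t ⟨i, -, ht⟩
    exact h2 i t ht
  · rw [Bool.eq_iff_iff, decide_eq_true_eq]
    simp_rw [← h3]
    simp only [dnfEval, List.any_flatMap, List.any_eq_true, List.mem_finRange, true_and]

end HasDNF

/-- Decryption has small circuits if the bits of the pads depend on few bits of the seed. -/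
theorem exists_circuit_decBit {n : ℕ → ℕ} {G : (κ : ℕ) → Bits κ → Bits (n κ ^ 7)} {L : ℕ}
    (hL : ∀ (κ : ℕ) (j : Fin (n κ ^ 7)), ∃ I : Finset (Fin κ), I.card ≤ L ∧
      ∀ s s' : Bits κ, (∀ i ∈ I, s i = s' i) → G κ s j = G κ s' j)
    (κ : ℕ) (c : Bits (ctextLength n κ)) : ∃ C : Circuit (Fin κ),
      C.size ≤ 2 * κ + (n κ * 2 ^ L + 1) * (κ + L + 2) + 1 ∧ C.depth ≤ 3 ∧
        ∀ sk, C.eval sk = decBit G κ sk c := by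
  classical
  refine HasDNF.exists_circuit ?_
  let c' : Bits (2 + n (κ / 2) ^ 7 + n κ + n κ * (κ - κ / 2)) := c
  let p := firstOne (Ctext.position c')
  -- The ciphertext is hardwired, hence so is the position `p`, and locality bounds the seed bits
  -- that matter.
  have hbit : ∀ b, HasDNF (fun sk : Bits κ => decide (b ≠ bitAt (G (κ / 2) (seedOf sk)) p))
      (2 ^ L) L := fun b => by
    by_cases hp : p < n (κ / 2) ^ 7
    · obtain ⟨I, hI, hdep⟩ := hL (κ / 2) ⟨p, hp⟩
      have hcard : (I.map ⟨fun t : Fin (κ / 2) => (⟨t, by omega⟩ : Fin κ), fun s t h =>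
        Fin.ext (by simpa using h)⟩).card ≤ L := by rwa [Finset.card_map]
      refine (HasDNF.of_depends_on _ fun x x' h => ?_).mono
        (Nat.pow_le_pow_right (by norm_num) hcard) hcard
      have := hdep (seedOf x) (seedOf x') fun t ht => h _ (Finset.mem_map_of_mem _ ht)
      simp only [bitAt_of_lt _ hp, this]
    -- Outside the pads `bitAt` is `false`, so the condition is constant.
    · refine ((HasDNF.const (decide (b ≠ false))).mono Nat.one_le_two_pow le_rfl).congr fun x => ?_
      rw [bitAt, dif_neg hp]
  by_cases hflag : Ctext.header c' 0 = true
  · refine ((HasDNF.const (Ctext.header c' 1)).mono (by omega) le_rfl).congr fun sk => ?_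
    simp only [decBit, decode]
    rw [if_pos hflag]
  -- For every slot, the literals of the label test are added to the terms for the pad bit; the
  -- slots are then joined by the outer disjunction.
  · refine ((HasDNF.exists_fin fun i => (hbit (Ctext.mask c' i)).and_literals
      (fun t : Fin (κ - κ / 2) => (⟨κ / 2 + t, by omega⟩ : Fin κ)) (Ctext.label c' i)).mono
        (by omega) (by omega)).congr fun sk => ?_
    simp only [decBit, decode]
    rw [if_neg hflag]
    simp only [Bool.and_eq_true, decide_eq_true_eq]
    rw [decide_eq_decide]
    refine exists_congr fun i => and_congr_left fun _ => ?_
    rw [eq_comm]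
    rfl

/-! ## The distinguisher -/

/-- Strategies of pirates. -/
abbrev Strategy (n w : ℕ → ℕ) : Type :=
  (κ : ℕ) → Bits (w κ) → (Fin (n κ) → Option (Bits κ)) →
    (Fin (numQueries (n κ)) → Bits (ctextLength n κ)) → Bits (numQueries (n κ))

section

variable {n w : ℕ → ℕ}

/-- The users other than `g`. -/
def othersOf (n g : ℕ) : Finset (Fin n) := Finset.univ.filter fun i => (i : ℕ) ≠ g

/-- The pads of the keys, with those of user `g` replaced by `y`. -/
def replacePad (G : (κ : ℕ) → Bits κ → Bits (n κ ^ 7)) {κ A : ℕ} (sk : Fin A → Bits κ) (g : ℕ)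
    (y : Bits (n (κ / 2) ^ 7)) : Fin A → Bits (n (κ / 2) ^ 7) :=
  fun i => if (i : ℕ) = g then y else padsOf G sk i

/-- The pirate without the key of user `g` answers so that `g` is accused, in the experiment where
the pads of `g` are `y`. -/
def Framed (G : (κ : ℕ) → Bits κ → Bits (n κ ^ 7)) (run : Strategy n w) (κ g : ℕ)
    (sk : Fin (n κ) → Bits κ) (F : Fin (numQueries (n κ)) → Bits (n κ)) (ω : Bits (w κ))
    (y : Bits (n (κ / 2) ^ 7)) : Prop :=
  g < n κ ∧ accuse F (run κ ω (keysOf (othersOf (n κ) g) sk) fun j =>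
    maskAll (replacePad G sk g y) (labelsOf sk) j (F j)) = g

/-- The number of binary digits of a guessed user. -/
def guessLength (n : ℕ) : ℕ := Nat.log 2 n + 1

/-- The experiment `Framed` with a random user, run with the coins `ω`. -/
def Simulates (G : (κ : ℕ) → Bits κ → Bits (n κ ^ 7)) (run : Strategy n w) (κ : ℕ) {m : ℕ}
    (ω : Bits m) (y : Bits (n (κ / 2) ^ 7)) : Prop :=
  Framed G run κ (binVal (guessLength (n κ)) (coins 4 0 ω)) (coinKeys (n κ) κ (coins 4 1 ω))
    (code (coinColumns (numQueries (n κ)) (n κ) κ (coins 4 2 ω))) (fun t => coins 4 3 ω t) y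

section

variable {α : Type} {N : α → ℕ} {x : α → Data} {κ A g : α → ℕ}

theorem PComp.replacePad {G : (κ : ℕ) → Bits κ → Bits (n κ ^ 7)} (hG : EfficientGenerator G)
    {sk : (a : α) → Fin (A a) → Bits (κ a)} {y : (a : α) → Bits (n (κ a / 2) ^ 7)}
    (hκ : NComp N x κ) (hA : NComp N x A) (hsk : PComp N x fun a => Data.ofBitsSeq (sk a))
    (hg : NComp N x g) (hy : PComp N x fun a => Data.ofBits (y a)) :
    PComp N x fun a => Data.ofBitsSeq (replacePad G (sk a) (g a) (y a)) := by
  refine .ofBitsSeq hA (PComp.congr (PComp.ite (P := fun q : Σ a, Fin (A a) => (q.2 : ℕ) = g q.1)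
    (inst := fun _ => inferInstance) (BComp.eq (.var hA) hg.weaken) hy.weaken
    (PComp.row (c := fun q : Σ a, Fin (A a) => _root_.padsOf G (sk q.1)) (i := fun q => q.2)
      (PComp.padsOf hG hκ hA hsk).weaken (.var hA))) fun q => ?_)
  unfold _root_.replacePad
  split_ifs <;> rfl

theorem PComp.keysOf_others {sk : (a : α) → Fin (A a) → Bits (κ a)}
    (hA : NComp N x A) (hsk : PComp N x fun a => Data.ofBitsSeq (sk a)) (hg : NComp N x g) :
    PComp N x fun a => Data.ofPartialSeq (keysOf (othersOf (A a) (g a)) (sk a)) := by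
  refine .ofList_ofFn hA (PComp.congr (PComp.ite (P := fun q : Σ a, Fin (A a) => (q.2 : ℕ) = g q.1)
    (inst := fun _ => inferInstance) (BComp.eq (.var hA) hg.weaken) .nil
    (.cons .nil (PComp.row (c := fun q : Σ a, Fin (A a) => sk q.1) (i := fun q => q.2)
      hsk.weaken (.var hA)))) fun q => ?_)
  by_cases h : (q.2 : ℕ) = g q.1 <;> simp [h, keysOf, othersOf, Data.ofOptionBits]

theorem BComp.simulates {G : (κ : ℕ) → Bits κ → Bits (n κ ^ 7)} (hG : EfficientGenerator G)
    (hn : PBdd id n) {run : Strategy n w} {prog : Prog} {adv : ℕ → List Bool}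
    {t : ℕ → ℕ} (ht : PBdd id t)
    (hrun : ∀ κ ω skS c, prog.ComputesIn
      (Data.ofList [Data.unary κ, Data.ofBoolList (adv κ), Data.ofBits ω,
        Data.ofPartialSeq skS, Data.ofBitsSeq c]) (Data.ofBits (run κ ω skS c)) (t κ))
    (hwN : NComp N x fun a => w (κ a)) (hκ : NComp N x κ) {m : α → ℕ} {ω : (a : α) → Bits (m a)}
    {y : (a : α) → Bits (n (κ a / 2) ^ 7)} (hadv : PComp N x fun a => Data.ofBoolList (adv (κ a)))
    (hω : PComp N x fun a => Data.ofBits (ω a)) (hy : PComp N x fun a => Data.ofBits (y a)) :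
    BComp N x fun a => Simulates G run (κ a) (ω a) (y a) := by
  obtain ⟨hn', hQ, hl, hk⟩ := NComp.parameters hG hn hκ
  have hg : NComp N x fun a => _root_.binVal (guessLength (n (κ a))) (_root_.coins 4 0 (ω a)) := by
    refine .binVal (hn'.log.add (.const 1)) hn' (fun a q hq => ?_) ?_
    · rcases Nat.eq_zero_or_pos (n (κ a)) with h | h
      · simp only [guessLength, h, Nat.log_zero_right, zero_add, Nat.lt_one_iff] at hq
        simp [hq]
      · exact (Nat.pow_le_of_le_log (by omega) (Nat.lt_succ_iff.1 hq)).trans (Nat.le_succ _)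
    · exact BComp.coins 4 0 (w := fun q : (Σ a, Fin (Nat.log 2 (n (κ a)) + 1)) => ω q.1)
        hω.weaken (.var (hn'.log.add (.const 1)))
  have hsk := PComp.coinKeys 4 1 hω hn' hκ
  have hF := PComp.codeOfCoins 4 2 hω hk hn' hκ
  have hωP : PComp N x fun a => Data.ofBits fun t : Fin (w (κ a)) => _root_.coins 4 3 (ω a) t :=
    .ofBits hwN (BComp.coins 4 3 (w := fun q : (Σ a, Fin (w (κ a))) => ω q.1) hω.weaken (.var hwN))
  have hc := PComp.maskCode hk hQ hn' hl (PComp.replacePad hG hκ hn' hsk hg hy)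
    (PComp.labelsOf hκ hn' hsk) hF
  have hS := PComp.keysOf_others hn' hsk hg
  have hrunC := PComp.trans (.cons hκ.1 (.cons hadv (.cons hωP (.cons hS (.cons hc .nil)))))
    (PComp.of_prog (t := fun a => t (κ a)) ((ht.comp κ).trans hκ.2) fun a => hrun (κ a) _ _ _)
  exact .and (.lt hg hn') (.eq (NComp.accuse hk hn' hF hrunC) hg)

end

theorem PBdd.numQueries {n : ℕ → ℕ} (hn : PBdd id n) : PBdd id fun κ => numQueries (n κ) := by
  refine ((hn.pow 2).mul ((hn.add (.const _ 1)).pow 3)).mono fun κ => ?_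
  unfold _root_.numQueries
  gcongr
  exact Nat.log_le_self _ _

open Classical in
/-- The distinguisher for the seed length `κ` simulates the scheme for the security parameter
`2 κ + b`. -/
theorem exists_distinguisher {M : AdversaryModel} {G : (κ : ℕ) → Bits κ → Bits (n κ ^ 7)}
    (hG : EfficientGenerator G) (hn : PBdd id n) (hgrow : PBdd (fun κ => n κ ^ 7) id)
    {r e : ℕ} (hr : r = 0 ∨ r = 1)
    {run : Strategy n fun κ => (κ + n κ + numQueries (n κ) + 2) ^ e} {prog : Prog}
    {adv : ℕ → List Bool} (hadv : M.Allows adv)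
    (hrun : ∀ κ ω skS c, prog.ComputesIn
      (Data.ofList [Data.unary κ, Data.ofBoolList (adv κ), Data.ofBits ω,
        Data.ofPartialSeq skS, Data.ofBitsSeq c]) (Data.ofBits (run κ ω skS c))
        ((κ + n κ + numQueries (n κ) + 2) ^ e)) {coinBd : ℕ → ℕ} (hcoin : PBdd id coinBd) :
    ∃ A : Distinguisher M fun κ => n κ ^ 7, (∀ κ, coinBd κ ≤ (n κ ^ 7 + 2) ^ A.e) ∧
      ∀ κ ω y, A.run κ ω y = true ↔ Simulates G run (2 * κ + r) ω fun t => bitAt y t := by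
  let α := Σ κ : ℕ, Σ m, Bits m × Bits (n κ ^ 7)
  let x : α → Data := fun a => Data.ofList [Data.unary a.1,
    Data.ofBoolList (adv (2 * a.1 + r)), Data.ofBits a.2.2.1, Data.ofBits a.2.2.2]
  have hκ' : NComp (fun a : α => a.1) x fun a => a.1 := ⟨PComp.self.fst, .self _⟩
  have hκ : NComp (fun a : α => a.1) x fun a => 2 * a.1 + r := ((NComp.const 2).mul hκ').add (.const r)
  have hw : PBdd id fun κ => (κ + n κ + numQueries (n κ) + 2) ^ e :=
    ((((PBdd.self id).add hn).add hn.numQueries).add (.const _ 2)).pow e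
  obtain ⟨hn', hQ, hl, hk'⟩ := NComp.parameters hG hn hκ
  -- The length index `(2 * a.1 + r) / 2` is not `a.1` by definition; reading the challenge through
  -- `bitAt` converts its type.
  have hb : BComp (fun a : α => a.1) x fun a => Simulates G run (2 * a.1 + r) a.2.2.1
      fun t => bitAt a.2.2.2 t := by
    refine BComp.simulates hG hn hw hrun ((((hκ.add hn').add hk').add (.const 2)).pow e) hκ
      (m := fun a => a.2.1) (ω := fun a => a.2.2.1) PComp.self.snd.fst PComp.self.snd.snd.fst ?_
    exact PComp.ofBits hQ (BComp.bitAt (w := fun q : Σ a : α, Fin (n ((2 * a.1 + r) / 2) ^ 7) =>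
      q.1.2.2.2) (PComp.weaken (x := x) PComp.self.snd.snd.snd.fst) (.var hQ))
  obtain ⟨p, d, hp⟩ := PComp.exists_prog hb
  -- A distinguisher is measured by its input length `n κ ^ 7`, in which `hgrow` bounds `κ`
  -- polynomially. One exponent serves both the running time and the coins.
  have hbd : PBdd (fun κ => n κ ^ 7) fun κ => (κ + 2) ^ d + coinBd κ :=
    ((((PBdd.self id).add (.const _ 2)).pow d).add hcoin).trans hgrow
  obtain ⟨E, hE⟩ := hbd
  refine ⟨⟨E, p, fun κ => adv (2 * κ + r), ?_,
    fun κ ω y => decide (Simulates G run (2 * κ + r) ω fun t => bitAt y t), fun κ ω y => ?_⟩, ?_, ?_⟩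
  · cases M with
    | uniform => exact fun κ => hadv _
    | nonuniform =>
      obtain ⟨c, hc⟩ := hadv
      -- The advice belongs to the parameter `2 κ + r`, and `2 κ + r + 2 ≤ (κ + 2) ^ 2`.
      refine ⟨2 * c, fun κ => (hc _).trans ?_⟩
      rw [pow_mul]
      refine Nat.pow_le_pow_left ?_ c
      rcases hr with rfl | rfl <;> nlinarith
  · exact (hp ⟨κ, _, ω, y⟩).mono (le_trans (Nat.le_add_right _ _) (hE κ))
  · exact fun κ => le_trans (Nat.le_add_left _ _) (hE κ)
  · exact fun κ ω y => decide_eq_true_iff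

end

/-! ## Independence of interleaved coins -/

section

variable {Ω Ω' : Type} [Fintype Ω] [Fintype Ω']

theorem prob_congr_snd {Ω'' : Type} [Fintype Ω''] {E : Ω × Ω' → Prop} {E' : Ω × Ω'' → Prop}
    (h : ∀ ω, prob (fun ω' => E (ω, ω')) = prob (fun ω'' => E' (ω, ω''))) : prob E = prob E' := by
  rw [prob_prod, prob_prod]
  simp_rw [h]

theorem prob_bitAt {ι : Type} [Fintype ι] [DecidableEq ι] {m : ℕ} {φ : ι → ℕ}
    (hφ : Function.Injective φ) (hm : ∀ i, φ i < m) (E : (ι → Bool) → Prop) :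
    prob (fun ω : Bits m => E fun i => bitAt ω (φ i)) = prob E := by
  rw [← prob_comp_injective (φ := fun i => (⟨φ i, hm i⟩ : Fin m))
    (fun i j h => hφ (Fin.mk.inj h)) E]
  simp_rw [bitAt_of_lt _ (hm _)]

theorem finProd_lt {a b m : ℕ} (q : Fin a × Fin b) (h : a * b ≤ m) :
    ((finProdFinEquiv q : Fin (a * b)) : ℕ) < m := (Fin.is_lt _).trans_le h

theorem prob_coinKeys {m n κ : ℕ} (hm : n * κ ≤ m) (E : (Fin n → Bits κ) → Prop) :
    prob (fun ω : Bits m => E (coinKeys n κ (coins 1 0 ω))) = prob E := by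
  rw [← prob_equiv (Equiv.curry (Fin n) (Fin κ) Bool) E]
  rw [← prob_bitAt (m := m) (φ := fun q : Fin n × Fin κ => 1 * (finProdFinEquiv q : ℕ) + 0)
    (fun q q' h => finProdFinEquiv.injective (Fin.ext (show (finProdFinEquiv q : ℕ) = finProdFinEquiv q' by
      dsimp only at h; omega))) (fun q => (show _ = _ by ring : 1 * (finProdFinEquiv q : ℕ) + 0 = finProdFinEquiv q).trans_lt (finProd_lt q hm))]
  rfl

/-- The order of the coins in `coinColumns`. -/
def columnIndex (k n B : ℕ) (q : Fin k × Fin (n + 1) × Fin B) : ℕ :=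
  (finProdFinEquiv (finProdFinEquiv (q.1, q.2.1), q.2.2) : Fin (k * (n + 1) * B))

theorem columnIndex_injective (k n B : ℕ) : Function.Injective (columnIndex k n B) := by
  rintro ⟨j, i, t⟩ ⟨j', i', t'⟩ h
  have h1 := finProdFinEquiv.injective (Fin.ext h)
  have h2 := finProdFinEquiv.injective (Prod.mk.inj h1).1
  simp only [Prod.mk.injEq] at h1 h2 ⊢
  exact ⟨h2.1, h2.2, h1.2⟩

theorem columnIndex_lt {k n B : ℕ} (q : Fin k × Fin (n + 1) × Fin B) :
    columnIndex k n B q < k * ((n + 1) * B) := by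
  rw [← mul_assoc]
  exact Fin.is_lt _

/-- Uncurrying of three arguments. -/
def uncurryThree (k n B : ℕ) :
    (Fin k × Fin (n + 1) × Fin B → Bool) ≃ (Fin k → Fin (n + 1) → Bits B) where
  toFun f j i t := f (j, i, t)
  invFun f q := f q.1 q.2.1 q.2.2
  left_inv _ := rfl
  right_inv _ := rfl

theorem prob_coinColumns {m k n B : ℕ} (hm : k * ((n + 1) * B) ≤ m)
    (E : (Fin k → Fin (n + 1) → Bits B) → Prop) :
    prob (fun ω : Bits m => E (coinColumns k n B (coins 1 0 ω))) = prob E := by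
  rw [← prob_equiv (uncurryThree k n B) E]
  rw [← prob_bitAt (m := m) (φ := fun q => 1 * columnIndex k n B q + 0)
    (fun q q' h => columnIndex_injective _ _ _ (by simpa using h))
    (fun q => by simpa using (columnIndex_lt q).trans_le hm)]
  rfl

set_option synthInstance.maxSize 1000 in
set_option synthInstance.maxHeartbeats 200000 in
/-- Four independent sources of interleaved coins. -/
theorem prob_interleaved {m L k n B w : ℕ} (h0 : 4 * L ≤ m) (h1 : 4 * (n * B) ≤ m)
    (h2 : 4 * (k * ((n + 1) * B)) ≤ m) (h3 : 4 * w ≤ m)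
    (E : Bits L × (Fin n → Bits B) × (Fin k → Fin (n + 1) → Bits B) × Bits w → Prop) :
    prob (fun ω : Bits m => E (fun t => coins 4 0 ω t, coinKeys n B (coins 4 1 ω),
      coinColumns k n B (coins 4 2 ω), fun t => coins 4 3 ω t)) = prob E := by
  let e : (Fin L ⊕ (Fin n × Fin B) ⊕ (Fin k × Fin (n + 1) × Fin B) ⊕ Fin w → Bool) ≃
      Bits L × (Fin n → Bits B) × (Fin k → Fin (n + 1) → Bits B) × Bits w :=
    (Equiv.sumArrowEquivProdArrow _ _ _).trans (Equiv.prodCongr (Equiv.refl _)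
      ((Equiv.sumArrowEquivProdArrow _ _ _).trans (Equiv.prodCongr (Equiv.curry _ _ _)
        ((Equiv.sumArrowEquivProdArrow _ _ _).trans (Equiv.prodCongr (uncurryThree k n B)
          (Equiv.refl _))))))
  let φ : Fin L ⊕ (Fin n × Fin B) ⊕ (Fin k × Fin (n + 1) × Fin B) ⊕ Fin w → ℕ := Sum.elim (fun t => 4 * (t : ℕ) + 0) (Sum.elim
    (fun q => 4 * ((finProdFinEquiv q : Fin (n * B)) : ℕ) + 1)
    (Sum.elim (fun q => 4 * columnIndex k n B q + 2) fun t => 4 * (t : ℕ) + 3))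
  -- Different sources use different residues modulo `4`, so only coins of the same source have to
  -- be compared.
  have hφ : Function.Injective φ := by
    rintro (i | i | i | i) (j | j | j | j) h <;>
      simp only [φ, Sum.elim_inl, Sum.elim_inr] at h <;> try omega
    · rw [Fin.ext (show (i : ℕ) = j by omega)]
    · rw [finProdFinEquiv.injective (Fin.ext (show (finProdFinEquiv i : ℕ) = finProdFinEquiv j by omega))]
    · rw [columnIndex_injective _ _ _ (show columnIndex k n B i = columnIndex k n B j by omega)]
    · rw [Fin.ext (show (i : ℕ) = j by omega)]
  have hlt : ∀ i, φ i < m := by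
    rintro (i | i | i | i) <;> simp only [φ, Sum.elim_inl, Sum.elim_inr]
    · have := i.2
      omega
    · have := finProd_lt i le_rfl
      omega
    · have := columnIndex_lt i
      omega
    · have := i.2
      omega
  rw [← prob_equiv e E, ← prob_bitAt hφ hlt]
  rfl

/-- Some guess of the distinguisher names user `i`, so the correct guess has probability at least `1
/ 2 ^ guessLength n`. -/
theorem exists_binVal {n i : ℕ} (h : i < n) :
    ∃ b : Bits (guessLength n), binVal (guessLength n) (bitAt b) = i := by
  have hlt : i < 2 ^ guessLength n := h.trans (Nat.lt_pow_succ_log_self (by norm_num) n)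
  refine ⟨fun q => i.testBit q, ?_⟩
  have : ∀ (L i : ℕ), i < 2 ^ L → (∑ q ∈ Finset.range L, if i.testBit q = true then 2 ^ q else 0) = i := by
    intro L
    induction L with
    | zero =>
      intro i hi
      simp at hi
      simp [hi]
    | succ L ih =>
      intro i hi
      have h1 := ih (i / 2) (by rw [pow_succ] at hi; omega)
      rw [Finset.sum_range_succ']
      simp only [Nat.testBit_succ]
      have h2 : (∑ q ∈ Finset.range L, if (i / 2).testBit q = true then 2 ^ (q + 1) else 0) =
          2 * (i / 2) := by
        refine Eq.trans ?_ (congrArg (2 * ·) h1)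
        simp only [Finset.mul_sum]
        refine Finset.sum_congr rfl fun q _ => ?_
        split_ifs <;> ring
      rw [h2, Nat.testBit_zero]
      rcases Nat.mod_two_eq_zero_or_one i with h | h <;> simp [h] <;> omega
  refine (Finset.sum_congr rfl fun q hq => ?_).trans (this _ i hlt)
  rw [bitAt_of_lt _ (Finset.mem_range.1 hq)]

theorem binVal_congr {L : ℕ} {c c' : ℕ → Bool} (h : ∀ q < L, c q = c' q) :
    binVal L c = binVal L c' :=
  Finset.sum_congr rfl fun q hq => by rw [h q (Finset.mem_range.1 hq)]

end

/-- The probability over coins of the simulation is the probability over its ingredients. -/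
theorem prob_simulates {n w : ℕ → ℕ} {G : (κ : ℕ) → Bits κ → Bits (n κ ^ 7)} {run : Strategy n w}
    {κ m : ℕ} (h0 : 4 * guessLength (n κ) ≤ m) (h1 : 4 * (n κ * κ) ≤ m)
    (h2 : 4 * (numQueries (n κ) * ((n κ + 1) * κ)) ≤ m) (h3 : 4 * w κ ≤ m)
    (y : Bits (n (κ / 2) ^ 7)) :
    prob (fun ω : Bits m => Simulates G run κ ω y) =
      prob (fun q : Bits (guessLength (n κ)) × (Fin (n κ) → Bits κ) ×
        (Fin (numQueries (n κ)) → Fin (n κ + 1) → Bits κ) × Bits (w κ) =>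
        Framed G run κ (binVal (guessLength (n κ)) (bitAt q.1)) q.2.1 (code q.2.2.1) q.2.2.2 y) := by
  rw [← prob_interleaved h0 h1 h2 h3]
  congr 1
  funext ω
  unfold Simulates
  rw [binVal_congr (c' := bitAt fun t : Fin (guessLength (n κ)) => coins 4 0 ω t)
    fun q hq => by rw [bitAt_of_lt _ hq]]

/-! ## Security -/

/-- The key with a given seed and label. -/
def keyOf {κ : ℕ} (s : Bits (κ / 2)) (l : Bits (κ - κ / 2)) : Bits κ :=
  fun t => if h : (t : ℕ) < κ / 2 then s ⟨t, h⟩ else l ⟨t - κ / 2, by omega⟩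

@[simp] theorem seedOf_keyOf {κ : ℕ} (s : Bits (κ / 2)) (l : Bits (κ - κ / 2)) :
    seedOf (keyOf s l) = s := by
  funext t
  simp [seedOf, keyOf]

@[simp] theorem labelOf_keyOf {κ : ℕ} (s : Bits (κ / 2)) (l : Bits (κ - κ / 2)) :
    labelOf (keyOf s l) = l := by
  funext t
  simp [labelOf, keyOf]

@[simp] theorem keyOf_seedOf_labelOf {κ : ℕ} (x : Bits κ) : keyOf (seedOf x) (labelOf x) = x := by
  funext t
  unfold keyOf seedOf labelOf
  split_ifs with h
  · rfl
  · congr 1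
    ext
    simp only
    omega

/-- Exchange of the seed of user `i`. -/
def swapSeed {A κ : ℕ} (i : Fin A) :
    (Fin A → Bits κ) × Bits (κ / 2) ≃ (Fin A → Bits κ) × Bits (κ / 2) where
  toFun q := (Function.update q.1 i (keyOf q.2 (labelOf (q.1 i))), seedOf (q.1 i))
  invFun q := (Function.update q.1 i (keyOf q.2 (labelOf (q.1 i))), seedOf (q.1 i))
  left_inv q := by simp
  right_inv q := by simp

theorem card_othersOf {n : ℕ} (i : Fin n) : (othersOf n i).card + 1 = n := by
  have : othersOf n i = Finset.univ.erase i := by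
    ext i'
    simp [othersOf, Fin.ext_iff]
  rw [this, Finset.card_erase_of_mem (Finset.mem_univ _), Finset.card_univ, Fintype.card_fin]
  have := i.pos
  omega

theorem mem_othersOf {n : ℕ} {i i' : Fin n} : i' ∈ othersOf n i ↔ i' ≠ i := by
  simp [othersOf, Fin.ext_iff]

theorem keysOf_congr {A κ : ℕ} {S : Finset (Fin A)} {sk sk' : Fin A → Bits κ}
    (h : ∀ i ∈ S, sk i = sk' i) : keysOf S sk = keysOf S sk' := by
  funext i
  unfold keysOf
  split_ifs with hi
  · rw [h i hi]
  · rfl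

section

variable {n w : ℕ → ℕ} {G : (κ : ℕ) → Bits κ → Bits (n κ ^ 7)} {run : Strategy n w} {κ : ℕ}

/-- The pirate without the key of user `i` answers so that `i` is accused. -/
def Accuses (G : (κ : ℕ) → Bits κ → Bits (n κ ^ 7)) (run : Strategy n w) (κ : ℕ) (i : Fin (n κ))
    (sk : Fin (n κ) → Bits κ) (F : Fin (numQueries (n κ)) → Bits (n κ)) (ω : Bits (w κ)) : Prop :=
  accuse F (run κ ω (keysOf (othersOf (n κ) i) sk) fun j =>
    maskAll (padsOf G sk) (labelsOf sk) j (F j)) = i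

/-- Pads expanded from a fresh seed are the pads of the key with that seed and the old label. The
pirate does not hold the key of `i`, so nothing else changes from its point of view. -/
theorem framed_swapSeed (i : Fin (n κ)) (q : (Fin (n κ) → Bits κ) × Bits (κ / 2))
    (F : Fin (numQueries (n κ)) → Bits (n κ)) (ω : Bits (w κ)) :
    Framed G run κ i q.1 F ω (G (κ / 2) q.2) ↔ Accuses G run κ i (swapSeed i q).1 F ω := by
  have h1 : keysOf (othersOf (n κ) i) q.1 = keysOf (othersOf (n κ) i) (swapSeed i q).1 :=
    keysOf_congr fun i' hi' => by
      simp [swapSeed, mem_othersOf.1 hi']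
  have h2 : labelsOf q.1 = labelsOf (swapSeed i q).1 := by
    funext i'
    by_cases h : i' = i
    · subst h
      simp [swapSeed, labelsOf]
    · simp [swapSeed, labelsOf, h]
  have h3 : replacePad G q.1 i (G (κ / 2) q.2) = padsOf G (swapSeed i q).1 := by
    funext i'
    by_cases h : i' = i
    · subst h
      simp [swapSeed, padsOf, replacePad]
    · simp [swapSeed, padsOf, replacePad, h, Fin.ext_iff.not.1 h]
  rw [Framed, Accuses, h1, h2, h3]
  exact and_iff_right i.2

/-- The simulation with the output of the generator. -/
theorem prob_accuses_le {m : ℕ} (h0 : 4 * guessLength (n κ) ≤ m) (h1 : 4 * (n κ * κ) ≤ m)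
    (h2 : 4 * (numQueries (n κ) * ((n κ + 1) * κ)) ≤ m) (h3 : 4 * w κ ≤ m) (i : Fin (n κ)) :
    prob (fun q : (Fin (n κ) → Bits κ) ×
        (Fin (numQueries (n κ)) → Fin (n κ + 1) → Bits κ) × Bits (w κ) =>
        Accuses G run κ i q.1 (code q.2.1) q.2.2) / 2 ^ guessLength (n κ) ≤
      prob (fun q : Bits m × Bits (κ / 2) => Simulates G run κ q.1 (G (κ / 2) q.2)) := by
  let g := Bits (guessLength (n κ))
  let K := Fin (n κ) → Bits κ
  let U := Fin (numQueries (n κ)) → Fin (n κ + 1) → Bits κ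
  let W := Bits (w κ)
  let S := Bits (κ / 2)
  have e1 : prob (fun q : Bits m × S => Simulates G run κ q.1 (G (κ / 2) q.2)) =
      prob (fun q : S × g × K × U × W =>
        Framed G run κ (binVal (guessLength (n κ)) (bitAt q.2.1)) q.2.2.1 (code q.2.2.2.1) q.2.2.2.2
          (G (κ / 2) q.1)) := by
    refine (prob_equiv (Equiv.prodComm S (Bits m))
      fun q : Bits m × S => Simulates G run κ q.1 (G (κ / 2) q.2)).symm.trans ?_
    refine prob_congr_snd (Ω := S) (Ω' := Bits m) (Ω'' := g × K × U × W) fun s => ?_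
    exact prob_simulates h0 h1 h2 h3 (G (κ / 2) s)
  let e : g × ((K × S) × (U × W)) ≃ S × g × K × U × W :=
    ⟨fun q => (q.2.1.2, q.1, q.2.1.1, q.2.2.1, q.2.2.2),
      fun q => (q.2.1, ((q.2.2.1, q.1), (q.2.2.2.1, q.2.2.2.2))), fun _ => rfl, fun _ => rfl⟩
  rw [e1]
  refine le_trans ?_ (prob_equiv e fun q : S × g × K × U × W =>
        Framed G run κ (binVal (guessLength (n κ)) (bitAt q.2.1)) q.2.2.1 (code q.2.2.2.1) q.2.2.2.2
          (G (κ / 2) q.1)).le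
  -- Only the guess that names `i` is kept; this costs the factor `2 ^ guessLength`.
  obtain ⟨b, hb⟩ := exists_binVal i.2
  refine le_trans (le_of_eq ?_) (prob_ge_of_fst b)
  congr 1
  · simp only [e, Equiv.coe_fn_mk, hb]
    simp only [framed_swapSeed]
    let e' : (K × U × W) × S ≃ (K × S) × (U × W) :=
      ⟨fun q => ((q.1.1, q.2), q.1.2), fun q => ((q.1.1, q.2), q.1.2), fun _ => rfl, fun _ => rfl⟩
    -- The exchange of seeds preserves the uniform distribution, and the seed that was swapped out
    -- is not used any more.
    refine Eq.symm ((prob_equiv ((swapSeed i).prodCongr (Equiv.refl (U × W)))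
      fun q : (K × S) × (U × W) => Accuses G run κ i q.1.1 (code q.2.1) q.2.2).trans ?_)
    refine (prob_equiv e'
      fun q : (K × S) × (U × W) => Accuses G run κ i q.1.1 (code q.2.1) q.2.2).symm.trans ?_
    exact prob_fst (Ω := K × U × W) (Ω' := S) fun q => Accuses G run κ i q.1 (code q.2.1) q.2.2
  · simp

theorem firstOne_oneHot {Q p : ℕ} (hp : p < Q) : firstOne (oneHot Q p) = p := by
  have h : ∀ t : Fin Q, (∀ s : Fin Q, (s : ℕ) ≤ t → oneHot Q p s = false) ↔ t < ⟨p, hp⟩ := fun t => by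
    simp only [oneHot, decide_eq_false_iff_not]
    constructor
    · intro ht
      by_contra hc
      exact ht ⟨p, hp⟩ (not_lt.1 hc) rfl
    · intro ht s hs
      have : (t : ℕ) < p := ht
      omega
  unfold firstOne
  simp_rw [h]
  rw [Finset.sum_boole, Nat.cast_id]
  rw [show (Finset.univ.filter fun t : Fin Q => t < ⟨p, hp⟩) = Finset.Iio ⟨p, hp⟩ by ext; simp,
    Fin.card_Iio]

/-- Decryption is correct if the labels are different. -/
theorem decode_maskAll {Q N l : ℕ} {pads : Fin N → Bits Q} {lab : Fin N → Bits l} {p : ℕ}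
    (hlab : Function.Injective lab) (hp : p < Q) (f : Bits N) (i : Fin N) :
    decode (pads i) (lab i) (maskAll pads lab p f) = f i := by
  have h1 : Ctext.position (maskAll pads lab p f) = oneHot Q p := by
    funext t
    simp [Ctext.position, maskAll, ctext]
  have h2 : ∀ i, Ctext.mask (maskAll pads lab p f) i = Bool.xor (f i) (bitAt (pads i) p) :=
    fun i => by simp [Ctext.mask, maskAll, ctext]
  have h3 : ∀ i, Ctext.label (maskAll pads lab p f) i = lab i := fun i => by
    funext t
    simp only [Ctext.label, maskAll, ctext, Fin.append_right, flatRows]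
    have := finProdFinEquiv.symm_apply_apply (i, t)
    rw [finProdFinEquiv_symm_apply] at this
    rw [(Prod.mk.inj this).1, (Prod.mk.inj this).2]
  unfold decode
  rw [if_neg (by simp [maskAll, Ctext.header_ctext])]
  simp only [h1, h2, h3, firstOne_oneHot hp]
  have : (∃ i', lab i' = lab i ∧ Bool.xor (f i') (bitAt (pads i') p) ≠ bitAt (pads i) p) ↔
      f i = true := by
    constructor
    · rintro ⟨i', hi', h⟩
      obtain rfl := hlab hi'
      revert h
      cases f i' <;> simp
    · intro h
      exact ⟨i, rfl, by simp [h]⟩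
  simp [this]

end

/-! ### Union bounds and collisions of labels -/

theorem prob_exists_le {Ω ι : Type} [Fintype Ω] [Fintype ι] (E : ι → Ω → Prop) :
    prob (fun ω => ∃ i, E i ω) ≤ ∑ i, prob (E i) := by
  classical
  unfold prob
  rw [← Finset.sum_div, ← Nat.cast_sum]
  gcongr
  refine (Finset.card_le_card fun ω => ?_).trans (Finset.card_biUnion_le
    (s := Finset.univ) (t := fun i => Finset.univ.filter fun ω => E i ω))
  simp

theorem prob_eq_const {Ω : Type} [Fintype Ω] (x : Ω) :
    prob (fun ω => ω = x) = 1 / Fintype.card Ω := by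
  classical
  rw [prob_eq_sum]
  simp

theorem prob_false {Ω : Type} [Fintype Ω] {E : Ω → Prop} (h : ∀ ω, ¬ E ω) : prob E = 0 := by
  classical
  rw [prob_eq_sum]
  simp [h]

/-- Keys as pairs of seeds and labels. -/
def keyEquiv (κ : ℕ) : Bits (κ / 2) × Bits (κ - κ / 2) ≃ Bits κ where
  toFun q := keyOf q.1 q.2
  invFun x := (seedOf x, labelOf x)
  left_inv q := by simp
  right_inv x := by simp

theorem prob_labelOf_eq {κ : ℕ} (l : Bits (κ - κ / 2)) :
    prob (fun x : Bits κ => labelOf x = l) = 1 / 2 ^ (κ - κ / 2) := by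
  rw [← prob_equiv (keyEquiv κ)]
  simp only [keyEquiv, Equiv.coe_fn_mk, labelOf_keyOf]
  rw [prob_snd (Ω := Bits (κ / 2)) fun q => q = l, prob_eq_const]
  simp

/-- Collisions of labels are unlikely. -/
theorem prob_label_collision_le (n κ : ℕ) :
    prob (fun sk : Fin n → Bits κ => ¬ Function.Injective (labelsOf sk)) ≤
      (n : ℝ) ^ 2 / 2 ^ (κ - κ / 2) := by
  have h1 : ∀ q : Fin n × Fin n, prob (fun sk : Fin n → Bits κ =>
      q.1 ≠ q.2 ∧ labelOf (sk q.1) = labelOf (sk q.2)) ≤ 1 / 2 ^ (κ - κ / 2) := fun q => by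
    by_cases hq : q.1 = q.2
    · rw [prob_false fun sk h => h.1 hq]
      positivity
    · let e : ({j // j ≠ q.1} → Bits κ) × Bits κ ≃ (Fin n → Bits κ) :=
        (Equiv.prodComm _ _).trans (Equiv.funSplitAt q.1 (Bits κ)).symm
      rw [← prob_equiv e]
      refine prob_prod_le (by positivity) fun r => ?_
      rw [← prob_labelOf_eq (labelOf (r ⟨q.2, Ne.symm hq⟩))]
      refine prob_mono fun x hx => ?_
      simpa [e, Ne.symm hq] using hx.2
  calc _ ≤ prob (fun sk : Fin n → Bits κ => ∃ q : Fin n × Fin n,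
        q.1 ≠ q.2 ∧ labelOf (sk q.1) = labelOf (sk q.2)) := by
        refine prob_mono fun sk h => ?_
        unfold Function.Injective at h
        push Not at h
        obtain ⟨i, i', h, h'⟩ := h
        exact ⟨(i, i'), h', h⟩
    _ ≤ ∑ _q : Fin n × Fin n, 1 / (2 : ℝ) ^ (κ - κ / 2) :=
        (prob_exists_le _).trans (Finset.sum_le_sum fun q _ => h1 q)
    _ = _ := by
        simp
        ring

/-! ### The experiment with truly random pads -/

section

variable {n w : ℕ → ℕ} {G : (κ : ℕ) → Bits κ → Bits (n κ ^ 7)} {run : Strategy n w} {κ : ℕ}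

/-- The bits of `y` at positions below `k` are flipped according to row `i` of the code. -/
def flipRow {k N Q : ℕ} (i : Fin N) (F : Fin k → Bits N) (y : Bits Q) : Bits Q :=
  fun t => Bool.xor (y t) (bitAt (fun j => F j i) t)

theorem flipRow_flipRow {k N Q : ℕ} (i : Fin N) (F : Fin k → Bits N) (y : Bits Q) :
    flipRow i F (flipRow i F y) = y := by
  funext t
  simp [flipRow]

/-- The queries in the experiment `Framed`. -/
def framedQuery (G : (κ : ℕ) → Bits κ → Bits (n κ ^ 7)) (κ : ℕ) (i : Fin (n κ))
    (sk : Fin (n κ) → Bits κ) (F : Fin (numQueries (n κ)) → Bits (n κ))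
    (y : Bits (n (κ / 2) ^ 7)) : Fin (numQueries (n κ)) → Bits (ctextLength n κ) :=
  fun j => maskAll (replacePad G sk i y) (labelsOf sk) j (F j)

/-- If the pads of user `i` are random, the queries do not depend on row `i` of the code. -/
theorem framedQuery_flipRow_congr (hk : numQueries (n κ) ≤ n (κ / 2) ^ 7) {i : Fin (n κ)}
    {sk : Fin (n κ) → Bits κ} {F F' : Fin (numQueries (n κ)) → Bits (n κ)}
    {y : Bits (n (κ / 2) ^ 7)} (h : ∀ j i', i' ≠ i → F j i' = F' j i') :
    framedQuery G κ i sk F (flipRow i F y) = framedQuery G κ i sk F' (flipRow i F' y) := by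
  funext j
  unfold framedQuery maskAll
  congr 1
  funext i'
  by_cases hi : i' = i
  · subst hi
    have hj : (j : ℕ) < n (κ / 2) ^ 7 := j.2.trans_le hk
    -- The bit of row `i` occurs once in the message and once in the flipped pad; the two cancel and
    -- leave `y`.
    have key : ∀ F : Fin (numQueries (n κ)) → Bits (n κ), Bool.xor (F j i')
        (bitAt (replacePad G sk i' (flipRow i' F y) i') j) = bitAt y j := fun F => by
      rw [replacePad, if_pos rfl, bitAt_of_lt _ hj, bitAt_of_lt _ hj, flipRow, bitAt_val]
      cases F j i' <;> simp
    rw [key, key]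
  · have hi' : (i' : ℕ) ≠ i := Fin.ext_iff.not.1 hi
    rw [h j i' hi, replacePad, replacePad, if_neg hi', if_neg hi']

/-- The bound on the simulation with random strings. -/
theorem prob_framed_le (hk : numQueries (n κ) ≤ n (κ / 2) ^ 7)
    (hB : (n κ + 1) ^ 2 * numQueries (n κ) ≤ 2 ^ κ) {δ : ℝ} (hδ : 0 ≤ δ)
    (hav : ∀ (sk : Fin (n κ) → Bits κ) (S : Finset (Fin (n κ))), n κ ≤ S.card + 1 → ∀ c,
      prob (fun ω => ∃ (j : Fin (numQueries (n κ))) (b : Bool),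
        (∀ i ∈ S, decBit G κ (sk i) (c j) = b) ∧ run κ ω (keysOf S sk) c j ≠ b) ≤ δ)
    (i : Fin (n κ)) :
    prob (fun q : Bits (n (κ / 2) ^ 7) × (Fin (n κ) → Bits κ) ×
        (Fin (numQueries (n κ)) → Fin (n κ + 1) → Bits κ) × Bits (w κ) =>
        Framed G run κ i q.2.1 (code q.2.2.1) q.2.2.2 q.1) ≤
      (n κ : ℝ) ^ 2 / 2 ^ (κ - κ / 2) + (δ + codeError (numQueries (n κ)) (n κ)) := by
  let Y := Bits (n (κ / 2) ^ 7)
  let K := Fin (n κ) → Bits κ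
  let U := Fin (numQueries (n κ)) → Fin (n κ + 1) → Bits κ
  let W := Bits (w κ)
  let O := othersOf (n κ) i
  let Coll : Y × K × U × W → Prop := fun q => ¬ Function.Injective (labelsOf q.2.1)
  let Unav : Y × K × U × W → Prop := fun q => ∃ (j : Fin (numQueries (n κ))) (b : Bool),
    (∀ i' ∈ O, decBit G κ (q.2.1 i') (framedQuery G κ i q.2.1 (code q.2.2.1) q.1 j) = b) ∧
      run κ q.2.2.2 (keysOf O q.2.1) (framedQuery G κ i q.2.1 (code q.2.2.1) q.1) j ≠ b
  let Good : Y × K × U × W → Prop := fun q =>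
    Feasible i (code q.2.2.1)
      (run κ q.2.2.2 (keysOf O q.2.1) (framedQuery G κ i q.2.1 (code q.2.2.1) q.1)) ∧
    accuse (code q.2.2.1)
      (run κ q.2.2.2 (keysOf O q.2.1) (framedQuery G κ i q.2.1 (code q.2.2.1) q.1)) = i
  -- With distinct labels every user other than `i` decrypts to the own code bit, so a pirate that
  -- keeps to availability gives feasible answers.
  have hsub : ∀ q : Y × K × U × W, Framed G run κ i q.2.1 (code q.2.2.1) q.2.2.2 q.1 →
      Coll q ∨ (Unav q ∨ Good q) := fun q hq => by
    by_cases h1 : Coll q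
    · exact .inl h1
    by_cases h2 : Unav q
    · exact .inr (.inl h2)
    refine .inr (.inr ⟨fun j b hb => ?_, hq.2⟩)
    by_contra hc
    refine h2 ⟨j, b, fun i' hi' => ?_, hc⟩
    have hne := mem_othersOf.1 hi'
    rw [← hb i' hne]
    have := decode_maskAll (pads := replacePad G q.2.1 i q.1) (not_not.1 h1)
      (j.2.trans_le hk) (code q.2.2.1 j) i'
    rwa [replacePad, if_neg (Fin.ext_iff.not.1 hne)] at this
  have hColl : prob Coll ≤ (n κ : ℝ) ^ 2 / 2 ^ (κ - κ / 2) := by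
    refine le_trans (le_of_eq ?_) (prob_label_collision_le (n κ) κ)
    refine (prob_snd (Ω := Y) (Ω' := K × U × W) fun q => ¬ Function.Injective (labelsOf q.1)).trans ?_
    exact prob_fst (Ω := K) (Ω' := U × W) fun sk => ¬ Function.Injective (labelsOf sk)
  have hUnav : prob Unav ≤ δ := by
    refine prob_prod_le (E := Unav) hδ fun y => ?_
    refine prob_prod_le (E := fun q : K × U × W => Unav (y, q)) hδ fun sk => ?_
    refine prob_prod_le (E := fun q : U × W => Unav (y, sk, q)) hδ fun u => ?_
    exact hav sk O (card_othersOf i).ge (framedQuery G κ i sk (code u) y)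
  have hcode : 0 ≤ codeError (numQueries (n κ)) (n κ) := by
    unfold codeError
    positivity
  have hGood : prob Good ≤ codeError (numQueries (n κ)) (n κ) := by
    -- Uniform pads remain uniform when row `i` of the code is added. After this change of variables
    -- the answers no longer depend on row `i`, as `prob_accuse_le` requires.
    let e : (Y × K × W) × U ≃ Y × K × U × W :=
      { toFun := fun q => (flipRow i (code q.2) q.1.1, q.1.2.1, q.2, q.1.2.2)
        invFun := fun q => ((flipRow i (code q.2.2.1) q.1, q.2.1, q.2.2.2), q.2.2.1)
        left_inv := fun q => by simp only [flipRow_flipRow]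
        right_inv := fun q => by simp only [flipRow_flipRow] }
    rw [← prob_equiv e]
    refine prob_prod_le (E := fun q : (Y × K × W) × U => Good (e q)) hcode fun r => ?_
    exact prob_accuse_le hB i (fun F => run κ r.2.2 (keysOf O r.2.1)
      (framedQuery G κ i r.2.1 F (flipRow i F r.1))) fun F F' h => by
        simp only [framedQuery_flipRow_congr hk h]
  exact (prob_mono hsub).trans (prob_or_le.trans (add_le_add hColl
    (prob_or_le.trans (add_le_add hUnav hGood))))

/-- The bound holds for each guessed user, hence for a random guess; a guess that is not a user
frames nobody. -/
theorem prob_simulates_le (hk : numQueries (n κ) ≤ n (κ / 2) ^ 7)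
    (hB : (n κ + 1) ^ 2 * numQueries (n κ) ≤ 2 ^ κ) {δ : ℝ} (hδ : 0 ≤ δ)
    (hav : ∀ (sk : Fin (n κ) → Bits κ) (S : Finset (Fin (n κ))), n κ ≤ S.card + 1 → ∀ c,
      prob (fun ω => ∃ (j : Fin (numQueries (n κ))) (b : Bool),
        (∀ i ∈ S, decBit G κ (sk i) (c j) = b) ∧ run κ ω (keysOf S sk) c j ≠ b) ≤ δ)
    {m : ℕ} (h0 : 4 * guessLength (n κ) ≤ m) (h1 : 4 * (n κ * κ) ≤ m)
    (h2 : 4 * (numQueries (n κ) * ((n κ + 1) * κ)) ≤ m) (h3 : 4 * w κ ≤ m) :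
    prob (fun q : Bits m × Bits (n (κ / 2) ^ 7) => Simulates G run κ q.1 q.2) ≤
      (n κ : ℝ) ^ 2 / 2 ^ (κ - κ / 2) + (δ + codeError (numQueries (n κ)) (n κ)) := by
  let g := Bits (guessLength (n κ))
  let Y := Bits (n (κ / 2) ^ 7)
  let K := Fin (n κ) → Bits κ
  let U := Fin (numQueries (n κ)) → Fin (n κ + 1) → Bits κ
  let W := Bits (w κ)
  have hβ : 0 ≤ (n κ : ℝ) ^ 2 / 2 ^ (κ - κ / 2) + (δ + codeError (numQueries (n κ)) (n κ)) := by
    unfold codeError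
    positivity
  have e1 : prob (fun q : Bits m × Y => Simulates G run κ q.1 q.2) =
      prob (fun q : Y × g × K × U × W =>
        Framed G run κ (binVal (guessLength (n κ)) (bitAt q.2.1)) q.2.2.1 (code q.2.2.2.1) q.2.2.2.2
          q.1) := by
    refine (prob_equiv (Equiv.prodComm Y (Bits m))
      fun q : Bits m × Y => Simulates G run κ q.1 q.2).symm.trans ?_
    refine prob_congr_snd (Ω := Y) (Ω' := Bits m) (Ω'' := g × K × U × W) fun y => ?_
    exact prob_simulates h0 h1 h2 h3 y
  let e : g × (Y × K × U × W) ≃ Y × g × K × U × W :=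
    ⟨fun q => (q.2.1, q.1, q.2.2), fun q => (q.2.1, q.1, q.2.2), fun _ => rfl, fun _ => rfl⟩
  rw [e1]
  refine (prob_equiv e fun q : Y × g × K × U × W =>
    Framed G run κ (binVal (guessLength (n κ)) (bitAt q.2.1)) q.2.2.1 (code q.2.2.2.1) q.2.2.2.2
      q.1).symm.le.trans (prob_prod_le hβ fun b => ?_)
  by_cases hb : binVal (guessLength (n κ)) (bitAt b) < n κ
  · exact prob_framed_le hk hB hδ hav ⟨_, hb⟩
  · exact (prob_false fun q h => hb h.1).trans_le hβ

end

theorem prob_map_fst {Ω Ω' Ω'' : Type} [Fintype Ω] [Fintype Ω'] [Fintype Ω''] {f : Ω → Ω''}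
    (hf : ∀ E : Ω'' → Prop, prob (fun ω => E (f ω)) = prob E) (E : Ω'' × Ω' → Prop) :
    prob (fun q : Ω × Ω' => E (f q.1, q.2)) = prob E := by
  refine (prob_equiv (Equiv.prodComm Ω' Ω) fun q : Ω × Ω' => E (f q.1, q.2)).symm.trans ?_
  refine Eq.trans ?_ (prob_equiv (Equiv.prodComm Ω' Ω'') E)
  exact prob_congr_snd fun ω' => hf fun ω => E (ω, ω')

/-! ### From accusations to the failure of tracing -/

section

variable {M : AdversaryModel} {n : ℕ → ℕ} {G : (κ : ℕ) → Bits κ → Bits (n κ ^ 7)}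

/-- The coins of the pirate. -/
abbrev pirateCoins (n : ℕ → ℕ) (e κ : ℕ) : ℕ := (κ + n κ + numQueries (n κ) + 2) ^ e

/-- The strategy of a pirate. -/
def Pirate.strategy {SP : SchemePrograms G} (P : Pirate M SP.scheme) :
    Strategy n (pirateCoins n P.e) := P.run

/-- Tracing always names a user, so it cannot fail if the coalition contains everybody. Otherwise
exactly one user is missing, and failure means that this user is accused. -/
theorem failure_le (SP : SchemePrograms G) (P : Pirate M SP.scheme) {κ : ℕ} (hn : 0 < n κ)
    {S : Finset (Fin (n κ))} (hS : n κ ≤ S.card + 1) {c : ℝ} (hc : 0 ≤ c)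
    (h : ∀ i, prob (fun q : (Fin (n κ) → Bits κ) ×
        (Fin (numQueries (n κ)) → Fin (n κ + 1) → Bits κ) × Bits (pirateCoins n P.e κ) =>
        Accuses G P.strategy κ i q.1 (code q.2.1) q.2.2) ≤ c) :
    SP.scheme.failure P κ S ≤ c := by
  by_cases hS' : S = Finset.univ
  · refine (prob_false fun q hq => hq ?_).trans_le hc
    rw [hS']
    exact ⟨⟨_, SP.scheme.trace_lt κ q.2.1 (SP.scheme.gen κ q.1) _ hn⟩, Finset.mem_univ _, rfl⟩
  · obtain ⟨i, hi⟩ : ∃ i, i ∉ S := by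
      by_contra! hall
      exact hS' (Finset.eq_univ_iff_forall.2 hall)
    have hSi : S = othersOf (n κ) i := by
      refine Finset.eq_of_subset_of_card_le (fun i' hi' => mem_othersOf.2 fun h => hi (h ▸ hi')) ?_
      have := card_othersOf i
      omega
    subst hSi
    let K := Fin (n κ) → Bits κ
    let U := Fin (numQueries (n κ)) → Fin (n κ + 1) → Bits κ
    let W := Bits (pirateCoins n P.e κ)
    let C := Bits ((κ + n κ + 2) ^ SP.e)
    let C' := Bits ((κ + n κ + numQueries (n κ) + 2) ^ SP.e)
    have hK : ∀ E : K → Prop, prob (fun ω : C => E (genKeys n κ ω)) = prob E :=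
      prob_coinKeys (SP.gen_coins κ)
    have hU : ∀ E : U → Prop, prob (fun ω : C' => E (coinColumns (numQueries (n κ)) (n κ) κ
        (coins 1 0 ω))) = prob E := prob_coinColumns (SP.trace_coins κ)
    refine le_trans ?_ (h i)
    have e1 : prob (fun q : C × C' × W =>
        Accuses G P.strategy κ i (genKeys n κ q.1) (traceCode n κ q.2.1) q.2.2) =
        prob (fun q : K × U × W => Accuses G P.strategy κ i q.1 (code q.2.1) q.2.2) := by
      refine Eq.trans ?_ (prob_map_fst (Ω' := U × W) hK
        fun q : K × U × W => Accuses G P.strategy κ i q.1 (code q.2.1) q.2.2)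
      refine prob_congr_snd (Ω := C) (Ω' := C' × W) (Ω'' := U × W) fun ω => ?_
      exact prob_map_fst (Ω' := W) hU
        fun q : U × W => Accuses G P.strategy κ i (genKeys n κ ω) (code q.1) q.2
    rw [← e1]
    refine prob_mono fun q hq => ?_
    by_contra hne
    refine hq ⟨⟨_, SP.scheme.trace_lt κ q.2.1 (SP.scheme.gen κ q.1) _ hn⟩, mem_othersOf.2 fun heq => ?_, rfl⟩
    exact hne (Fin.ext_iff.1 heq)

theorem simulates_bitAt {w : ℕ → ℕ} {run : Strategy n w} {κ κ' m : ℕ} (h : κ' = κ) (ω : Bits m)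
    (y : Bits (n (κ / 2) ^ 7)) :
    Simulates G run κ' ω (fun t => bitAt y t) ↔ Simulates G run κ ω y := by
  subst h
  simp only [bitAt_val]

/-- The number of coins of the distinguisher. -/
def coinBound (n : ℕ → ℕ) (e κ : ℕ) : ℕ :=
  4 * (guessLength (n κ) + n κ * κ + numQueries (n κ) * ((n κ + 1) * κ) + pirateCoins n e κ)

/-- The bound on the accusations of innocent users. -/
theorem prob_accuses_le_advantage {e κ : ℕ} {run : Strategy n (pirateCoins n e)}
    {A : Distinguisher M fun κ => n κ ^ 7}
    (hcoin : coinBound n e κ ≤ (n (κ / 2) ^ 7 + 2) ^ A.e)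
    (hA : ∀ ω y, A.run (κ / 2) ω y = true ↔ Simulates G run κ ω y)
    (hk : numQueries (n κ) ≤ n (κ / 2) ^ 7)
    (hB : (n κ + 1) ^ 2 * numQueries (n κ) ≤ 2 ^ κ) {δ : ℝ} (hδ : 0 ≤ δ)
    (hav : ∀ (sk : Fin (n κ) → Bits κ) (S : Finset (Fin (n κ))), n κ ≤ S.card + 1 → ∀ c,
      prob (fun ω => ∃ (j : Fin (numQueries (n κ))) (b : Bool),
        (∀ i ∈ S, decBit G κ (sk i) (c j) = b) ∧ run κ ω (keysOf S sk) c j ≠ b) ≤ δ)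
    (i : Fin (n κ)) :
    prob (fun q : (Fin (n κ) → Bits κ) ×
        (Fin (numQueries (n κ)) → Fin (n κ + 1) → Bits κ) × Bits (pirateCoins n e κ) =>
        Accuses G run κ i q.1 (code q.2.1) q.2.2) ≤
      2 * n κ * ((n κ : ℝ) ^ 2 / 2 ^ (κ - κ / 2) + (δ + codeError (numQueries (n κ)) (n κ)) +
        A.advantage G (κ / 2)) := by
  unfold coinBound at hcoin
  have h0 : 4 * guessLength (n κ) ≤ (n (κ / 2) ^ 7 + 2) ^ A.e := by omega
  have h1 : 4 * (n κ * κ) ≤ (n (κ / 2) ^ 7 + 2) ^ A.e := by omega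
  have h2 : 4 * (numQueries (n κ) * ((n κ + 1) * κ)) ≤ (n (κ / 2) ^ 7 + 2) ^ A.e := by omega
  have h3 : 4 * pirateCoins n e κ ≤ (n (κ / 2) ^ 7 + 2) ^ A.e := by omega
  have hreal := prob_accuses_le (G := G) (run := run) h0 h1 h2 h3 i
  have hideal := prob_simulates_le (G := G) (run := run) hk hB hδ hav h0 h1 h2 h3
  have hadv := le_abs_self (prob (fun q : Bits ((n (κ / 2) ^ 7 + 2) ^ A.e) × Bits (κ / 2) =>
      A.run (κ / 2) q.1 (G (κ / 2) q.2) = true)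
    - prob (fun q : Bits ((n (κ / 2) ^ 7 + 2) ^ A.e) × Bits (n (κ / 2) ^ 7) =>
      A.run (κ / 2) q.1 q.2 = true))
  simp only [hA] at hadv
  have hadv' : A.advantage G (κ / 2) =
      |prob (fun q : Bits ((n (κ / 2) ^ 7 + 2) ^ A.e) × Bits (κ / 2) =>
          Simulates G run κ q.1 (G (κ / 2) q.2))
        - prob (fun q : Bits ((n (κ / 2) ^ 7 + 2) ^ A.e) × Bits (n (κ / 2) ^ 7) =>
          Simulates G run κ q.1 q.2)| := by
    simp only [Distinguisher.advantage, hA]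
  rw [← hadv'] at hadv
  rw [div_le_iff₀ (by positivity)] at hreal
  -- The loss from guessing: one digit more than `Nat.log 2` at most doubles the number of guesses.
  have hpow : (2 : ℝ) ^ guessLength (n κ) ≤ 2 * n κ := by
    have : 2 ^ guessLength (n κ) ≤ 2 * n κ := by
      rw [guessLength, pow_succ']
      exact Nat.mul_le_mul_left 2 (Nat.pow_log_le_self 2 i.pos.ne')
    exact_mod_cast this
  have hnn : (0 : ℝ) ≤ prob (fun q : Bits ((n (κ / 2) ^ 7 + 2) ^ A.e) × Bits (κ / 2) =>
    Simulates G run κ q.1 (G (κ / 2) q.2)) := prob_nonneg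
  calc _ ≤ _ := hreal
    _ ≤ _ := mul_le_mul_of_nonneg_left hpow hnn
    _ ≤ ((n κ : ℝ) ^ 2 / 2 ^ (κ - κ / 2) + (δ + codeError (numQueries (n κ)) (n κ)) +
        A.advantage G (κ / 2)) * (2 * n κ) := by
        refine mul_le_mul_of_nonneg_right ?_ (by positivity)
        linarith
    _ = _ := by ring

theorem PBdd.coinBound {n : ℕ → ℕ} (hn : PBdd id n) (e r : ℕ) :
    PBdd id fun κ => coinBound n e (2 * κ + r) := by
  have hg : PBdd id fun κ => guessLength (n κ) := (hn.add (.const _ 1)).mono fun κ =>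
    Nat.add_le_add_right (Nat.log_le_self _ _) 1
  have h : PBdd id (_root_.coinBound n e) := (PBdd.const _ 4).mul (((hg.add (hn.mul (.self id))).add
    (hn.numQueries.mul ((hn.add (.const _ 1)).mul (.self id)))).add
    (((((PBdd.self id).add hn).add hn.numQueries).add (.const _ 2)).pow e))
  exact (h.comp fun κ => 2 * κ + r).trans (((PBdd.const id 2).mul (.self id)).add (.const _ r))

end

/-! ## Growth of the number of users -/

/-- `n` grows like a monomial of positive degree. -/
def MonomialGrowth (n : ℕ → ℕ) : Prop :=
  ∃ d C : ℕ, 0 < d ∧ ∀ᶠ κ in atTop, n κ ≤ C * κ ^ d ∧ κ ^ d ≤ C * n κ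

/-- A polynomial is asymptotically equivalent to its leading term, whose degree is positive by
assumption. -/
theorem monomialGrowth_of_polynomial {p : ℚ[X]} (hp : 0 < p.natDegree) {n : ℕ → ℕ}
    (hn : ∀ κ : ℕ, (n κ : ℚ) = p.eval (κ : ℚ)) : MonomialGrowth n := by
  set P : ℝ[X] := p.map (algebraMap ℚ ℝ) with hP
  have hn' : ∀ κ : ℕ, (n κ : ℝ) = P.eval (κ : ℝ) := fun κ => by
    have h := congrArg (algebraMap ℚ ℝ) (hn κ)
    rw [hP, Polynomial.eval_map, Polynomial.eval₂_eq_eval_map, ← map_natCast (algebraMap ℚ ℝ) κ,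
      Polynomial.eval_map, Polynomial.eval₂_at_apply, ← h]
    simp
  have hdeg : P.natDegree = p.natDegree := Polynomial.natDegree_map _
  have hP0 : P.leadingCoeff ≠ 0 := by
    rw [Polynomial.leadingCoeff_ne_zero]
    rintro h
    rw [h, Polynomial.natDegree_zero] at hdeg
    omega
  have hΘ : (fun κ : ℕ => (n κ : ℝ)) =Θ[atTop] fun κ : ℕ => (κ : ℝ) ^ p.natDegree := by
    have h1 := (Polynomial.isEquivalent_atTop_lead P).isTheta
    have h2 : (fun x : ℝ => P.leadingCoeff * x ^ P.natDegree) =Θ[atTop] fun x => x ^ P.natDegree :=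
      (isTheta_const_mul_left hP0).2 (isTheta_refl _ _)
    have h3 := (h1.trans h2)
    rw [hdeg] at h3
    simp_rw [hn']
    exact ⟨h3.1.comp_tendsto tendsto_natCast_atTop_atTop,
      h3.2.comp_tendsto tendsto_natCast_atTop_atTop⟩
  obtain ⟨c1, h1⟩ := hΘ.1.bound
  obtain ⟨c2, h2⟩ := hΘ.2.bound
  obtain ⟨C1, hC1⟩ := exists_nat_ge c1
  obtain ⟨C2, hC2⟩ := exists_nat_ge c2
  refine ⟨p.natDegree, C1 + C2, hp, ?_⟩
  filter_upwards [h1, h2] with κ h1 h2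
  rw [Real.norm_of_nonneg (by positivity), Real.norm_of_nonneg (by positivity)] at h1 h2
  constructor
  · have : (n κ : ℝ) ≤ (C1 + C2) * (κ : ℝ) ^ p.natDegree := h1.trans (by
      gcongr
      linarith [(Nat.cast_nonneg C2 : (0 : ℝ) ≤ C2)])
    exact_mod_cast this
  · have : (κ : ℝ) ^ p.natDegree ≤ (C1 + C2) * (n κ : ℝ) := h2.trans (by
      gcongr
      linarith [(Nat.cast_nonneg C1 : (0 : ℝ) ≤ C1)])
    exact_mod_cast this

/-- The finitely many exceptions are absorbed by the sum of the values there. -/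
theorem exists_le_add_of_eventually_le {f g : ℕ → ℕ} (h : ∀ᶠ κ in atTop, f κ ≤ g κ) :
    ∃ D, ∀ κ, f κ ≤ g κ + D := by
  obtain ⟨N, hN⟩ := eventually_atTop.1 h
  refine ⟨∑ κ ∈ Finset.range N, f κ, fun κ => ?_⟩
  by_cases hκ : κ < N
  · exact (Finset.single_le_sum (f := f) (fun _ _ => Nat.zero_le _) (Finset.mem_range.2 hκ)).trans
      (Nat.le_add_left _ _)
  · exact (hN κ (not_lt.1 hκ)).trans (Nat.le_add_right _ _)

theorem PBdd.of_eventually_le {N f g : ℕ → ℕ} (hg : PBdd N g) (h : ∀ᶠ κ in atTop, f κ ≤ g κ) :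
    PBdd N f := by
  obtain ⟨D, hD⟩ := exists_le_add_of_eventually_le h
  exact (hg.add (.const N D)).mono hD

namespace MonomialGrowth

variable {n : ℕ → ℕ}

theorem pbdd (h : MonomialGrowth n) : PBdd id n := by
  obtain ⟨d, C, -, h⟩ := h
  exact PBdd.of_eventually_le ((PBdd.const id C).mul ((PBdd.self id).pow d)) (h.mono fun κ h => h.1)

theorem eventually_le_mul (h : MonomialGrowth n) : ∃ C : ℕ, ∀ᶠ κ in atTop, κ ≤ C * n κ := by
  obtain ⟨d, C, hd, h⟩ := h
  exact ⟨C, h.mono fun κ h => (Nat.le_self_pow hd.ne' κ).trans h.2⟩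

/-- Time polynomial in `κ` is thus polynomial in the output length, the measure for distinguishers.
-/
theorem pbdd_pow_seven (h : MonomialGrowth n) : PBdd (fun κ => n κ ^ 7) id := by
  obtain ⟨C, h⟩ := h.eventually_le_mul
  refine PBdd.of_eventually_le ((PBdd.const _ C).mul (.self _)) (h.mono fun κ h => h.trans ?_)
  exact Nat.mul_le_mul_left C (Nat.le_self_pow (by norm_num) _)

theorem tendsto (h : MonomialGrowth n) : Tendsto n atTop atTop := by
  obtain ⟨C, h⟩ := h.eventually_le_mul
  refine tendsto_atTop.2 fun b => ?_
  filter_upwards [h, eventually_gt_atTop (C * b)] with κ h1 h2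
  exact (lt_of_mul_lt_mul_left (h2.trans_le h1) (Nat.zero_le C)).le

theorem tendsto_div_two : Tendsto (fun κ : ℕ => κ / 2) atTop atTop :=
  Nat.tendsto_div_const_atTop two_ne_zero

/-- Since `κ ≤ 3 * (κ / 2)` for `κ ≥ 2`, halving the argument costs only a constant factor. This
compensates for seeds of half the length of a key. -/
theorem eventually_le_half (h : MonomialGrowth n) :
    ∃ C : ℕ, ∀ᶠ κ in atTop, n κ ≤ C * n (κ / 2) := by
  obtain ⟨d, C, hd, h⟩ := h
  refine ⟨C * (3 ^ d * C), ?_⟩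
  filter_upwards [h, tendsto_div_two.eventually h, eventually_ge_atTop 2] with κ h1 h2 h3
  calc n κ ≤ C * κ ^ d := h1.1
    _ ≤ C * (3 * (κ / 2)) ^ d := by
        gcongr
        omega
    _ = C * (3 ^ d * (κ / 2) ^ d) := by rw [mul_pow]
    _ ≤ C * (3 ^ d * (C * n (κ / 2))) := by
        gcongr
        exact h2.2
    _ = _ := by ring

end MonomialGrowth

/-! ### Size of the error terms -/

theorem numQueries_le (n : ℕ) : numQueries n ≤ n ^ 5 := by
  rcases Nat.eq_zero_or_pos n with rfl | hn
  · simp [numQueries]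
  · calc n ^ 2 * (Nat.log 2 n + 1) ^ 3 ≤ n ^ 2 * n ^ 3 := by
          gcongr
          exact Nat.log_lt_self 2 hn.ne'
      _ = n ^ 5 := by ring

/-- This provides a separate pad position for every query. The two spare powers between `5` and `7`
absorb the constant `C ^ 5` from halving the key. -/
theorem MonomialGrowth.numQueries_le_pow {n : ℕ → ℕ} (h : MonomialGrowth n) :
    ∀ᶠ κ in atTop, numQueries (n κ) ≤ n (κ / 2) ^ 7 := by
  obtain ⟨C, hC⟩ := h.eventually_le_half
  filter_upwards [hC, (h.tendsto.comp tendsto_div_two).eventually_ge_atTop (C ^ 5)] with κ h1 h2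
  calc numQueries (n κ) ≤ (C * n (κ / 2)) ^ 5 := (numQueries_le _).trans (Nat.pow_le_pow_left h1 5)
    _ = C ^ 5 * n (κ / 2) ^ 5 := by ring
    _ ≤ n (κ / 2) ^ 2 * n (κ / 2) ^ 5 := Nat.mul_le_mul_right _
        ((show C ^ 5 ≤ n (κ / 2) from h2).trans (Nat.le_self_pow two_ne_zero _))
    _ = n (κ / 2) ^ 7 := by ring

/-- Exponentials beat polynomials. -/
theorem PBdd.tendsto_div_two_pow {f : ℕ → ℕ} (hf : PBdd id f) :
    Tendsto (fun κ => (f κ : ℝ) / 2 ^ (κ - κ / 2)) atTop (nhds 0) := by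
  obtain ⟨e, he⟩ := hf
  have h1 : Tendsto (fun j : ℕ => 2 * 2 ^ e * (((j + 1 : ℕ) : ℝ) ^ e / 2 ^ (j + 1))) atTop (nhds 0) := by
    have := (tendsto_pow_const_div_const_pow_of_one_lt e (one_lt_two (α := ℝ))).comp
      (tendsto_add_atTop_nat 1)
    simpa using this.const_mul (2 * 2 ^ e)
  have h2 : Tendsto (fun κ : ℕ => κ - κ / 2) atTop atTop :=
    tendsto_atTop_mono (fun κ => by omega) MonomialGrowth.tendsto_div_two
  refine squeeze_zero (fun κ => by positivity) (fun κ => ?_) (h1.comp h2)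
  -- This uses `κ + 2 ≤ 2 * (κ - κ / 2 + 1)`.
  have h3 : (f κ : ℝ) ≤ 2 ^ e * ((κ - κ / 2 + 1 : ℕ) : ℝ) ^ e := by
    have : f κ ≤ 2 ^ e * (κ - κ / 2 + 1) ^ e := by
      rw [← mul_pow]
      exact (he κ).trans (Nat.pow_le_pow_left (by simp only [id]; omega) e)
    exact_mod_cast this
  simp only [Function.comp]
  rw [pow_succ (2 : ℝ) (κ - κ / 2)]
  calc _ ≤ 2 ^ e * ((κ - κ / 2 + 1 : ℕ) : ℝ) ^ e / 2 ^ (κ - κ / 2) := by gcongr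
    _ = _ := by
        field_simp

theorem PBdd.eventually_le_two_pow {f : ℕ → ℕ} (hf : PBdd id f) :
    ∀ᶠ κ in atTop, f κ ≤ 2 ^ κ := by
  filter_upwards [hf.tendsto_div_two_pow.eventually_le_const one_pos] with κ h
  rw [div_le_one (by positivity)] at h
  have : f κ ≤ 2 ^ (κ - κ / 2) := by exact_mod_cast h
  exact this.trans (Nat.pow_le_pow_right (by norm_num) (Nat.sub_le _ _))

theorem log_le_natLog_succ (n : ℕ) : Real.log n ≤ (Nat.log 2 n + 1 : ℕ) := by
  rcases Nat.eq_zero_or_pos n with rfl | hn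
  · simp
  · have h1 : (n : ℝ) ≤ 2 ^ (Nat.log 2 n + 1) := by
      exact_mod_cast (Nat.lt_pow_succ_log_self (by norm_num) n).le
    calc Real.log n ≤ Real.log (2 ^ (Nat.log 2 n + 1)) :=
          Real.log_le_log (by exact_mod_cast hn) h1
      _ = (Nat.log 2 n + 1 : ℕ) * Real.log 2 := Real.log_pow _ _
      _ ≤ (Nat.log 2 n + 1 : ℕ) * 1 := by
          gcongr
          linarith [Real.log_two_lt_d9]
      _ = _ := mul_one _

theorem harm_le (n : ℕ) : harm n ≤ 2 * (Nat.log 2 n + 1 : ℕ) := by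
  have h1 : harm n = (harmonic n : ℝ) := by
    simp [harm, harmonic]
  have h2 := harmonic_le_one_add_log n
  have h3 := log_le_natLog_succ n
  have h4 : (1 : ℝ) ≤ (Nat.log 2 n + 1 : ℕ) := by exact_mod_cast Nat.le_add_left 1 _
  linarith

/-- Write `ℓ` for the rounded logarithm. Then `k = n ^ 2 ℓ ^ 3`, `harm n ≤ 2 ℓ` and `n (n + 1) ≤ 2 n
^ 2` give the exponent `ℓ ^ 2 / (512 * 2 * 2)`; the other exponent is even larger. -/
theorem codeError_le {n : ℕ} (hn : 0 < n) :
    codeError (numQueries n) n ≤ 6 * Real.exp (-(((Nat.log 2 n + 1 : ℕ) : ℝ) ^ 2 / 2048)) := by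
  have hH := harm_le n
  have hH1 := one_le_harm hn
  have hk : ((numQueries n : ℕ) : ℝ) = (n : ℝ) ^ 2 * ((Nat.log 2 n + 1 : ℕ) : ℝ) ^ 3 := by
    unfold numQueries
    push_cast
    rfl
  set ℓ : ℝ := ((Nat.log 2 n + 1 : ℕ) : ℝ) with hℓ
  have h1 : (1 : ℝ) ≤ ℓ := by
    rw [hℓ]
    exact_mod_cast Nat.le_add_left 1 _
  have hn1 : (1 : ℝ) ≤ n := by exact_mod_cast hn
  have e1 : ℓ ^ 2 / 2048 ≤ numQueries n / (4 * (n + 1)) := by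
    rw [hk, div_le_div_iff₀ (by norm_num) (by positivity)]
    have h3 : ℓ ^ 2 ≤ ℓ ^ 3 := pow_le_pow_right₀ h1 (by norm_num)
    have h4 : (4 : ℝ) * (n + 1) ≤ n ^ 2 * 2048 := by nlinarith
    calc ℓ ^ 2 * (4 * (n + 1)) ≤ ℓ ^ 3 * (n ^ 2 * 2048) := by gcongr
      _ = _ := by ring
  have e2 : ℓ ^ 2 / 2048 ≤ numQueries n / (512 * harm n * (n * (n + 1))) := by
    rw [hk, div_le_div_iff₀ (by norm_num) (by positivity)]
    have h4 : (n : ℝ) * (n + 1) ≤ 2 * n ^ 2 := by nlinarith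
    calc ℓ ^ 2 * (512 * harm n * (n * (n + 1))) ≤ ℓ ^ 2 * (512 * (2 * ℓ) * (2 * n ^ 2)) := by gcongr
      _ = _ := by ring
  have f1 := Real.exp_le_exp.2 (neg_le_neg e1)
  have f2 := Real.exp_le_exp.2 (neg_le_neg e2)
  unfold codeError
  linarith

/-- The threshold is `6144 = 3 * 2048`: beyond it `ℓ ^ 2 / 2048 ≥ 3 log n`, so the error is at most
`6 / n ^ 3`. -/
theorem sq_mul_codeError_le {n : ℕ} (hn : 0 < n) (h : 6144 ≤ Real.log n) :
    codeError (numQueries n) n * (n : ℝ) ^ 2 ≤ 6 * (1 / n) := by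
  have hn' : (0 : ℝ) < n := by exact_mod_cast hn
  have h1 := codeError_le hn
  have h2 := log_le_natLog_succ n
  set ℓ : ℝ := ((Nat.log 2 n + 1 : ℕ) : ℝ) with hℓ
  have h3 : (n : ℝ) ^ 2 = Real.exp (2 * Real.log n) := by
    rw [two_mul, Real.exp_add, Real.exp_log hn', sq]
  have h4 : 1 / (n : ℝ) = Real.exp (-Real.log n) := by
    rw [Real.exp_neg, Real.exp_log hn', one_div]
  rw [h4]
  calc codeError (numQueries n) n * (n : ℝ) ^ 2 ≤
        6 * Real.exp (-(ℓ ^ 2 / 2048)) * Real.exp (2 * Real.log n) := by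
        rw [h3]
        gcongr
    _ = 6 * Real.exp (2 * Real.log n - ℓ ^ 2 / 2048) := by
        rw [mul_assoc, ← Real.exp_add]
        ring_nf
    _ ≤ 6 * Real.exp (-Real.log n) := by
        gcongr
        nlinarith

theorem MonomialGrowth.tendsto_codeError {n : ℕ → ℕ} (h : MonomialGrowth n) :
    Tendsto (fun κ => codeError (numQueries (n κ)) (n κ) * (n κ : ℝ) ^ 2) atTop (nhds 0) := by
  have hn : Tendsto (fun κ => (n κ : ℝ)) atTop atTop := tendsto_natCast_atTop_atTop.comp h.tendsto
  have h1 : Tendsto (fun κ => 6 * (1 / (n κ : ℝ))) atTop (nhds 0) := by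
    simpa using (tendsto_inv_atTop_zero.comp hn).const_mul 6
  refine squeeze_zero' (.of_forall fun κ => ?_) ?_ h1
  · unfold codeError
    positivity
  · filter_upwards [h.tendsto.eventually_gt_atTop 0,
      (Real.tendsto_log_atTop.comp hn).eventually_ge_atTop 6144] with κ h2 h3
    exact sq_mul_codeError_le h2 h3

theorem MonomialGrowth.isLittleO_of_tendsto {n : ℕ → ℕ} (h : MonomialGrowth n) {f : ℕ → ℝ}
    (hf : Tendsto (fun κ => f κ * (n κ : ℝ) ^ 2) atTop (nhds 0)) :
    f =o[atTop] fun κ => 1 / (n κ : ℝ) ^ 2 := by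
  refine isLittleO_of_tendsto' ?_ (hf.congr fun κ => by simp)
  filter_upwards [h.tendsto.eventually_gt_atTop 0] with κ hκ h0
  have : (n κ : ℝ) ≠ 0 := by exact_mod_cast hκ.ne'
  simp [this] at h0

/-- The error terms that do not depend on the adversary. -/
theorem MonomialGrowth.isLittleO_collision {n : ℕ → ℕ} (h : MonomialGrowth n) :
    (fun κ => (n κ : ℝ) ^ 2 / 2 ^ (κ - κ / 2)) =o[atTop] fun κ => 1 / (n κ : ℝ) ^ 2 := by
  refine h.isLittleO_of_tendsto ((h.pbdd.pow 4).tendsto_div_two_pow.congr fun κ => ?_)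
  push_cast
  ring

theorem MonomialGrowth.isLittleO_codeError {n : ℕ → ℕ} (h : MonomialGrowth n) :
    (fun κ => codeError (numQueries (n κ)) (n κ)) =o[atTop] fun κ => 1 / (n κ : ℝ) ^ 2 :=
  h.isLittleO_of_tendsto h.tendsto_codeError

theorem MonomialGrowth.isLittleO_half {n : ℕ → ℕ} (h : MonomialGrowth n) {ε : ℕ → ℝ}
    (hε : ε =o[atTop] fun κ => 1 / (n κ : ℝ) ^ 2) :
    (fun κ => ε (κ / 2)) =o[atTop] fun κ => 1 / (n κ : ℝ) ^ 2 := by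
  refine (hε.comp_tendsto tendsto_div_two).trans_isBigO ?_
  obtain ⟨C, hC⟩ := h.eventually_le_half
  refine IsBigO.of_bound ((C : ℝ) ^ 2) ?_
  filter_upwards [hC, h.tendsto.eventually_gt_atTop 0] with κ h1 h2
  have h3 : (0 : ℝ) < n κ := by exact_mod_cast h2
  have h4 : (0 : ℝ) < n (κ / 2) := by
    have : n (κ / 2) ≠ 0 := fun h0 => by
      rw [h0] at h1
      omega
    exact_mod_cast Nat.pos_of_ne_zero this
  have h5 : (n κ : ℝ) ≤ C * n (κ / 2) := by exact_mod_cast h1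
  simp only [Function.comp]
  rw [Real.norm_of_nonneg (by positivity), Real.norm_of_nonneg (by positivity), mul_one_div,
    div_le_div_iff₀ (by positivity) (by positivity), one_mul, ← mul_pow]
  gcongr

/-- The logarithmic factor is that of `n ^ 2`, and `Nat.log 2 n + 1 ≤ 2 log (n ^ 2)` as soon as `log
n ≥ 1`. Its cube accounts for the constant `2 ^ 3`. -/
theorem MonomialGrowth.isSoftO_numQueries {n : ℕ → ℕ} (h : MonomialGrowth n) :
    IsSoftO (fun κ => (numQueries (n κ) : ℝ)) fun κ => (n κ : ℝ) ^ 2 := by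
  refine ⟨3, IsBigO.of_bound (2 ^ 3) ?_⟩
  have hn : Tendsto (fun κ => (n κ : ℝ)) atTop atTop := tendsto_natCast_atTop_atTop.comp h.tendsto
  filter_upwards [h.tendsto.eventually_gt_atTop 0,
    (Real.tendsto_log_atTop.comp hn).eventually_ge_atTop 1] with κ h1 h2
  simp only [Function.comp] at h2
  have h3 : (Nat.log 2 (n κ) : ℝ) * Real.log 2 ≤ Real.log (n κ) := by
    rw [← Real.log_pow]
    exact Real.log_le_log (by positivity) (by exact_mod_cast Nat.pow_log_le_self 2 h1.ne')
  have h4 := Real.log_two_gt_d9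
  have h5 : ((Nat.log 2 (n κ) + 1 : ℕ) : ℝ) ≤ 2 * Real.log ((n κ : ℝ) ^ 2) := by
    rw [Real.log_pow]
    push_cast
    nlinarith [(Nat.cast_nonneg (Nat.log 2 (n κ)) : (0 : ℝ) ≤ Nat.log 2 (n κ))]
  have h6 : (0 : ℝ) ≤ Real.log ((n κ : ℝ) ^ 2) := by
    rw [Real.log_pow]
    push_cast
    linarith
  rw [Real.norm_of_nonneg (by positivity), Real.norm_of_nonneg (by positivity)]
  calc (numQueries (n κ) : ℝ) = (n κ : ℝ) ^ 2 * ((Nat.log 2 (n κ) + 1 : ℕ) : ℝ) ^ 3 := by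
        unfold numQueries
        push_cast
        rfl
    _ ≤ (n κ : ℝ) ^ 2 * (2 * Real.log ((n κ : ℝ) ^ 2)) ^ 3 := by gcongr
    _ = _ := by ring

theorem MonomialGrowth.isSoftO_add_one {n : ℕ → ℕ} (h : MonomialGrowth n) :
    IsSoftO (fun κ => ((n κ + 1 : ℕ) : ℝ)) fun κ => (n κ : ℝ) := by
  refine ⟨0, IsBigO.of_bound 2 ?_⟩
  filter_upwards [h.tendsto.eventually_gt_atTop 0] with κ h1
  have h2 : (1 : ℝ) ≤ n κ := by exact_mod_cast h1
  rw [pow_zero, mul_one, Real.norm_of_nonneg (by positivity), Real.norm_of_nonneg (by positivity)]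
  push_cast
  linarith

/-! ### Security and the conclusion -/

section

variable {M : AdversaryModel} {n : ℕ → ℕ} {G : (κ : ℕ) → Bits κ → Bits (n κ ^ 7)}

/-- The failure probability is at most `2 n β`, where `β` collects label collisions, unavailability,
the error of the code and the distinguishing advantage, all `o(1 / n ^ 2)`. -/
theorem SchemePrograms.secure (hgrow : MonomialGrowth n) {ε : ℕ → ℝ} {L : ℕ}
    (hε : ε =o[atTop] fun κ => 1 / (n κ : ℝ) ^ 2) (hG : IsLocalPRG M ε (fun κ => n κ ^ 7) L G)
    (SP : SchemePrograms G) : SP.scheme.Secure M := by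
  intro P hP S hS
  obtain ⟨δ, hδ, hav⟩ := hP
  have hav' : ∀ κ (sk : Fin (n κ) → Bits κ) (S : Finset (Fin (n κ))), n κ ≤ S.card + 1 → ∀ c,
      prob (fun ω => ∃ (j : Fin (numQueries (n κ))) (b : Bool),
        (∀ i ∈ S, decBit G κ (sk i) (c j) = b) ∧ P.strategy κ ω (keysOf S sk) c j ≠ b) ≤ δ κ := hav
  have hδ0 : ∀ κ, 0 ≤ δ κ := fun κ =>
    prob_nonneg.trans (hav' κ (fun _ _ => false) Finset.univ (by simp) fun _ _ => false)
  -- Two consecutive security parameters share the seed length `κ / 2`, so each parity of `κ` gets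
  -- its own distinguisher.
  have hdist : ∀ r, r = 0 ∨ r = 1 → ∃ A : Distinguisher M fun κ => n κ ^ 7,
      ∀ᶠ κ in atTop, κ % 2 = r → coinBound n P.e κ ≤ (n (κ / 2) ^ 7 + 2) ^ A.e ∧
        (∀ ω y, A.run (κ / 2) ω y = true ↔ Simulates G P.strategy κ ω y) ∧
        A.advantage G (κ / 2) ≤ ε (κ / 2) := fun r hr => by
    obtain ⟨A, hA1, hA2⟩ := exists_distinguisher (M := M) (run := P.strategy) hG.efficient
      hgrow.pbdd hgrow.pbdd_pow_seven hr P.advice_ok P.computes (hgrow.pbdd.coinBound P.e r)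
    refine ⟨A, ?_⟩
    filter_upwards [MonomialGrowth.tendsto_div_two.eventually (hG.pseudorandom A)] with κ h1 h2
    have hκ : 2 * (κ / 2) + r = κ := by omega
    refine ⟨?_, fun ω y => ?_, h1⟩
    · have := hA1 (κ / 2)
      rwa [hκ] at this
    · exact (hA2 (κ / 2) ω y).trans (simulates_bitAt hκ ω y)
  obtain ⟨A0, hA0⟩ := hdist 0 (.inl rfl)
  obtain ⟨A1, hA1⟩ := hdist 1 (.inr rfl)
  have hB : ∀ᶠ κ in atTop, (n κ + 1) ^ 2 * numQueries (n κ) ≤ 2 ^ κ :=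
    (((hgrow.pbdd.add (.const _ 1)).pow 2).mul hgrow.pbdd.numQueries).eventually_le_two_pow
  let β : ℕ → ℝ := fun κ => (n κ : ℝ) ^ 2 / 2 ^ (κ - κ / 2) +
    (δ κ + codeError (numQueries (n κ)) (n κ)) + ε (κ / 2)
  have hβ : β =o[atTop] fun κ => 1 / (n κ : ℝ) ^ 2 :=
    (hgrow.isLittleO_collision.add (hδ.add hgrow.isLittleO_codeError)).add (hgrow.isLittleO_half hε)
  have hbound : ∀ᶠ κ in atTop, SP.scheme.failure P κ (S κ) ≤ 2 * n κ * β κ := by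
    filter_upwards [hA0, hA1, hB, hgrow.numQueries_le_pow,
      hgrow.tendsto.eventually_gt_atTop 0] with κ h0 h1 h2 h3 h4
    obtain ⟨A, hcoin, hrun, hadv⟩ : ∃ A : Distinguisher M fun κ => n κ ^ 7,
        coinBound n P.e κ ≤ (n (κ / 2) ^ 7 + 2) ^ A.e ∧
        (∀ ω y, A.run (κ / 2) ω y = true ↔ Simulates G P.strategy κ ω y) ∧
        A.advantage G (κ / 2) ≤ ε (κ / 2) := by
      rcases Nat.mod_two_eq_zero_or_one κ with h | h
      · exact ⟨A0, h0 h⟩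
      · exact ⟨A1, h1 h⟩
    have key := fun i => (prob_accuses_le_advantage (i := i) hcoin hrun h3 h2 (hδ0 κ)
      (hav' κ)).trans (mul_le_mul_of_nonneg_left (add_le_add_right hadv _)
        (by positivity : (0 : ℝ) ≤ 2 * n κ))
    exact failure_le SP P h4 (hS κ) (prob_nonneg.trans (key ⟨0, h4⟩)) key
  -- Guessing the user uses up one of the two powers of `n`.
  have hfinal : (fun κ => 2 * n κ * β κ) =o[atTop] fun κ => 1 / (n κ : ℝ) := by
    have h1 := ((isBigO_refl (fun κ => 2 * (n κ : ℝ)) atTop).mul_isLittleO hβ)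
    refine h1.trans_isBigO (IsBigO.of_bound 2 ?_)
    filter_upwards [hgrow.tendsto.eventually_gt_atTop 0] with κ h
    have h2 : (n κ : ℝ) ≠ 0 := by exact_mod_cast h.ne'
    rw [Real.norm_of_nonneg (by positivity), Real.norm_of_nonneg (by positivity)]
    refine le_of_eq ?_
    field_simp
  refine (IsBigO.of_bound 1 ?_).trans_isLittleO hfinal
  filter_upwards [hbound] with κ h
  have h0 : 0 ≤ SP.scheme.failure P κ (S κ) := prob_nonneg
  rw [one_mul, Real.norm_of_nonneg h0, Real.norm_of_nonneg (h0.trans h)]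
  exact h

end

theorem corollary5p9 (M : AdversaryModel) (p : ℚ[X]) (hp : 0 < p.natDegree)
    (n : ℕ → ℕ) (hn : ∀ κ : ℕ, (n κ : ℚ) = p.eval (κ : ℚ))
    (hPRG : ∃ (L : ℕ) (ε : ℕ → ℝ) (G : (κ : ℕ) → Bits κ → Bits (n κ ^ 7)),
      ε =o[atTop] (fun κ => 1 / (n κ : ℝ) ^ 2) ∧ IsLocalPRG M ε (fun κ => n κ ^ 7) L G) :
    ∃ (k : ℕ → ℕ) (T : TTScheme n k),
      IsSoftO (fun κ => (k κ : ℝ)) (fun κ => (n κ : ℝ) ^ 2) ∧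
      T.Secure M ∧
      ∃ (s u v : ℕ → ℕ), T.DecCircuits s 6 ∧ (∀ κ, s κ ≤ u κ * v κ) ∧
        IsSoftO (fun κ => (u κ : ℝ)) (fun κ => (n κ : ℝ)) ∧
        ∃ d : ℕ, ∀ κ, v κ ≤ (κ + 2) ^ d := by
  obtain ⟨L, ε, G, hε, hG⟩ := hPRG
  have hgrow := monomialGrowth_of_polynomial hp hn
  obtain ⟨SP⟩ := SchemePrograms.nonempty hG.efficient hgrow.pbdd
  refine ⟨fun κ => numQueries (n κ), SP.scheme, hgrow.isSoftO_numQueries, SP.secure hgrow hε hG, ?_⟩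
  let v : ℕ → ℕ := fun κ => 2 * κ + 2 ^ L * (κ + L + 2) + 1
  have hv : PBdd id v := (((PBdd.const _ 2).mul (.self _)).add ((PBdd.const _ (2 ^ L)).mul
    (((PBdd.self _).add (.const _ L)).add (.const _ 2)))).add (.const _ 1)
  obtain ⟨d, hd⟩ := hv
  -- The factor is `n κ + 1` because `n κ` may vanish for small `κ`, where the circuits still have
  -- positive size bounds.
  refine ⟨fun κ => (n κ + 1) * v κ, fun κ => n κ + 1, v, fun κ c => ?_, fun κ => le_rfl,
    hgrow.isSoftO_add_one, d, hd⟩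
  obtain ⟨C, h1, h2, h3⟩ := exists_circuit_decBit hG.isLocal κ c
  refine ⟨C, h1.trans ?_, h2.trans (by norm_num), h3⟩
  have hL : 1 ≤ 2 ^ L := Nat.one_le_two_pow
  calc 2 * κ + (n κ * 2 ^ L + 1) * (κ + L + 2) + 1 ≤
      2 * κ + (n κ * 2 ^ L + 2 ^ L) * (κ + L + 2) + 1 := by gcongr
    _ ≤ (n κ + 1) * (2 * κ) + (n κ + 1) * (2 ^ L * (κ + L + 2)) + (n κ + 1) := by
        have h : (n κ * 2 ^ L + 2 ^ L) * (κ + L + 2) = (n κ + 1) * (2 ^ L * (κ + L + 2)) := by ring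
        have h' : 2 * κ ≤ (n κ + 1) * (2 * κ) := Nat.le_mul_of_pos_left _ (Nat.succ_pos _)
        omega
    _ = (n κ + 1) * v κ := by
        simp only [v]
        ring
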